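/- Let $X$ be a paracompact Hausdorff space with a continuous involution $\tau\colon x\mapsto\bar x$, and let $A^0$ be a unital real $C^*$-algebra (a Banach $*$-algebra over $\mathbb R$ that is isometrically $*$-isomorphic to a norm-closed algebra of bounded operators on a real Hilbert space). Let $\mathcal A^0$ be a locally trivial bundle of $*$-algebras on $X$ with fibre $A^0$, with an involution $a\mapsto\bar a$ covering $\tau$ by $*$-isomorphisms $\mathcal A^0_x\to\mathcal A^0_{\bar x}$ (for the trivial bundle $X\times A^0$ one may take $(x,a)\mapsto(\bar x,a)$). *Definitions.* A Real algebra bundle $\mathcal B$ on $X$ is a locally trivial bundle of $\mathbb R$-algebras with an involution $b\mapsto\bar b$ which restricts to algebra isomorphisms $\mathcal B_x\to\mathcal B_{\bar x}$. A Real $\mathcal B$-bundle is a locally trivial bundle $E$ of finitely generated projective left $\mathcal B$-modules with an involution $\tau$ that maps $E_x$ to $E_{\bar x}$ and satisfies $\tau(be)=\bar b\,\tau(e)$; isomorphisms are bundle isomorphisms that are $\mathcal B$-linear and commute with $\tau$. $KR^{\mathcal B}(X)$ is the Grothendieck group of Real $\mathcal B$-bundles under direct sum. If $\mathcal B$ has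 an anti-involution $\ast$ commuting with its involution, an $\varepsilon$-symmetric form ($\varepsilon=\pm1$) on $E$ is an isomorphism $\varphi\colon E\to E^*=\operatorname{Hom}_{\mathcal B}(E,\mathcal B)$ of Real $\mathcal B$-bundles, where $b\in\mathcal B_x$ acts on $f\in E^*_x$ by $e\mapsto f(e)b^*$, with $\varphi(w)v=\varepsilon\,(\varphi(v)w)^*$; and ${}_\varepsilon GR^{\mathcal B}(X)$ is the Grothendieck group of $\varepsilon$-symmetric forms $(E,\varphi)$ under orthogonal sum. Let $\mathcal A=\mathcal A^0\otimes_{\mathbb R}\mathbb C$ with the involution $a\otimes z\mapsto\bar a\otimes\bar z$ and the anti-involution $a\otimes z\mapsto a^*\otimes z$. Let $\mathcal A^+=\mathcal A^0\otimes_{\mathbb R}M_2(\mathbb R)$ and $\mathcal A^-=\mathcal A^0\otimes_{\mathbb R}\mathbb H$. In $M_2(\mathbb R)$ put $i=\begin{pmatrix}0&-1\\1&0\end{pmatrix}$ and $j=\begin{pmatrix}1&0\\0&-1\end{pmatrix}$; in $\mathbb H$ let $i,j$ be the usual elements. Thus $\mathcal A\subset\mathcal A^\pm$, $ij=-ji$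 and $j^2=\pm1$. Give $\mathcal A^\pm$ the involution $a\otimes d\mapsto\bar a\otimes jdj^{-1}$, which extends that of $\mathcal A$ and fixes $j$. **Theorem.** There are canonical group isomorphisms $$ {}_{+1}GR^{\mathcal A}(X)\cong KR^{\mathcal A^{+}}(X),\qquad {}_{-1}GR^{\mathcal A}(X)\cong KR^{\mathcal A^{-}}(X). $$ "Canonical" means the following. Let $\varepsilon=\pm1$. Say that an $\varepsilon$-symmetric form $(E,\varphi)$ on a Real $\mathcal A$-bundle and a Real $\mathcal A^{\varepsilon}$-bundle $F$ correspond if $E$ is isomorphic, as a Real $\mathcal A$-bundle, to the restriction of $F$ to $\mathcal A$ in such a way that $\varphi(v)w=\langle jv,w\rangle$ for some Hermitian metric $\langle\ ,\ \rangle$ on $E$ compatible with $\tau$, i.e. some $(+1)$-symmetric form for the anti-involution $(a\otimes z)^*=a^*\otimes\bar z$ such that every $\langle v,v\rangle$ has the form $c^*c$. Then every $(E,\varphi)$ corresponds to some $F$, every $F$ corresponds to some $(E,\varphi)$, and there is exactly one isomorphism ${}_{\varepsilon}GR^{\mathcal A}(X)\cong KR^{\mathcal A^{\varepsilon}}(X)$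 that sends $[(E,\varphi)]$ to $[F]$ whenever $(E,\varphi)$ and $F$ correspond. In particular, let ${}_{-1}GR(X)$ be the group ${}_{-1}GR^{\mathcal A}(X)$ for the trivial bundle $\mathcal A=X\times\mathbb C$ with involution $(x,z)\mapsto(\bar x,\bar z)$ and the identity as anti-involution, and let $KR^{\mathbb H}(X)$ be the group $KR^{\mathcal B}(X)$ for $\mathcal B=X\times\mathbb H$ with involution $(x,q)\mapsto(\bar x,iqi^{-1})$. Then ${}_{-1}GR(X)\cong KR^{\mathbb H}(X)$. -/

import Mathlib

open scoped TensorProduct Quaternion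

universe u v

noncomputable section

namespace RealKTheory

/-! ### Spaces with involution, total spaces -/

/-- A space with involution `x ↦ bar x`, i.e. a space with an action of `G = {1, τ}`. -/
class InvolutiveSpace (X : Type u) [TopologicalSpace X] where
  bar : X → X
  bar_bar : ∀ x, bar (bar x) = x
  continuous_bar : Continuous bar

/-- Total space of a family. It carries no topology by default: the topology of a bundle
is part of its structure. -/
abbrev Tot {X : Type u} (E : X → Type v) : Type (max u v) := Bundle.TotalSpace Unit E

/-- The total space of a fibrewise product is the fibre product of the total spaces. -/
instance totProdTopology {X : Type u} (E F : X → Type v)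
    [TopologicalSpace (Tot E)] [TopologicalSpace (Tot F)] :
    TopologicalSpace (Tot fun x => E x × F x) :=
  TopologicalSpace.induced
    (fun p => ((⟨p.proj, p.snd.1⟩ : Tot E), (⟨p.proj, p.snd.2⟩ : Tot F))) inferInstance

section TotProd

variable {X : Type u} {Y : Type*} [TopologicalSpace Y] {E F : X → Type v}
  [TopologicalSpace (Tot E)] [TopologicalSpace (Tot F)]

theorem continuous_tot_prod {f : Y → Tot fun x => E x × F x} :
    Continuous f ↔ Continuous (fun y => (⟨(f y).proj, (f y).snd.1⟩ : Tot E)) ∧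
      Continuous (fun y => (⟨(f y).proj, (f y).snd.2⟩ : Tot F)) := by
  rw [continuous_induced_rng, ← continuous_prodMk]
  rfl

theorem continuous_tot_fst :
    Continuous fun p : Tot (fun x => E x × F x) => (⟨p.proj, p.snd.1⟩ : Tot E) :=
  (continuous_tot_prod.1 continuous_id).1

theorem continuous_tot_snd :
    Continuous fun p : Tot (fun x => E x × F x) => (⟨p.proj, p.snd.2⟩ : Tot F) :=
  (continuous_tot_prod.1 continuous_id).2

end TotProd

/-- The total space `X × A` of the trivial bundle. -/
@[reducible] def trivialTopology (X : Type u) [TopologicalSpace X] (A : Type v) [TopologicalSpace A] :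
    TopologicalSpace (Tot fun _ : X => A) :=
  TopologicalSpace.induced (fun p => (p.proj, p.snd)) inferInstance

theorem continuous_trivial {X : Type u} [TopologicalSpace X] {A : Type v} [TopologicalSpace A]
    {Y : Type*} [TopologicalSpace Y] {f : Y → Tot fun _ : X => A} :
    @Continuous _ _ _ (trivialTopology X A) f ↔
      Continuous (fun y => (f y).proj) ∧ Continuous (fun y => (f y).snd) := by
  rw [← continuous_prodMk]
  exact continuous_induced_rng

theorem trivial_ext {X : Type u} {A : Type v} {x y : X} (h : x = y) {a b : A} (h' : a = b) :
    (⟨x, a⟩ : Tot fun _ : X => A) = ⟨y, b⟩ := by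
  subst h h'
  rfl

/-! ### Bundles of algebras -/

/-- A local trivialization of a family of `ℝ`-algebras with model algebra `A`:
an open set `base`, algebra isomorphisms of the fibres over `base` with `A`, such that the
resulting bijection from the part of the total space over `base` to `base × A` is a
homeomorphism. -/
structure AlgebraChart {X : Type u} [TopologicalSpace X] (fiber : X → Type v)
    [∀ x, Ring (fiber x)] [∀ x, Algebra ℝ (fiber x)] [TopologicalSpace (Tot fiber)]
    (A : Type v) [Ring A] [Algebra ℝ A] [TopologicalSpace A] where
  base : Set X
  isOpen_base : IsOpen base
  iso : ∀ x : base, fiber x ≃ₐ[ℝ] A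
  continuous_iso : Continuous fun p : {p : Tot fiber // p.proj ∈ base} =>
    iso ⟨p.1.proj, p.2⟩ p.1.snd
  continuous_symm : Continuous fun q : base × A =>
    (⟨q.1, (iso q.1).symm q.2⟩ : Tot fiber)

open InvolutiveSpace in
/-- A Real algebra bundle with fibre `A`: a locally trivial bundle of `ℝ`-algebras with fibre `A`
and an involution `conj` covering `bar`, which is an algebra isomorphism on fibres.
(`continuous_add` records that fibrewise addition is continuous, which holds in the charts
whenever it holds in `A`.) -/
structure RealAlgebraBundle (X : Type u) [TopologicalSpace X] [InvolutiveSpace X]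
    (A : Type v) [Ring A] [Algebra ℝ A] [TopologicalSpace A] where
  fiber : X → Type v
  [ring : ∀ x, Ring (fiber x)]
  [algebra : ∀ x, Algebra ℝ (fiber x)]
  [topology : TopologicalSpace (Tot fiber)]
  continuous_proj : Continuous fun p : Tot fiber => p.proj
  chartAt : X → AlgebraChart fiber A
  mem_chartAt : ∀ x, x ∈ (chartAt x).base
  continuous_add : Continuous fun p : Tot (fun x => fiber x × fiber x) =>
    (⟨p.proj, p.snd.1 + p.snd.2⟩ : Tot fiber)
  conj : ∀ x, fiber x →ₐ[ℝ] fiber (bar x)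
  conj_conj : ∀ x a, (⟨bar (bar x), conj (bar x) (conj x a)⟩ : Tot fiber) = ⟨x, a⟩
  continuous_conj : Continuous fun p : Tot fiber =>
    (⟨bar p.proj, conj p.proj p.snd⟩ : Tot fiber)

attribute [instance] RealAlgebraBundle.ring RealAlgebraBundle.algebra RealAlgebraBundle.topology

open InvolutiveSpace

section Bundles

variable {X : Type u} [TopologicalSpace X] [InvolutiveSpace X]

section
variable {A : Type v} [Ring A] [Algebra ℝ A] [TopologicalSpace A]

/-- An anti-involution of a Real algebra bundle: a continuous family of `ℝ`-linear
anti-automorphisms of order two of the fibres, commuting with the involution. -/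
structure AntiInvolution (𝒜 : RealAlgebraBundle X A) where
  star : ∀ x, 𝒜.fiber x →ₗ[ℝ] 𝒜.fiber x
  star_mul : ∀ x a b, star x (a * b) = star x b * star x a
  star_star : ∀ x a, star x (star x a) = a
  star_conj : ∀ x a, star (bar x) (𝒜.conj x a) = 𝒜.conj x (star x a)
  continuous_star : Continuous fun p : Tot 𝒜.fiber => (⟨p.proj, star p.proj p.snd⟩ : Tot 𝒜.fiber)

end

/-! ### Finitely generated projective modules and module bundles -/

/-- A finitely generated projective `A`-module with its canonical topology: a topological
module which is a retract of some `Aⁿ` through continuous `A`-linear maps. -/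
structure FGProjective (A : Type v) [Ring A] [TopologicalSpace A] where
  carrier : Type v
  [addCommGroup : AddCommGroup carrier]
  [module : Module A carrier]
  [topology : TopologicalSpace carrier]
  rank : ℕ
  incl : carrier →L[A] (Fin rank → A)
  retr : (Fin rank → A) →L[A] carrier
  retr_incl : ∀ m, retr (incl m) = m

attribute [instance] FGProjective.addCommGroup FGProjective.module FGProjective.topology

variable {A : Type v} [Ring A] [Algebra ℝ A] [TopologicalSpace A]

/-- A local trivialization of a family of `𝒜`-modules over an open subset of the domain of a
chart `c` of `𝒜`: the fibres are identified with a fixed `A`-module `M`, linearly over the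
identification `c` of the fibres of `𝒜` with `A`, and homeomorphically on total spaces. -/
structure ModuleChart (𝒜 : RealAlgebraBundle X A) (fiber : X → Type v)
    [∀ x, AddCommGroup (fiber x)] [∀ x, Module (𝒜.fiber x) (fiber x)]
    [TopologicalSpace (Tot fiber)] (c : AlgebraChart 𝒜.fiber A) (M : FGProjective A) where
  base : Set X
  isOpen_base : IsOpen base
  base_subset : base ⊆ c.base
  iso : ∀ x : base, fiber x ≃+ M.carrier
  iso_smul : ∀ (x : base) (a : 𝒜.fiber x) (e : fiber x),
    iso x (a • e) = c.iso ⟨x, base_subset x.2⟩ a • iso x e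
  continuous_iso : Continuous fun p : {p : Tot fiber // p.proj ∈ base} =>
    iso ⟨p.1.proj, p.2⟩ p.1.snd
  continuous_symm : Continuous fun q : base × M.carrier =>
    (⟨q.1, (iso q.1).symm q.2⟩ : Tot fiber)

/-- A Real `𝒜`-bundle: a locally trivial bundle of finitely generated projective `𝒜`-modules
(the model module may vary with the point) with an involution covering `bar` which is
twisted `𝒜`-linear. -/
structure RealBundle (𝒜 : RealAlgebraBundle X A) where
  fiber : X → Type v
  [addCommGroup : ∀ x, AddCommGroup (fiber x)]
  [module : ∀ x, Module (𝒜.fiber x) (fiber x)]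
  [topology : TopologicalSpace (Tot fiber)]
  continuous_proj : Continuous fun p : Tot fiber => p.proj
  exists_chart : ∀ x, ∃ (M : FGProjective A) (c : ModuleChart 𝒜 fiber (𝒜.chartAt x) M),
    x ∈ c.base
  conj : ∀ x, fiber x →+ fiber (bar x)
  conj_smul : ∀ x (a : 𝒜.fiber x) e, conj x (a • e) = 𝒜.conj x a • conj x e
  conj_conj : ∀ x e, (⟨bar (bar x), conj (bar x) (conj x e)⟩ : Tot fiber) = ⟨x, e⟩
  continuous_conj : Continuous fun p : Tot fiber =>
    (⟨bar p.proj, conj p.proj p.snd⟩ : Tot fiber)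

attribute [instance] RealBundle.addCommGroup RealBundle.module RealBundle.topology

variable {𝒜 : RealAlgebraBundle X A}

/-- Isomorphisms of Real `𝒜`-bundles. -/
structure RealBundle.Iso (E F : RealBundle 𝒜) where
  equiv : ∀ x, E.fiber x ≃ₗ[𝒜.fiber x] F.fiber x
  continuous_toFun : Continuous fun p : Tot E.fiber => (⟨p.proj, equiv p.proj p.snd⟩ : Tot F.fiber)
  continuous_invFun : Continuous fun p : Tot F.fiber =>
    (⟨p.proj, (equiv p.proj).symm p.snd⟩ : Tot E.fiber)
  map_conj : ∀ x e, equiv (bar x) (E.conj x e) = F.conj x (equiv x e)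

namespace RealBundle.Iso

variable {E F H E' F' : RealBundle 𝒜}

def refl (E : RealBundle 𝒜) : Iso E E where
  equiv _ := LinearEquiv.refl _ _
  continuous_toFun := continuous_id
  continuous_invFun := continuous_id
  map_conj _ _ := rfl

def symm (f : Iso E F) : Iso F E where
  equiv x := (f.equiv x).symm
  continuous_toFun := f.continuous_invFun
  continuous_invFun := f.continuous_toFun
  map_conj x e := by
    rw [LinearEquiv.symm_apply_eq, f.map_conj, LinearEquiv.apply_symm_apply]

def trans (f : Iso E F) (g : Iso F H) : Iso E H where
  equiv x := (f.equiv x).trans (g.equiv x)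
  continuous_toFun := g.continuous_toFun.comp f.continuous_toFun
  continuous_invFun := f.continuous_invFun.comp g.continuous_invFun
  map_conj x e := by simp [f.map_conj, g.map_conj]

end RealBundle.Iso

/-! ### Whitney sums -/

/-- Direct sum of finitely generated projective modules. -/
def FGProjective.prod (M N : FGProjective A) : FGProjective A where
  carrier := M.carrier × N.carrier
  rank := M.rank + N.rank
  incl :=
    { toFun := fun p => Fin.append (M.incl p.1) (N.incl p.2)
      map_add' := fun p q => by
        ext i
        refine Fin.addCases (fun i => ?_) (fun i => ?_) i <;> simp
      map_smul' := fun a p => by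
        ext i
        refine Fin.addCases (fun i => ?_) (fun i => ?_) i <;> simp
      cont := by
        refine continuous_pi fun i => ?_
        refine Fin.addCases (fun i => ?_) (fun i => ?_) i
        · simpa [Function.comp_def] using
            (continuous_apply i).comp (M.incl.continuous.comp continuous_fst)
        · simpa [Function.comp_def] using
            (continuous_apply i).comp (N.incl.continuous.comp continuous_snd) }
  retr :=
    { toFun := fun f => (M.retr fun i => f (Fin.castAdd _ i), N.retr fun i => f (Fin.natAdd _ i))
      map_add' := fun f g => Prod.ext (map_add M.retr _ _) (map_add N.retr _ _)
      map_smul' := fun a f => Prod.ext (map_smul M.retr _ _) (map_smul N.retr _ _)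
      cont := by
        refine Continuous.prodMk (M.retr.continuous.comp ?_) (N.retr.continuous.comp ?_) <;>
          exact continuous_pi fun i => continuous_apply _ }
  retr_incl p := by
    obtain ⟨m, n⟩ := p
    simp [M.retr_incl, N.retr_incl]

/-- Whitney sum of Real `𝒜`-bundles. -/
def RealBundle.sum (E F : RealBundle 𝒜) : RealBundle 𝒜 where
  fiber x := E.fiber x × F.fiber x
  continuous_proj := E.continuous_proj.comp continuous_tot_fst
  exists_chart x := by
    obtain ⟨M, c, hc⟩ := E.exists_chart x
    obtain ⟨N, d, hd⟩ := F.exists_chart x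
    refine ⟨M.prod N, ⟨c.base ∩ d.base, c.isOpen_base.inter d.isOpen_base,
      fun y hy => c.base_subset hy.1,
      fun y => (c.iso ⟨y, y.2.1⟩).prodCongr (d.iso ⟨y, y.2.2⟩), ?_, ?_, ?_⟩, hc, hd⟩
    · intro y a e
      exact Prod.ext (c.iso_smul ⟨y, y.2.1⟩ a e.1) (d.iso_smul ⟨y, y.2.2⟩ a e.2)
    · refine Continuous.prodMk ?_ ?_
      · exact c.continuous_iso.comp
          ((continuous_tot_fst.comp continuous_subtype_val).subtype_mk fun p => p.2.1)
      · exact d.continuous_iso.comp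
          ((continuous_tot_snd.comp continuous_subtype_val).subtype_mk fun p => p.2.2)
    · refine continuous_tot_prod.2 ⟨?_, ?_⟩
      · exact c.continuous_symm.comp
          (((continuous_subtype_val.comp continuous_fst).subtype_mk fun p => p.1.2.1).prodMk
            (continuous_fst.comp continuous_snd))
      · exact d.continuous_symm.comp
          (((continuous_subtype_val.comp continuous_fst).subtype_mk fun p => p.1.2.2).prodMk
            (continuous_snd.comp continuous_snd))
  conj x := (E.conj x).prodMap (F.conj x)
  conj_smul x a e := Prod.ext (E.conj_smul x a e.1) (F.conj_smul x a e.2)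
  conj_conj x e := by
    have key : ∀ (y : X) (a : E.fiber y) (b : F.fiber y),
        (⟨y, a⟩ : Tot E.fiber) = ⟨x, e.1⟩ → (⟨y, b⟩ : Tot F.fiber) = ⟨x, e.2⟩ →
        (⟨y, (a, b)⟩ : Tot fun x => E.fiber x × F.fiber x) = ⟨x, e⟩ := by
      intro y a b h1 h2
      cases h1
      cases h2
      rfl
    exact key _ _ _ (E.conj_conj x e.1) (F.conj_conj x e.2)
  continuous_conj := continuous_tot_prod.2
    ⟨E.continuous_conj.comp continuous_tot_fst, F.continuous_conj.comp continuous_tot_snd⟩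

/-- The total space of the zero bundle is `X`. -/
@[reducible] def zeroTopology (X : Type u) [TopologicalSpace X] :
    TopologicalSpace (Tot fun _ : X => PUnit.{v + 1}) :=
  TopologicalSpace.induced (fun p => p.proj) inferInstance

/-- The zero bundle. -/
def RealBundle.zero (𝒜 : RealAlgebraBundle X A) : RealBundle 𝒜 :=
  letI := zeroTopology.{u, v} X
  { fiber := fun _ => PUnit
    continuous_proj := continuous_induced_dom
    exists_chart := fun x => ⟨⟨PUnit, 0, 0, 0, fun _ => rfl⟩,
      { base := (𝒜.chartAt x).base
        isOpen_base := (𝒜.chartAt x).isOpen_base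
        base_subset := subset_rfl
        iso := fun _ => AddEquiv.refl _
        iso_smul := fun _ _ _ => rfl
        continuous_iso := continuous_of_const fun _ _ => rfl
        continuous_symm := continuous_induced_rng.2 (continuous_subtype_val.comp continuous_fst) },
      𝒜.mem_chartAt x⟩
    conj := fun _ => 0
    conj_smul := fun _ _ _ => rfl
    conj_conj := fun x e => by
      have key : ∀ y : X, y = x → ∀ b : PUnit.{v + 1},
          (⟨y, b⟩ : Tot fun _ : X => PUnit.{v + 1}) = ⟨x, e⟩ := by
        rintro y rfl b
        rfl
      exact key _ (bar_bar x) _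
    continuous_conj := continuous_induced_rng.2 (continuous_bar.comp continuous_induced_dom) }

namespace RealBundle.Iso

variable {E F H E' F' : RealBundle 𝒜}

def sumCongr (f : Iso E E') (g : Iso F F') : Iso (E.sum F) (E'.sum F') where
  equiv x := (f.equiv x).prodCongr (g.equiv x)
  continuous_toFun := continuous_tot_prod.2
    ⟨f.continuous_toFun.comp continuous_tot_fst, g.continuous_toFun.comp continuous_tot_snd⟩
  continuous_invFun := continuous_tot_prod.2
    ⟨f.continuous_invFun.comp continuous_tot_fst, g.continuous_invFun.comp continuous_tot_snd⟩
  map_conj x e := Prod.ext (f.map_conj x e.1) (g.map_conj x e.2)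

def sumComm (E F : RealBundle 𝒜) : Iso (E.sum F) (F.sum E) where
  equiv _ := LinearEquiv.prodComm _ _ _
  continuous_toFun := continuous_tot_prod.2 ⟨continuous_tot_snd, continuous_tot_fst⟩
  continuous_invFun := continuous_tot_prod.2 ⟨continuous_tot_snd, continuous_tot_fst⟩
  map_conj _ _ := rfl

def sumAssoc (E F H : RealBundle 𝒜) : Iso ((E.sum F).sum H) (E.sum (F.sum H)) where
  equiv _ := LinearEquiv.prodAssoc _ _ _ _
  continuous_toFun := continuous_tot_prod.2
    ⟨(continuous_tot_fst (E := E.fiber) (F := F.fiber)).comp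
      (continuous_tot_fst (E := (E.sum F).fiber) (F := H.fiber)),
    continuous_tot_prod.2 ⟨(continuous_tot_snd (E := E.fiber) (F := F.fiber)).comp
      (continuous_tot_fst (E := (E.sum F).fiber) (F := H.fiber)),
      continuous_tot_snd (E := (E.sum F).fiber) (F := H.fiber)⟩⟩
  continuous_invFun := continuous_tot_prod.2 ⟨continuous_tot_prod.2 ⟨continuous_tot_fst,
    (continuous_tot_fst (E := F.fiber) (F := H.fiber)).comp
      (continuous_tot_snd (E := E.fiber) (F := (F.sum H).fiber))⟩,
    (continuous_tot_snd (E := F.fiber) (F := H.fiber)).comp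
      (continuous_tot_snd (E := E.fiber) (F := (F.sum H).fiber))⟩
  map_conj _ _ := rfl

def zeroSum (E : RealBundle 𝒜) : Iso ((RealBundle.zero 𝒜).sum E) E where
  equiv _ :=
    { toFun := fun e => e.2
      invFun := fun e => (PUnit.unit, e)
      map_add' := fun _ _ => rfl
      map_smul' := fun _ _ => rfl
      left_inv := fun _ => rfl
      right_inv := fun _ => rfl }
  continuous_toFun :=
    continuous_tot_snd (E := (RealBundle.zero 𝒜).fiber) (F := E.fiber)
  continuous_invFun := continuous_tot_prod.2 ⟨continuous_induced_rng.2 E.continuous_proj,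
    continuous_id⟩
  map_conj _ _ := rfl

end RealBundle.Iso

/-! ### The group `KR^𝒜(X)` -/

instance RealBundle.setoid (𝒜 : RealAlgebraBundle X A) : Setoid (RealBundle 𝒜) where
  r E F := Nonempty (E.Iso F)
  iseqv := ⟨fun E => ⟨.refl E⟩, fun ⟨f⟩ => ⟨f.symm⟩, fun ⟨f⟩ ⟨g⟩ => ⟨f.trans g⟩⟩

/-- Isomorphism classes of Real `𝒜`-bundles. -/
def RealBundle.IsoClass (𝒜 : RealAlgebraBundle X A) := Quotient (RealBundle.setoid 𝒜)

instance (𝒜 : RealAlgebraBundle X A) : Add (RealBundle.IsoClass 𝒜) where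
  add := Quotient.map₂ RealBundle.sum fun _ _ ⟨f⟩ _ _ ⟨g⟩ => ⟨f.sumCongr g⟩

instance (𝒜 : RealAlgebraBundle X A) : Zero (RealBundle.IsoClass 𝒜) where
  zero := Quotient.mk _ (RealBundle.zero 𝒜)

instance (𝒜 : RealAlgebraBundle X A) : AddCommMonoid (RealBundle.IsoClass 𝒜) where
  add_assoc := by
    rintro ⟨a⟩ ⟨b⟩ ⟨c⟩
    exact Quotient.sound ⟨.sumAssoc a b c⟩
  add_comm := by
    rintro ⟨a⟩ ⟨b⟩
    exact Quotient.sound ⟨.sumComm a b⟩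
  zero_add := by
    rintro ⟨a⟩
    exact Quotient.sound ⟨.zeroSum a⟩
  add_zero := by
    rintro ⟨a⟩
    exact Quotient.sound ⟨(RealBundle.Iso.sumComm _ _).trans (.zeroSum a)⟩
  nsmul := nsmulRec

/-- `KR^𝒜(X)`: the Grothendieck group of Real `𝒜`-bundles under Whitney sum. -/
abbrev KR (𝒜 : RealAlgebraBundle X A) := Algebra.GrothendieckAddGroup (RealBundle.IsoClass 𝒜)

/-- The class of a Real `𝒜`-bundle in `KR^𝒜(X)`. -/
def KR.mk (E : RealBundle 𝒜) : KR 𝒜 :=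
  Algebra.GrothendieckAddGroup.of (Quotient.mk (RealBundle.setoid 𝒜) E)

theorem RealAlgebraBundle.continuous_zero (𝒜 : RealAlgebraBundle X A) :
    Continuous fun x : X => (⟨x, 0⟩ : Tot 𝒜.fiber) := by
  refine continuous_iff_continuousAt.2 fun x => ?_
  have h : ContinuousOn (fun x : X => (⟨x, 0⟩ : Tot 𝒜.fiber)) (𝒜.chartAt x).base := by
    rw [continuousOn_iff_continuous_domRestrict]
    refine ((𝒜.chartAt x).continuous_symm.comp
      (continuous_id.prodMk (continuous_const (y := (0 : A))))).congr fun y => ?_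
    simp
  exact h.continuousAt ((𝒜.chartAt x).isOpen_base.mem_nhds (𝒜.mem_chartAt x))

/-! ### Symmetric forms and the group `GR^𝒜(X)` -/

/-- An `ε`-symmetric form on a Real `𝒜`-bundle `E`: an isomorphism `ψ = toDual : E → E^*` of Real
`𝒜`-bundles with `B(v, w) = ψ(v) w` satisfying `B(w, v) = ε B(v, w)^*`. Here `E^*` has fibres
`Hom(E_x, 𝒜_x)`, the element `a` acting by `f ↦ f(-) a^*`. Continuity of `ψ` is
expressed as continuity of `B` on the fibre product of `E` with itself; a continuous fibrewise
bijective `ψ` automatically has a continuous inverse. -/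
structure SymForm {𝒜 : RealAlgebraBundle X A} (s : AntiInvolution 𝒜) (ε : ℤˣ)
    (E : RealBundle 𝒜) where
  toDual : ∀ x, E.fiber x →+ (E.fiber x →ₗ[𝒜.fiber x] 𝒜.fiber x)
  toDual_smul : ∀ x (a : 𝒜.fiber x) v w, toDual x (a • v) w = toDual x v w * s.star x a
  bijective : ∀ x, Function.Bijective (toDual x)
  symm : ∀ x v w, toDual x w v = (ε : ℤ) • s.star x (toDual x v w)
  map_conj : ∀ x v w, toDual (bar x) (E.conj x v) (E.conj x w) = 𝒜.conj x (toDual x v w)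
  continuous_form : Continuous fun p : Tot (fun x => E.fiber x × E.fiber x) =>
    (⟨p.proj, toDual p.proj p.snd.1 p.snd.2⟩ : Tot 𝒜.fiber)

/-- A Real `𝒜`-bundle with an `ε`-symmetric form. -/
structure SymBundle {𝒜 : RealAlgebraBundle X A} (s : AntiInvolution 𝒜) (ε : ℤˣ) where
  bundle : RealBundle 𝒜
  form : SymForm s ε bundle

variable {s : AntiInvolution 𝒜} {ε : ℤˣ}

/-- Isometries. -/
structure SymBundle.Iso (E F : SymBundle s ε) where
  iso : E.bundle.Iso F.bundle
  isometry : ∀ x v w,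
    F.form.toDual x (iso.equiv x v) (iso.equiv x w) = E.form.toDual x v w

namespace SymBundle

/-- Orthogonal sum. -/
def sum (E F : SymBundle s ε) : SymBundle s ε where
  bundle := E.bundle.sum F.bundle
  form :=
    { toDual := fun x =>
        { toFun := fun v => LinearMap.coprod (E.form.toDual x v.1) (F.form.toDual x v.2)
          map_zero' := by
            apply LinearMap.ext
            intro w
            change E.form.toDual x 0 w.1 + F.form.toDual x 0 w.2 = 0
            simp
          map_add' := fun v v' => by
            apply LinearMap.ext
            intro w
            change E.form.toDual x (v.1 + v'.1) w.1 + F.form.toDual x (v.2 + v'.2) w.2 =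
              (E.form.toDual x v.1 w.1 + F.form.toDual x v.2 w.2) +
                (E.form.toDual x v'.1 w.1 + F.form.toDual x v'.2 w.2)
            rw [map_add, map_add, LinearMap.add_apply, LinearMap.add_apply]
            abel }
      toDual_smul := fun x a v w => by
        change E.form.toDual x (a • v.1) w.1 + F.form.toDual x (a • v.2) w.2 =
          (E.form.toDual x v.1 w.1 + F.form.toDual x v.2 w.2) * _
        rw [E.form.toDual_smul, F.form.toDual_smul, add_mul]
      bijective := fun x => by
        constructor
        · intro v v' h
          refine Prod.ext ((E.form.bijective x).1 ?_) ((F.form.bijective x).1 ?_)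
          · apply LinearMap.ext
            intro w
            have := LinearMap.congr_fun h (w, 0)
            change E.form.toDual x v.1 w + F.form.toDual x v.2 0 =
              E.form.toDual x v'.1 w + F.form.toDual x v'.2 0 at this
            simpa using this
          · apply LinearMap.ext
            intro w
            have := LinearMap.congr_fun h (0, w)
            change E.form.toDual x v.1 0 + F.form.toDual x v.2 w =
              E.form.toDual x v'.1 0 + F.form.toDual x v'.2 w at this
            simpa using this
        · intro f
          obtain ⟨a, ha⟩ := (E.form.bijective x).2 (f.comp (LinearMap.inl _ _ _))
          obtain ⟨b, hb⟩ := (F.form.bijective x).2 (f.comp (LinearMap.inr _ _ _))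
          refine ⟨(a, b), ?_⟩
          apply LinearMap.ext
          intro w
          change E.form.toDual x a w.1 + F.form.toDual x b w.2 = f w
          rw [ha, hb]
          change f (w.1, 0) + f (0, w.2) = f w
          refine (map_add f _ _).symm.trans (congrArg f ?_)
          exact Prod.ext (add_zero _) (zero_add _)
      symm := fun x v w => by
        change E.form.toDual x w.1 v.1 + F.form.toDual x w.2 v.2 =
          (ε : ℤ) • s.star x (E.form.toDual x v.1 w.1 + F.form.toDual x v.2 w.2)
        rw [E.form.symm x v.1 w.1, F.form.symm x v.2 w.2, map_add, smul_add]
      map_conj := fun x v w => by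
        change E.form.toDual (bar x) (E.bundle.conj x v.1) (E.bundle.conj x w.1) +
          F.form.toDual (bar x) (F.bundle.conj x v.2) (F.bundle.conj x w.2) =
          𝒜.conj x (E.form.toDual x v.1 w.1 + F.form.toDual x v.2 w.2)
        rw [E.form.map_conj, F.form.map_conj, map_add]
      continuous_form := by
        have h1 := E.form.continuous_form.comp
          (f := fun p : Tot (fun x => (E.bundle.sum F.bundle).fiber x ×
            (E.bundle.sum F.bundle).fiber x) =>
            (⟨p.proj, (p.snd.1.1, p.snd.2.1)⟩ :
              Tot fun x => E.bundle.fiber x × E.bundle.fiber x))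
          (continuous_tot_prod.2 
            ⟨(continuous_tot_fst (E := E.bundle.fiber) (F := F.bundle.fiber)).comp
              (continuous_tot_fst (E := (E.bundle.sum F.bundle).fiber)
                (F := (E.bundle.sum F.bundle).fiber)),
            (continuous_tot_fst (E := E.bundle.fiber) (F := F.bundle.fiber)).comp
              (continuous_tot_snd (E := (E.bundle.sum F.bundle).fiber)
                (F := (E.bundle.sum F.bundle).fiber))⟩)
        have h2 := F.form.continuous_form.comp
          (f := fun p : Tot (fun x => (E.bundle.sum F.bundle).fiber x ×
            (E.bundle.sum F.bundle).fiber x) =>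
            (⟨p.proj, (p.snd.1.2, p.snd.2.2)⟩ :
              Tot fun x => F.bundle.fiber x × F.bundle.fiber x))
          (continuous_tot_prod.2 
            ⟨(continuous_tot_snd (E := E.bundle.fiber) (F := F.bundle.fiber)).comp
              (continuous_tot_fst (E := (E.bundle.sum F.bundle).fiber)
                (F := (E.bundle.sum F.bundle).fiber)),
            (continuous_tot_snd (E := E.bundle.fiber) (F := F.bundle.fiber)).comp
              (continuous_tot_snd (E := (E.bundle.sum F.bundle).fiber)
                (F := (E.bundle.sum F.bundle).fiber))⟩)
        exact 𝒜.continuous_add.comp (f := fun p : Tot (fun x => (E.bundle.sum F.bundle).fiber x ×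
            (E.bundle.sum F.bundle).fiber x) =>
            (⟨p.proj, (E.form.toDual p.proj p.snd.1.1 p.snd.2.1,
              F.form.toDual p.proj p.snd.1.2 p.snd.2.2)⟩ :
              Tot fun x => 𝒜.fiber x × 𝒜.fiber x))
          (continuous_tot_prod.2 ⟨h1, h2⟩) }

/-- The zero form. -/
def zero (s : AntiInvolution 𝒜) (ε : ℤˣ) : SymBundle s ε where
  bundle := RealBundle.zero 𝒜
  form :=
    { toDual := fun _ => 0
      toDual_smul := fun x a v w => by simp
      bijective := fun x => by
        constructor
        · intro v w _
          exact Subsingleton.elim (α := PUnit) v w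
        · intro f
          refine ⟨PUnit.unit, LinearMap.ext fun w => ?_⟩
          have : w = 0 := Subsingleton.elim (α := PUnit) w 0
          rw [this, map_zero, map_zero]
      symm := fun x v w => by simp
      map_conj := fun x v w => by simp
      continuous_form := by
        exact 𝒜.continuous_zero.comp ((RealBundle.zero 𝒜).continuous_proj.comp
          (continuous_tot_fst (E := (RealBundle.zero 𝒜).fiber)
            (F := (RealBundle.zero 𝒜).fiber))) }

namespace Iso

variable {E F H E' F' : SymBundle s ε}

def refl (E : SymBundle s ε) : Iso E E := ⟨.refl _, fun _ _ _ => rfl⟩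

def symm (f : Iso E F) : Iso F E := ⟨f.iso.symm, fun x v w => by
  rw [← f.isometry]
  change F.form.toDual x (f.iso.equiv x ((f.iso.equiv x).symm v))
    (f.iso.equiv x ((f.iso.equiv x).symm w)) = _
  rw [LinearEquiv.apply_symm_apply, LinearEquiv.apply_symm_apply]⟩

def trans (f : Iso E F) (g : Iso F H) : Iso E H :=
  ⟨f.iso.trans g.iso, fun x _ _ => (g.isometry x _ _).trans (f.isometry x _ _)⟩

def sumCongr (f : Iso E E') (g : Iso F F') : Iso (E.sum F) (E'.sum F') :=
  ⟨f.iso.sumCongr g.iso, fun x v w =>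
    congrArg₂ (· + ·) (f.isometry x v.1 w.1) (g.isometry x v.2 w.2)⟩

def sumComm (E F : SymBundle s ε) : Iso (E.sum F) (F.sum E) :=
  ⟨.sumComm _ _, fun x v w => add_comm (F.form.toDual x v.2 w.2) (E.form.toDual x v.1 w.1)⟩

def sumAssoc (E F H : SymBundle s ε) : Iso ((E.sum F).sum H) (E.sum (F.sum H)) :=
  ⟨.sumAssoc _ _ _, fun x v w => (add_assoc (E.form.toDual x v.1.1 w.1.1)
    (F.form.toDual x v.1.2 w.1.2) (H.form.toDual x v.2 w.2)).symm⟩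

def zeroSum (E : SymBundle s ε) : Iso ((SymBundle.zero s ε).sum E) E :=
  ⟨.zeroSum _, fun x v w => (zero_add (E.form.toDual x v.2 w.2)).symm⟩

end Iso

instance setoid (s : AntiInvolution 𝒜) (ε : ℤˣ) : Setoid (SymBundle s ε) where
  r E F := Nonempty (E.Iso F)
  iseqv := ⟨fun E => ⟨.refl E⟩, fun ⟨f⟩ => ⟨f.symm⟩, fun ⟨f⟩ ⟨g⟩ => ⟨f.trans g⟩⟩

/-- Isometry classes of `ε`-symmetric forms. -/
def IsoClass (s : AntiInvolution 𝒜) (ε : ℤˣ) := Quotient (SymBundle.setoid s ε)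

instance (s : AntiInvolution 𝒜) (ε : ℤˣ) : Add (IsoClass s ε) where
  add := Quotient.map₂ SymBundle.sum fun _ _ ⟨f⟩ _ _ ⟨g⟩ => ⟨f.sumCongr g⟩

instance (s : AntiInvolution 𝒜) (ε : ℤˣ) : Zero (IsoClass s ε) where
  zero := Quotient.mk _ (SymBundle.zero s ε)

instance (s : AntiInvolution 𝒜) (ε : ℤˣ) : AddCommMonoid (IsoClass s ε) where
  add_assoc := by
    rintro ⟨a⟩ ⟨b⟩ ⟨c⟩
    exact Quotient.sound ⟨.sumAssoc a b c⟩
  add_comm := by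
    rintro ⟨a⟩ ⟨b⟩
    exact Quotient.sound ⟨.sumComm a b⟩
  zero_add := by
    rintro ⟨a⟩
    exact Quotient.sound ⟨.zeroSum a⟩
  add_zero := by
    rintro ⟨a⟩
    exact Quotient.sound ⟨(Iso.sumComm _ _).trans (.zeroSum a)⟩
  nsmul := nsmulRec

end SymBundle

/-- The Grothendieck-Witt group `_εGR^𝒜(X)`: the Grothendieck group of `ε`-symmetric forms on
Real `𝒜`-bundles under orthogonal sum, for the anti-involution `s` of `𝒜`. -/
abbrev GR (s : AntiInvolution 𝒜) (ε : ℤˣ) :=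
  Algebra.GrothendieckAddGroup (SymBundle.IsoClass s ε)

/-- The class of a form in `_εGR^𝒜(X)`. -/
def GR.mk (E : SymBundle s ε) : GR s ε :=
  Algebra.GrothendieckAddGroup.of (Quotient.mk (SymBundle.setoid s ε) E)

/-! ### Trivial Real algebra bundles -/

/-- An involution of an `ℝ`-algebra (an algebra automorphism with square the identity). -/
structure AlgInvolution (D : Type*) [Ring D] [Algebra ℝ D] where
  toAlgEquiv : D ≃ₐ[ℝ] D
  involutive : ∀ d, toAlgEquiv (toAlgEquiv d) = d

/-- Conjugation by a unit `t` with central square. -/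
def AlgInvolution.conjBy {D : Type*} [Ring D] [Algebra ℝ D] (t : Dˣ)
    (ht : ∀ d : D, (t * t : D) * d = d * (t * t : D)) : AlgInvolution D where
  toAlgEquiv := MulSemiringAction.toAlgEquiv ℝ D (ConjAct.toConjAct t)
  involutive d := by
    simp only [MulSemiringAction.toAlgEquiv_apply, ConjAct.units_smul_def,
      ConjAct.ofConjAct_toConjAct]
    have := ht d
    calc (t : D) * (t * d * ↑t⁻¹) * ↑t⁻¹ = (t * t) * d * ↑t⁻¹ * ↑t⁻¹ := by
          simp only [mul_assoc]
      _ = d := by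
          rw [this]
          simp [mul_assoc]

/-- An anti-involution of an `ℝ`-algebra with involution, commuting with the involution. -/
structure AlgAntiInvolution {D : Type*} [Ring D] [Algebra ℝ D] (ρ : AlgInvolution D) where
  toLinearMap : D →ₗ[ℝ] D
  map_mul : ∀ a b, toLinearMap (a * b) = toLinearMap b * toLinearMap a
  involutive : ∀ a, toLinearMap (toLinearMap a) = a
  comm : ∀ a, toLinearMap (ρ.toAlgEquiv a) = ρ.toAlgEquiv (toLinearMap a)

/-- The trivial Real algebra bundle `X × A` with involution `(x, a) ↦ (bar x, ρ a)`. -/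
def RealAlgebraBundle.trivial (X : Type u) [TopologicalSpace X] [InvolutiveSpace X]
    (A : Type v) [Ring A] [Algebra ℝ A] [TopologicalSpace A] [ContinuousAdd A]
    (ρ : AlgInvolution A) (hρ : Continuous ρ.toAlgEquiv) : RealAlgebraBundle X A :=
  letI := trivialTopology X A
  { fiber := fun _ => A
    continuous_proj := (continuous_trivial.1 continuous_id).1
    chartAt := fun _ =>
      { base := Set.univ
        isOpen_base := isOpen_univ
        iso := fun _ => AlgEquiv.refl
        continuous_iso := (continuous_trivial.1 continuous_subtype_val).2
        continuous_symm := continuous_trivial.2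
          ⟨continuous_subtype_val.comp continuous_fst, continuous_snd⟩ }
    mem_chartAt := fun _ => Set.mem_univ _
    continuous_add := continuous_trivial.2
      ⟨(continuous_trivial.1 continuous_tot_fst).1,
        (continuous_trivial.1 continuous_tot_fst).2.add (continuous_trivial.1 continuous_tot_snd).2⟩
    conj := fun _ => ρ.toAlgEquiv
    conj_conj := fun x a => trivial_ext (bar_bar x) (ρ.involutive a)
    continuous_conj := continuous_trivial.2
      ⟨continuous_bar.comp (continuous_trivial.1 continuous_id).1,
        hρ.comp (continuous_trivial.1 continuous_id).2⟩ }

/-- The anti-involution of a trivial Real algebra bundle given by one on the fibre. -/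
def AntiInvolution.trivial {A : Type v} [Ring A] [Algebra ℝ A] [TopologicalSpace A]
    [ContinuousAdd A] {ρ : AlgInvolution A} (hρ : Continuous ρ.toAlgEquiv)
    (δ : AlgAntiInvolution ρ) (hδ : Continuous δ.toLinearMap) :
    AntiInvolution (RealAlgebraBundle.trivial X A ρ hρ) where
  star _ := δ.toLinearMap
  star_mul _ := δ.map_mul
  star_star _ := δ.involutive
  star_conj _ := δ.comm
  continuous_star :=
    letI := trivialTopology X A
    continuous_trivial.2
      ⟨(continuous_trivial.1 continuous_id).1, hδ.comp (continuous_trivial.1 continuous_id).2⟩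

end Bundles

/-! ### Bundles of real `C*`-algebras and their tensor products with finite algebras -/

/-- A (unital) real `C*`-algebra: a Banach `*`-algebra over `ℝ` which is isometrically
`*`-isomorphic to a norm-closed algebra of bounded operators on a real Hilbert space. -/
class IsRealCStarAlgebra (A : Type v) [NormedRing A] [NormedAlgebra ℝ A] [StarRing A] : Prop where
  complete : CompleteSpace A
  exists_isometry : ∃ (H : Type v) (_ : NormedAddCommGroup H) (_ : InnerProductSpace ℝ H)
    (_ : CompleteSpace H) (f : A →⋆ₐ[ℝ] (H →L[ℝ] H)), Isometry f

/-- A locally trivial bundle of `*`-algebras over `ℝ` with fibre `A`, with an action of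
`G = {1, τ}` covering the one on the base by `*`-isomorphisms. -/
structure RealStarAlgebraBundle (X : Type u) [TopologicalSpace X] [InvolutiveSpace X]
    (A : Type v) [Ring A] [Algebra ℝ A] [TopologicalSpace A] [StarRing A]
    extends RealAlgebraBundle X A where
  [starRing : ∀ x, StarRing (fiber x)]
  [starModule : ∀ x, StarModule ℝ (fiber x)]
  chart_star : ∀ x (y : (chartAt x).base) (a : fiber y),
    (chartAt x).iso y (star a) = star ((chartAt x).iso y a)
  conj_star : ∀ x (a : fiber x), conj x (star a) = star (conj x a)
  continuous_star : Continuous fun p : Tot fiber => (⟨p.proj, star p.snd⟩ : Tot fiber)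

attribute [instance] RealStarAlgebraBundle.starRing RealStarAlgebraBundle.starModule

section Tensor

variable (D : Type) [Ring D] [Algebra ℝ D]

/-- The slice map `id ⊗ f : A ⊗ D → A` of a linear form `f` on `D`. -/
def slice {A : Type v} [Ring A] [Algebra ℝ A] (f : D →ₗ[ℝ] ℝ) : A ⊗[ℝ] D →ₗ[ℝ] A :=
  (TensorProduct.rid ℝ A).toLinearMap ∘ₗ f.lTensor A

variable {D} in
@[simp] theorem slice_tmul {A : Type v} [Ring A] [Algebra ℝ A] (f : D →ₗ[ℝ] ℝ) (a : A) (d : D) :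
    slice D f (a ⊗ₜ d) = f d • a := by
  simp [slice]

/-- For a finite dimensional algebra `D`, the topology of `A ⊗ D` is the product topology obtained
from any basis of `D`, i.e. the coarsest one for which all slice maps are continuous. -/
instance tensorTopology (A : Type v) [Ring A] [Algebra ℝ A] [TopologicalSpace A] :
    TopologicalSpace (A ⊗[ℝ] D) :=
  ⨅ f : D →ₗ[ℝ] ℝ, TopologicalSpace.induced (slice D f) inferInstance

/-- The same topology on the total space of a bundle `𝒜⁰ ⊗ D`. -/
instance totTensorTopology {X : Type u} (E : X → Type v) [∀ x, Ring (E x)] [∀ x, Algebra ℝ (E x)]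
    [TopologicalSpace (Tot E)] : TopologicalSpace (Tot fun x => E x ⊗[ℝ] D) :=
  ⨅ f : D →ₗ[ℝ] ℝ, TopologicalSpace.induced
    (fun p => (⟨p.proj, slice D f p.snd⟩ : Tot E)) inferInstance

variable {D}

theorem continuous_tensor {A : Type v} [Ring A] [Algebra ℝ A] [TopologicalSpace A]
    {Y : Type*} [TopologicalSpace Y] {g : Y → A ⊗[ℝ] D} :
    Continuous g ↔ ∀ f : D →ₗ[ℝ] ℝ, Continuous fun y => slice D f (g y) := by
  rw [continuous_iInf_rng]
  exact forall_congr' fun f => continuous_induced_rng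

theorem continuous_totTensor {X : Type u} {E : X → Type v} [∀ x, Ring (E x)]
    [∀ x, Algebra ℝ (E x)] [TopologicalSpace (Tot E)]
    {Y : Type*} [TopologicalSpace Y] {g : Y → Tot fun x => E x ⊗[ℝ] D} :
    Continuous g ↔ ∀ f : D →ₗ[ℝ] ℝ,
      Continuous fun y => (⟨(g y).proj, slice D f (g y).snd⟩ : Tot E) := by
  rw [continuous_iInf_rng]
  exact forall_congr' fun f => continuous_induced_rng

theorem slice_map {A B : Type v} [Ring A] [Algebra ℝ A] [Ring B] [Algebra ℝ B]
    (g : A →ₗ[ℝ] B) (h : D →ₗ[ℝ] D) (f : D →ₗ[ℝ] ℝ) (t : A ⊗[ℝ] D) :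
    slice D f (TensorProduct.map g h t) = g (slice D (f ∘ₗ h) t) := by
  induction t with
  | zero => simp
  | tmul a d => simp
  | add a b ha hb => simp [ha, hb]

variable {X : Type u} [TopologicalSpace X] [InvolutiveSpace X]

section
variable {A : Type v} [Ring A] [Algebra ℝ A] [TopologicalSpace A]

/-- The Real algebra bundle `𝒜⁰ ⊗ D`, for an algebra `D` with involution `ρ`, with
involution `a ⊗ d ↦ conj a ⊗ ρ d`. -/
def RealAlgebraBundle.tensor (𝒜 : RealAlgebraBundle X A) (ρ : AlgInvolution D) :
    RealAlgebraBundle X (A ⊗[ℝ] D) where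
  fiber x := 𝒜.fiber x ⊗[ℝ] D
  continuous_proj := 𝒜.continuous_proj.comp (continuous_totTensor.1 continuous_id 0)
  chartAt x :=
    { base := (𝒜.chartAt x).base
      isOpen_base := (𝒜.chartAt x).isOpen_base
      iso := fun y => Algebra.TensorProduct.congr ((𝒜.chartAt x).iso y) AlgEquiv.refl
      continuous_iso := by
        refine continuous_tensor.2 fun f => ?_
        have h := (𝒜.chartAt x).continuous_iso.comp
          (((continuous_totTensor.1 continuous_id f).comp
            (continuous_subtype_val (p := fun p : Tot (fun x => 𝒜.fiber x ⊗[ℝ] D) =>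
              p.proj ∈ (𝒜.chartAt x).base))).subtype_mk fun p => p.2)
        refine h.congr fun p => ?_
        exact (slice_map ((𝒜.chartAt x).iso ⟨p.1.proj, p.2⟩).toLinearMap LinearMap.id f _).symm
      continuous_symm := by
        refine continuous_totTensor.2 fun f => ?_
        have h := (𝒜.chartAt x).continuous_symm.comp
          ((continuous_fst (X := (𝒜.chartAt x).base) (Y := A ⊗[ℝ] D)).prodMk
            ((continuous_tensor.1 continuous_id f).comp continuous_snd))
        refine h.congr fun q => ?_
        exact congrArg (Bundle.TotalSpace.mk _)
          (slice_map ((𝒜.chartAt x).iso q.1).symm.toLinearMap LinearMap.id f _).symm }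
  mem_chartAt := 𝒜.mem_chartAt
  continuous_add := by
    refine continuous_totTensor.2 fun f => ?_
    have h := 𝒜.continuous_add.comp (f := fun p : Tot (fun x =>
        (𝒜.fiber x ⊗[ℝ] D) × (𝒜.fiber x ⊗[ℝ] D)) =>
        (⟨p.proj, (slice D f p.snd.1, slice D f p.snd.2)⟩ : Tot fun x => 𝒜.fiber x × 𝒜.fiber x))
      (continuous_tot_prod.2 ⟨continuous_totTensor.1 continuous_tot_fst f,
        continuous_totTensor.1 continuous_tot_snd f⟩)
    refine h.congr fun p => ?_
    simp
  conj x := Algebra.TensorProduct.map (𝒜.conj x) ρ.toAlgEquiv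
  conj_conj x t := by
    have key : ∀ (y : X) (g : 𝒜.fiber x →ₐ[ℝ] 𝒜.fiber y), y = x →
        (∀ a, (⟨y, g a⟩ : Tot 𝒜.fiber) = ⟨x, a⟩) →
        (⟨y, Algebra.TensorProduct.map g (AlgHom.id ℝ D) t⟩ :
          Tot fun x => 𝒜.fiber x ⊗[ℝ] D) = ⟨x, t⟩ := by
      rintro y g rfl hg
      have : g = AlgHom.id ℝ _ := AlgHom.ext fun a => by
        simpa using hg a
      rw [this]
      simp
    have := key _ ((𝒜.conj (bar x)).comp (𝒜.conj x)) (bar_bar x) (𝒜.conj_conj x)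
    rw [← this]
    congr 1
    rw [← AlgHom.comp_apply, ← Algebra.TensorProduct.map_comp]
    congr 2
    exact AlgHom.ext ρ.involutive
  continuous_conj := by
    refine continuous_totTensor.2 fun f => ?_
    have h := 𝒜.continuous_conj.comp
      (continuous_totTensor.1 continuous_id (f ∘ₗ ρ.toAlgEquiv.toLinearMap))
    refine h.congr fun p => ?_
    exact congrArg (Bundle.TotalSpace.mk _)
      (slice_map (𝒜.conj p.proj).toLinearMap ρ.toAlgEquiv.toLinearMap f p.snd).symm

end

variable {A : Type v} [Ring A] [Algebra ℝ A] [TopologicalSpace A] [StarRing A]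

/-- The star operation of a `*`-algebra over `ℝ` as a linear map. -/
def starLinear (B : Type v) [Ring B] [Algebra ℝ B] [StarRing B] [StarModule ℝ B] : B →ₗ[ℝ] B where
  toFun := star
  map_add' := star_add
  map_smul' r b := by simp

/-- The anti-involution `a ⊗ d ↦ a^* ⊗ δ d` of `𝒜⁰ ⊗ D`. -/
def RealStarAlgebraBundle.antiInvolution (𝒜 : RealStarAlgebraBundle X A) {ρ : AlgInvolution D}
    (δ : AlgAntiInvolution ρ) : AntiInvolution (𝒜.toRealAlgebraBundle.tensor ρ) where
  star x := TensorProduct.map (starLinear (𝒜.fiber x)) δ.toLinearMap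
  star_mul x a b := by
    change 𝒜.fiber x ⊗[ℝ] D at a b
    change TensorProduct.map (starLinear (𝒜.fiber x)) δ.toLinearMap (a * b) =
      TensorProduct.map (starLinear (𝒜.fiber x)) δ.toLinearMap b *
        TensorProduct.map (starLinear (𝒜.fiber x)) δ.toLinearMap a
    induction a using TensorProduct.induction_on with
    | zero => simp
    | add a a' h h' => rw [add_mul, map_add, map_add, mul_add, h, h']
    | tmul a d =>
      induction b using TensorProduct.induction_on with
      | zero => simp
      | add b b' h h' => rw [mul_add, map_add, map_add, add_mul, h, h']
      | tmul b e => simp [starLinear, δ.map_mul]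
  star_star x a := by
    change TensorProduct.map _ _ (TensorProduct.map _ _ a) = a
    induction a using TensorProduct.induction_on with
    | zero => simp
    | add a a' h h' => rw [map_add, map_add, h, h']
    | tmul a d => simp [starLinear, δ.involutive]
  star_conj x a := by
    change TensorProduct.map _ _ (Algebra.TensorProduct.map (𝒜.conj x) ρ.toAlgEquiv.toAlgHom a) =
      Algebra.TensorProduct.map (𝒜.conj x) ρ.toAlgEquiv.toAlgHom (TensorProduct.map _ _ a)
    induction a using TensorProduct.induction_on with
    | zero => simp
    | add a a' h h' => rw [map_add, map_add, map_add, map_add, h, h']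
    | tmul a d => simp [starLinear, δ.comm, 𝒜.conj_star]
  continuous_star := by
    refine continuous_totTensor.2 fun f => ?_
    have h := 𝒜.continuous_star.comp
      (continuous_totTensor.1 continuous_id (f ∘ₗ δ.toLinearMap))
    refine h.congr fun p => ?_
    exact congrArg (Bundle.TotalSpace.mk _)
      (slice_map (starLinear (𝒜.fiber p.proj)) δ.toLinearMap f p.snd).symm

end Tensor

/-! ### The algebras `ℂ`, `M₂(ℝ)` and `ℍ` with their involutions -/

/-- Complex conjugation. -/
def complexConj : AlgInvolution ℂ := ⟨Complex.conjAe, Complex.conj_conj⟩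

/-- The identity of `ℂ` as an anti-involution: it induces `(a ⊗ z)† = a^* ⊗ z`. -/
def idAnti : AlgAntiInvolution complexConj where
  toLinearMap := LinearMap.id
  map_mul a b := mul_comm a b
  involutive _ := rfl
  comm _ := rfl

/-- Complex conjugation as an anti-involution: it induces `(a ⊗ z)^* = a^* ⊗ conj z`. -/
def conjAnti : AlgAntiInvolution complexConj where
  toLinearMap := Complex.conjAe.toLinearMap
  map_mul a b := by simp [mul_comm]
  involutive := Complex.conj_conj
  comm _ := rfl

/-- `M₂(ℝ)`. -/
abbrev M2 : Type := Matrix (Fin 2) (Fin 2) ℝ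

/-- `j = diag(1, -1)` in `M₂(ℝ)`, with `j² = 1`. -/
def jPlus : M2ˣ where
  val := !![1, 0; 0, -1]
  inv := !![1, 0; 0, -1]
  val_inv := by simp [Matrix.one_fin_two]
  inv_val := by simp [Matrix.one_fin_two]

/-- The inclusion `ℂ → M₂(ℝ)` with `i ↦ (0 -1; 1 0)`; one has `ij = -ji`. -/
def iotaPlus : ℂ →ₐ[ℝ] M2 :=
  Complex.lift ⟨!![0, -1; 1, 0], by
    ext a b
    fin_cases a <;> fin_cases b <;> simp⟩

/-- The involution of `M₂(ℝ)` fixing `j` with `i ↦ -i`: conjugation by `j = diag(1, -1)`. -/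
def rhoPlus : AlgInvolution M2 := .conjBy jPlus fun d => by
  have : (jPlus * jPlus : M2) = 1 := jPlus.val_inv
  rw [this, one_mul, mul_one]

theorem quat_mul_self {q : ℍ[ℝ]} (h : q.re = 0)
    (h' : q.imI * q.imI + q.imJ * q.imJ + q.imK * q.imK = 1) : q * q = -1 := by
  ext
  · simp [h]
    linarith
  all_goals simp [h]
  all_goals ring

/-- `i` in `ℍ`. -/
def quatI : ℍ[ℝ] := ⟨0, 1, 0, 0⟩

/-- `j` in `ℍ`. -/
def quatJ : ℍ[ℝ] := ⟨0, 0, 1, 0⟩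

theorem quatI_mul_self : quatI * quatI = -1 := quat_mul_self rfl (by simp [quatI])

theorem quatJ_mul_self : quatJ * quatJ = -1 := quat_mul_self rfl (by simp [quatJ])

/-- The unit `i` of `ℍ`. -/
def iMinus : ℍ[ℝ]ˣ where
  val := quatI
  inv := -quatI
  val_inv := by rw [mul_neg, quatI_mul_self, neg_neg]
  inv_val := by rw [neg_mul, quatI_mul_self, neg_neg]

/-- The unit `j` of `ℍ`, with `j² = -1`. -/
def jMinus : ℍ[ℝ]ˣ where
  val := quatJ
  inv := -quatJ
  val_inv := by rw [mul_neg, quatJ_mul_self, neg_neg]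
  inv_val := by rw [neg_mul, quatJ_mul_self, neg_neg]

/-- The inclusion `ℂ → ℍ` with `i ↦ i`; one has `ij = -ji`. -/
def iotaMinus : ℂ →ₐ[ℝ] ℍ[ℝ] := Complex.lift ⟨quatI, quatI_mul_self⟩

/-- The involution of `ℍ` fixing `j` with `i ↦ -i`: conjugation by `j`. -/
def rhoMinus : AlgInvolution ℍ[ℝ] := .conjBy jMinus fun d => by
  have h : (jMinus * jMinus : ℍ[ℝ]) = -1 := quatJ_mul_self
  rw [h, neg_one_mul, mul_neg_one]

/-- The involution of `ℍ` given by conjugation by `i`. -/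
def quatConjI : AlgInvolution ℍ[ℝ] := .conjBy iMinus fun d => by
  have h : (iMinus * iMinus : ℍ[ℝ]) = -1 := quatI_mul_self
  rw [h, neg_one_mul, mul_neg_one]

theorem continuous_complexConj : Continuous complexConj.toAlgEquiv := Complex.continuous_conj

theorem continuous_quatConjI : Continuous quatConjI.toAlgEquiv :=
  (continuous_const.mul continuous_id).mul continuous_const

/-- `_εGR(X)`: forms on Real vector bundles. Here `𝒜` is the trivial Real algebra bundle with
fibre `ℂ`, with complex conjugation as involution and the identity as anti-involution. -/
abbrev GRC (X : Type u) [TopologicalSpace X] [InvolutiveSpace X] (ε : ℤˣ) :=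
  GR (AntiInvolution.trivial (X := X) continuous_complexConj idAnti continuous_id) ε

/-- `KR^ℍ(X)`: the Grothendieck group of Real quaternionic bundles. Here `ℍ` has the involution
given by conjugation by `i`. -/
abbrev KRH (X : Type u) [TopologicalSpace X] [InvolutiveSpace X] :=
  KR (RealAlgebraBundle.trivial X ℍ[ℝ] quatConjI continuous_quatConjI)

/-! ### Hermitian metrics and the correspondence between forms and module structures -/

section Correspondence

variable {X : Type u} [TopologicalSpace X] [InvolutiveSpace X]
  {A : Type v} [Ring A] [Algebra ℝ A] [TopologicalSpace A] [StarRing A]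

namespace RealStarAlgebraBundle

/-- `𝒜 = 𝒜⁰ ⊗ ℂ`, with involution `a ⊗ z ↦ conj a ⊗ conj z`. -/
abbrev complexification (𝒜 : RealStarAlgebraBundle X A) : RealAlgebraBundle X (A ⊗[ℝ] ℂ) :=
  𝒜.toRealAlgebraBundle.tensor complexConj

/-- The anti-involution `(a ⊗ z)† = a^* ⊗ z` of `𝒜⁰ ⊗ ℂ`. -/
abbrev dagger (𝒜 : RealStarAlgebraBundle X A) : AntiInvolution 𝒜.complexification :=
  𝒜.antiInvolution idAnti

/-- The anti-involution `(a ⊗ z)^* = a^* ⊗ conj z` of `𝒜⁰ ⊗ ℂ`. -/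
abbrev hermitian (𝒜 : RealStarAlgebraBundle X A) : AntiInvolution 𝒜.complexification :=
  𝒜.antiInvolution conjAnti

/-- `𝒜⁺ = 𝒜⁰ ⊗ M₂(ℝ)`. -/
abbrev plus (𝒜 : RealStarAlgebraBundle X A) : RealAlgebraBundle X (A ⊗[ℝ] M2) :=
  𝒜.toRealAlgebraBundle.tensor rhoPlus

/-- `𝒜⁻ = 𝒜⁰ ⊗ ℍ`. -/
abbrev minus (𝒜 : RealStarAlgebraBundle X A) : RealAlgebraBundle X (A ⊗[ℝ] ℍ[ℝ]) :=
  𝒜.toRealAlgebraBundle.tensor rhoMinus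

end RealStarAlgebraBundle

/-- A Hermitian metric on a Real `𝒜⁰ ⊗ ℂ`-bundle, compatible with the involution: a form which
is symmetric for `*` and positive, i.e. all `⟨v, v⟩` are of the form `c^* c`. -/
structure HermitianMetric (𝒜 : RealStarAlgebraBundle X A) (E : RealBundle 𝒜.complexification)
    extends SymForm 𝒜.hermitian 1 E where
  pos : ∀ x v, ∃ c, toDual x v v = 𝒜.hermitian.star x c * c

/-- The Real `𝒜⁰ ⊗ D`-bundle `F` corresponds to the form `E` on a Real `𝒜⁰ ⊗ ℂ`-bundle: up to an
isomorphism `u`, the latter bundle is obtained from `F` by restriction of scalars along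
`ι : ℂ → D`, and its form is `φ(v, w) = ⟨j v, w⟩` for some Hermitian metric. -/
def Corresponds {D : Type} [Ring D] [Algebra ℝ D] (𝒜 : RealStarAlgebraBundle X A)
    (ρ : AlgInvolution D) (ι : ℂ →ₐ[ℝ] D) (j : D) {ε : ℤˣ} (E : SymBundle 𝒜.dagger ε)
    (F : RealBundle (𝒜.toRealAlgebraBundle.tensor ρ)) : Prop :=
  ∃ (u : ∀ x, E.bundle.fiber x ≃+ F.fiber x) (ψ : HermitianMetric 𝒜 E.bundle),
    Continuous (fun p : Tot E.bundle.fiber => (⟨p.proj, u p.proj p.snd⟩ : Tot F.fiber)) ∧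
    Continuous (fun p : Tot F.fiber => (⟨p.proj, (u p.proj).symm p.snd⟩ : Tot E.bundle.fiber)) ∧
    (∀ x v, u (bar x) (E.bundle.conj x v) = F.conj x (u x v)) ∧
    (∀ x (a : 𝒜.fiber x ⊗[ℝ] ℂ) v,
      u x (HSMul.hSMul (α := 𝒜.complexification.fiber x) a v) =
        HSMul.hSMul (α := (𝒜.toRealAlgebraBundle.tensor ρ).fiber x)
          (Algebra.TensorProduct.map (AlgHom.id ℝ (𝒜.fiber x)) ι a) (u x v)) ∧
    (∀ x v w, E.form.toDual x v w = ψ.toDual x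
      ((u x).symm (HSMul.hSMul (α := (𝒜.toRealAlgebraBundle.tensor ρ).fiber x)
        ((1 : 𝒜.fiber x) ⊗ₜ[ℝ] j) (u x v))) w)

end Correspondence

end RealKTheory

end

open RealKTheory

/-!
Write `𝒜 = 𝒜⁰ ⊗ ℂ`, with the two anti-involutions `(a ⊗ z)† = a^* ⊗ z` and
`(a ⊗ z)^* = a^* ⊗ conj z`, and let `𝒟` be `𝒜⁺` or `𝒜⁻`. Every element of `𝒟` is uniquely of the form
`b + c j` with `b`, `c` in `𝒜`, and `j b = (b†)^* j`, `j² = ε`. A Real `𝒟`-bundle is therefore a Real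
`𝒜`-bundle `E` with a twisted linear endomorphism `J` such that `J² = ε`. The proof is a polar
decomposition: in the presence of a Hermitian metric `ψ`, an `ε`-symmetric form `φ` is the same as an
invertible twisted linear endomorphism `T`, with `φ(v, w) = ψ(T v, w)`, and the unitary part of `T` is
such a `J`.

The endomorphism `S = ε T²` is linear and positive. Its positive square root `U` commutes with `T`.
With the metric `ψ(U v, w)` in place of `ψ`, the form `φ` is represented by `J = U⁻¹ T`, and `J² = ε`
(`JData.exists_metric_jStructure`). Conversely, given `J`, the average of a metric over the action of
`J` is a metric `ψ` for which `φ(v, w) = ψ(J v, w)` is an `ε`-symmetric form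
(`JData.exists_compatible_metric`, `JData.symForm`). Each of the two structures determines the other up
to isomorphism: the positive square root of the endomorphism relating two metrics transforms one
choice into the other (`JData.exists_iso_of_form_eq`, `JData.exists_isometry_of_J_eq`), since positive
square roots are unique. The correspondence is thus a bijection of isomorphism classes, compatible with
sums, and induces a unique isomorphism of Grothendieck groups (`JData.existsUnique_addEquiv`).

The analysis takes place in the fibres of `𝒜`, which are complex `C*`-algebras: a real `C*`-algebra `A`
acts on a real Hilbert space `H`, and `A ⊗ ℂ` acts on `H ⊕ H` (`Cplx`). A finitely generated projective
module over a `C*`-algebra `R` is described by a frame, i.e. as a retract of a module of rows `Rⁿ`, so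
that its endomorphisms become matrices over `R`, which again form a `C*`-algebra. A nondegenerate
positive form admits local frames which are Parseval frames, through the square root of a Gram matrix
(`PosForm.exists_parseval`). In such frames adjoints of endomorphisms are adjoints of matrices, and the
continuous functional calculus gives square roots which vary continuously with the point of the base
(`PosForm.exists_sqrt`). Metrics exist by a partition of unity and averaging over the involution
(`exists_metric`). Local triviality of the `𝒟`-bundle defined by `J` follows by averaging a chart over
the action of `j` (`JStructure.exists_chart`).

The case of Real vector bundles is the same argument for the trivial bundles with fibres `ℂ ⊂ ℍ`, where
`ℂ` is embedded as `ℝ[j]` and the adjoined element is `i`; conjugation by `i` then restricts to complex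
conjugation (`quatJData`).
-/

noncomputable section

set_option linter.unusedSectionVars false

namespace RealKTheory

open InvolutiveSpace

/-! ### Matrices over a `C*`-algebra acting on rows -/

section Rows

/-- Square matrices over a `C*`-algebra, as a `C*`-algebra. The type is kept separate from
`CStarMatrix`, so that all its algebraic structure is derived from the `C*`-algebra structure. -/
def SqMat (ι R : Type*) : Type _ := CStarMatrix ι ι R

namespace SqMat

variable {R : Type*} [CStarAlgebra R] [PartialOrder R] [StarOrderedRing R]
  {ι : Type*} [Fintype ι] [DecidableEq ι]

instance : CStarAlgebra (SqMat ι R) := inferInstanceAs (CStarAlgebra (CStarMatrix ι ι R))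

instance : PartialOrder (SqMat ι R) := CStarAlgebra.spectralOrder _

instance : StarOrderedRing (SqMat ι R) := CStarAlgebra.spectralOrderedRing _

/-- The matrix with given entries. -/
def of {ι R : Type*} (f : ι → ι → R) : SqMat ι R := CStarMatrix.ofMatrix f

/-- The entries of a matrix. -/
def entry {ι R : Type*} (m : SqMat ι R) (k l : ι) : R := CStarMatrix.ofMatrix.symm m k l

@[simp] theorem entry_of {ι R : Type*} (f : ι → ι → R) (k l : ι) : entry (of f) k l = f k l := rfl

@[ext] theorem ext {ι R : Type*} {m m' : SqMat ι R} (h : ∀ k l, m.entry k l = m'.entry k l) :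
    m = m' := CStarMatrix.ext h

theorem entry_mul (m m' : SqMat ι R) (k l : ι) :
    (m * m').entry k l = ∑ i, m.entry k i * m'.entry i l := CStarMatrix.mul_apply

@[simp] theorem entry_add (m m' : SqMat ι R) (k l : ι) :
    (m + m').entry k l = m.entry k l + m'.entry k l := rfl

@[simp] theorem entry_sub (m m' : SqMat ι R) (k l : ι) :
    (m - m').entry k l = m.entry k l - m'.entry k l := rfl

@[simp] theorem entry_neg (m : SqMat ι R) (k l : ι) : (-m).entry k l = -m.entry k l := rfl

@[simp] theorem entry_zero (k l : ι) : (0 : SqMat ι R).entry k l = 0 := rfl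

@[simp] theorem entry_star (m : SqMat ι R) (k l : ι) : (star m).entry k l = star (m.entry l k) :=
  rfl

theorem entry_one (k l : ι) : (1 : SqMat ι R).entry k l = if k = l then 1 else 0 :=
  CStarMatrix.one_apply

theorem continuous_iff {Y : Type*} [TopologicalSpace Y] {f : Y → SqMat ι R} :
    Continuous f ↔ ∀ k l, Continuous fun y => (f y).entry k l :=
  continuous_pi_iff.trans (forall_congr' fun _ => continuous_pi_iff)

end SqMat

variable {R : Type*} [CStarAlgebra R] {ι : Type*} [Fintype ι]

/-- The standard `R`-valued inner product of rows, linear in the first variable. -/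
def rowInner (d c : ι → R) : R := ∑ k, d k * star (c k)

theorem rowInner_add (d c c' : ι → R) : rowInner d (c + c') = rowInner d c + rowInner d c' := by
  simp [rowInner, mul_add, Finset.sum_add_distrib]

theorem add_rowInner (d d' c : ι → R) : rowInner (d + d') c = rowInner d c + rowInner d' c := by
  simp [rowInner, add_mul, Finset.sum_add_distrib]

theorem sub_rowInner (d d' c : ι → R) : rowInner (d - d') c = rowInner d c - rowInner d' c := by
  simp [rowInner, sub_mul, Finset.sum_sub_distrib]

theorem smul_rowInner (a : R) (d c : ι → R) : rowInner (a • d) c = a * rowInner d c := by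
  simp [rowInner, Finset.mul_sum, mul_assoc]

theorem rowInner_smul (a : R) (d c : ι → R) : rowInner d (a • c) = rowInner d c * star a := by
  simp [rowInner, Finset.sum_mul, mul_assoc]

@[simp] theorem zero_rowInner (c : ι → R) : rowInner 0 c = 0 := by simp [rowInner]

@[simp] theorem rowInner_zero (c : ι → R) : rowInner c 0 = 0 := by simp [rowInner]

theorem star_rowInner (d c : ι → R) : star (rowInner d c) = rowInner c d := by
  simp [rowInner, star_sum]

@[simp] theorem rowInner_single [DecidableEq ι] (d : ι → R) (k : ι) :
    rowInner d (Pi.single k 1) = d k := by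
  simp only [rowInner]
  rw [Finset.sum_eq_single k] <;> simp +contextual

theorem continuous_rowInner {Y : Type*} [TopologicalSpace Y] {c d : Y → ι → R}
    (hd : Continuous d) (hc : Continuous c) : Continuous fun y => rowInner (d y) (c y) :=
  continuous_finsetSum _ fun k _ =>
    (continuous_pi_iff.1 hd k).mul (continuous_pi_iff.1 hc k).star

variable [PartialOrder R] [StarOrderedRing R]

theorem rowInner_self_nonneg (c : ι → R) : 0 ≤ rowInner c c :=
  Finset.sum_nonneg fun k _ => mul_star_self_nonneg (c k)

theorem rowInner_self_eq_zero {c : ι → R} (h : rowInner c c = 0) : c = 0 := by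
  ext k
  have := (Finset.sum_eq_zero_iff_of_nonneg fun k _ => mul_star_self_nonneg (c k)).1 h k
    (Finset.mem_univ k)
  simpa using this

variable [DecidableEq ι]

/-- The product of a row with a matrix. Matrices act on rows from the right, so that the action
commutes with left multiplication by scalars. -/
def rowMul (c : ι → R) (m : SqMat ι R) : ι → R := fun l => ∑ k, c k * m.entry k l

theorem rowMul_rowMul (c : ι → R) (m m' : SqMat ι R) :
    rowMul (rowMul c m) m' = rowMul c (m * m') := by
  ext l
  simp only [rowMul, SqMat.entry_mul, Finset.sum_mul, Finset.mul_sum, mul_assoc]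
  exact Finset.sum_comm

theorem rowMul_add (c : ι → R) (m m' : SqMat ι R) :
    rowMul c (m + m') = rowMul c m + rowMul c m' := by
  ext l
  simp [rowMul, mul_add, Finset.sum_add_distrib]

theorem rowMul_sub (c : ι → R) (m m' : SqMat ι R) :
    rowMul c (m - m') = rowMul c m - rowMul c m' := by
  ext l
  simp [rowMul, mul_sub, Finset.sum_sub_distrib]

theorem add_rowMul (c d : ι → R) (m : SqMat ι R) :
    rowMul (c + d) m = rowMul c m + rowMul d m := by
  ext l
  simp [rowMul, add_mul, Finset.sum_add_distrib]

theorem smul_rowMul (a : R) (c : ι → R) (m : SqMat ι R) :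
    rowMul (a • c) m = a • rowMul c m := by
  ext l
  simp [rowMul, Finset.mul_sum, mul_assoc]

@[simp] theorem zero_rowMul (m : SqMat ι R) : rowMul (0 : ι → R) m = 0 := by
  ext l
  simp [rowMul]

@[simp] theorem rowMul_zero (c : ι → R) : rowMul c (0 : SqMat ι R) = 0 := by
  ext l
  simp [rowMul]

theorem rowInner_rowMul (d c : ι → R) (m : SqMat ι R) :
    rowInner d (rowMul c m) = rowInner (rowMul d (star m)) c := by
  simp only [rowInner, rowMul, SqMat.entry_star, star_sum, star_mul, Finset.sum_mul,
    Finset.mul_sum, mul_assoc]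
  exact Finset.sum_comm

@[simp] theorem rowMul_one (c : ι → R) : rowMul c (1 : SqMat ι R) = c := by
  ext l
  simp [rowMul, SqMat.entry_one]

@[simp] theorem rowMul_single (k l : ι) (m : SqMat ι R) :
    rowMul (Pi.single k 1) m l = m.entry k l := by
  simp only [rowMul]
  rw [Finset.sum_eq_single k] <;> simp +contextual

theorem SqMat.ext_rowMul {m m' : SqMat ι R} (h : ∀ c, rowMul c m = rowMul c m') :
    m = m' := by
  ext k l
  simpa using congrFun (h (Pi.single k 1)) l

/-- A matrix whose quadratic form is real is self-adjoint, by polarization. -/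
theorem isSelfAdjoint_of_rowInner {m : SqMat ι R}
    (h : ∀ c, star (rowInner (rowMul c m) c) = rowInner (rowMul c m) c) : star m = m := by
  set B : (ι → R) → (ι → R) → R := fun d c => rowInner (rowMul d (star m - m)) c with hB
  have h0 : ∀ c, B c c = 0 := fun c => by
    have := h c
    rw [star_rowInner, rowInner_rowMul] at this
    simp only [hB, rowMul_sub, sub_rowInner, this, sub_self]
  have hadd : ∀ d c, B d c + B c d = 0 := fun d c => by
    have := h0 (d + c)
    simp only [hB, add_rowMul, add_rowInner, rowInner_add] at this h0 ⊢
    rw [h0, h0, zero_add, add_zero] at this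
    rw [add_comm, this]
  have key : ∀ d c, B d c = 0 := fun d c => by
    have h1 := hadd d c
    -- `B` is linear in `d` and conjugate linear in `c`: comparing `hadd` for `d` and for `i d`
    -- gives `B d c = 0`.
    have h2 := hadd ((Complex.I • (1 : R)) • d) c
    simp only [hB, smul_rowMul, smul_rowInner, rowInner_smul] at h1 h2
    simp only [star_smul, star_one, mul_smul_comm, smul_mul_assoc, one_mul, mul_one,
      Complex.star_def, Complex.conj_I] at h2
    rw [neg_smul, ← sub_eq_add_neg, ← smul_sub] at h2
    have h3 := (smul_eq_zero.1 h2).resolve_left Complex.I_ne_zero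
    have h4 : (2 : ℂ) • rowInner (rowMul d (star m - m)) c = 0 := by
      rw [two_smul]
      nth_rewrite 1 [eq_neg_of_add_eq_zero_left h1]
      rw [sub_eq_zero.1 h3]
      simp
    exact (smul_eq_zero.1 h4).resolve_left two_ne_zero
  have : star m - m = 0 := by
    ext k l
    have := key (Pi.single k 1) (Pi.single l 1)
    simpa only [hB, rowInner_single, rowMul_single, SqMat.entry_zero] using this
  exact sub_eq_zero.1 this

theorem rowInner_rowMul_nonneg {m : SqMat ι R} (hm : 0 ≤ m) (c : ι → R) :
    0 ≤ rowInner (rowMul c m) c := by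
  obtain ⟨x, rfl⟩ := CStarAlgebra.nonneg_iff_eq_star_mul_self.1 hm
  rw [← rowMul_rowMul]
  have := rowInner_rowMul (rowMul c (star x)) c (star x)
  rw [star_star] at this
  rw [← this]
  exact rowInner_self_nonneg _

/-- A matrix with nonnegative quadratic form is nonnegative. Nonnegativity of the matrix refers to the
`C*`-algebra of matrices, so this is a spectral statement. -/
theorem nonneg_of_rowInner {m : SqMat ι R}
    (h : ∀ c, 0 ≤ rowInner (rowMul c m) c) : 0 ≤ m := by
  have hsa : IsSelfAdjoint m :=
    isSelfAdjoint_of_rowInner fun c => (IsSelfAdjoint.of_nonneg (h c)).star_eq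
  -- With `n` the negative part of `m`, the diagonal entries of `n m n = -n³` are both `≥ 0` and
  -- `≤ 0`, which forces `n = 0`.
  set n := m⁻ with hn
  have hn0 : 0 ≤ n := CFC.negPart_nonneg m
  have hnsa : star n = n := (IsSelfAdjoint.of_nonneg hn0).star_eq
  have hnm : n * m * n = -(n * n * n) := by
    conv_lhs => rw [← CFC.posPart_sub_negPart m hsa]
    rw [mul_sub, sub_mul, CFC.negPart_mul_posPart]
    simp [hn]
  -- `n³ = y y^*`, so that the diagonal entries of `n³` are squared norms of the rows of `y`.
  set y := CFC.sqrt n * n with hy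
  have hsq : star (CFC.sqrt n) = CFC.sqrt n :=
    (IsSelfAdjoint.of_nonneg (CFC.sqrt_nonneg n)).star_eq
  have hcomm : CFC.sqrt n * n = n * CFC.sqrt n := by
    have e := CFC.sqrt_mul_sqrt_self n
    calc CFC.sqrt n * n = CFC.sqrt n * (CFC.sqrt n * CFC.sqrt n) := by rw [e]
      _ = n * CFC.sqrt n := by rw [← mul_assoc, e]
  have hyy : y * star y = n * n * n := by
    rw [hy, star_mul, hnsa, hsq, hcomm]
    calc n * CFC.sqrt n * (n * CFC.sqrt n) = n * CFC.sqrt n * (CFC.sqrt n * n) := by rw [hcomm]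
      _ = n * (CFC.sqrt n * CFC.sqrt n) * n := by simp only [mul_assoc]
      _ = n * n * n := by rw [CFC.sqrt_mul_sqrt_self n]
  have hy0 : ∀ k, rowMul (Pi.single k 1) y = 0 := fun k => by
    apply rowInner_self_eq_zero
    refine le_antisymm ?_ (rowInner_self_nonneg _)
    have := h (rowMul (Pi.single k 1) n)
    rw [rowInner_rowMul, hnsa, rowMul_rowMul, rowMul_rowMul, ← mul_assoc, hnm, ← hyy] at this
    rw [rowInner_rowMul, rowMul_rowMul]
    have h2 : rowInner (rowMul (Pi.single k 1) (-(y * star y))) (Pi.single k 1) =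
        -rowInner (rowMul (Pi.single k 1) (y * star y)) (Pi.single k (1 : R)) := by simp
    rw [h2] at this
    exact neg_nonneg.1 this
  have hyz : y = 0 := SqMat.ext_rowMul fun c => by
    ext l
    have : ∀ k, y.entry k l = 0 := fun k => by simpa using congrFun (hy0 k) l
    simp [rowMul, this]
  have hn3 : n * n * n = 0 := by rw [← hyy, hyz, zero_mul]
  have hnn : n * n = 0 := by
    have : star (n * n) * (n * n) = 0 := by
      rw [star_mul, hnsa, ← mul_assoc, hn3, zero_mul]
    exact CStarRing.star_mul_self_eq_zero_iff (n * n) |>.1 this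
  have hnz : n = 0 := by
    have : star n * n = 0 := by rw [hnsa, hnn]
    exact CStarRing.star_mul_self_eq_zero_iff n |>.1 this
  have := CFC.posPart_sub_negPart m hsa
  rw [← hn, hnz, sub_zero] at this
  rw [← this]
  exact CFC.posPart_nonneg m

/-- The element `p p^* + (1 - p) (1 - p)^*` is invertible, since it equals
`½ (1 + (2p - 1) (2p - 1)^*)`. For an idempotent `p` of a matrix algebra it is the Gram matrix of
the sum of the standard inner products on the image and the kernel of `p`. -/
theorem isUnit_idempotent_add {B : Type*} [CStarAlgebra B] [PartialOrder B] [StarOrderedRing B]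
    (p : B) : IsUnit (p * star p + (1 - p) * star (1 - p)) := by
  have h1 : (1 : B) ≤ (2 : ℂ) • (p * star p + (1 - p) * star (1 - p)) := by
    have h2 : (2 : ℂ) • (p * star p + (1 - p) * star (1 - p)) =
        1 + (p - (1 - p)) * star (p - (1 - p)) := by
      simp only [two_smul, star_sub, star_one]
      noncomm_ring
    rw [h2]
    exact le_add_of_nonneg_right (mul_star_self_nonneg _)
  have h2 : IsUnit ((2 : ℂ) • (p * star p + (1 - p) * star (1 - p))) :=
    CStarAlgebra.isUnit_of_le 1 h1
  have := h2.smul (Units.mk0 (2⁻¹ : ℂ) (by norm_num))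
  simpa [Units.smul_def, smul_smul] using this

theorem continuous_rowMul {Y : Type*} [TopologicalSpace Y] {c : Y → ι → R}
    {f : Y → SqMat ι R} (hc : Continuous c) (hf : Continuous f) :
    Continuous fun y => rowMul (c y) (f y) := by
  refine continuous_pi fun l => continuous_finsetSum _ fun k _ => ?_
  exact (continuous_pi_iff.1 hc k).mul (SqMat.continuous_iff.1 hf k l)

end Rows

/-! ### Positive forms on finitely generated projective modules -/

section Fibre

variable {a : Type*} [Ring a] {R : Type*} [CStarAlgebra R] [PartialOrder R] [StarOrderedRing R]
  {θ : a ≃+* R} {V : Type*} [AddCommGroup V] [Module a V] {ι : Type*} [Fintype ι] [DecidableEq ι]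

/-- The matrix of a linear endomorphism of a space of rows. -/
def SqMat.ofLinear (f : (ι → R) →ₗ[R] (ι → R)) : SqMat ι R :=
  SqMat.of fun k l => f (Pi.single k 1) l

theorem sum_smul_single (c : ι → R) : ∑ k, c k • (Pi.single k (1 : R) : ι → R) = c := by
  ext l
  simp [Finset.sum_apply, Pi.single_apply]

@[simp] theorem rowMul_ofLinear (f : (ι → R) →ₗ[R] (ι → R)) (c : ι → R) :
    rowMul c (SqMat.ofLinear f) = f c := by
  conv_rhs => rw [← sum_smul_single c, map_sum]
  ext l
  simp [rowMul, SqMat.ofLinear]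

/-- Every functional on rows is an inner product. -/
theorem rowInner_star_apply (f : (ι → R) →ₗ[R] R) (d : ι → R) :
    rowInner d (fun k => star (f (Pi.single k 1))) = f d := by
  conv_rhs => rw [← sum_smul_single d, map_sum]
  simp [rowInner]

/-- A presentation of the `a`-module `V` as a retract of a module of rows over the algebra `R`,
which is identified with `a` by `θ`: `coord` sends a vector to its row of coefficients and `comb`
forms linear combinations of the elements of the frame. -/
structure FibreFrame (θ : a ≃+* R) (V : Type*) [AddCommGroup V] [Module a V] (ι : Type*) where
  coord : V →+ (ι → R)
  comb : (ι → R) →+ V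
  coord_smul : ∀ b v, coord (b • v) = θ b • coord v
  comb_smul : ∀ b c, comb (θ b • c) = b • comb c
  comb_coord : ∀ v, comb (coord v) = v

/-- A positive sesquilinear form: `B v w` is linear in `w` and conjugate linear in `v`. -/
structure IsPosForm (θ : a ≃+* R) (B : V →+ (V →ₗ[a] a)) : Prop where
  smul : ∀ b v w, θ (B (b • v) w) = θ (B v w) * star (θ b)
  pos : ∀ v, 0 ≤ θ (B v v)

namespace FibreFrame

variable (F : FibreFrame θ V ι)

/-- An endomorphism of `V`, extended by zero on the kernel of `comb` to all rows. -/
def rowMap (T : V →ₗ[a] V) : (ι → R) →ₗ[R] (ι → R) where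
  toFun c := F.coord (T (F.comb c))
  map_add' c d := by simp
  map_smul' b c := by
    have := F.comb_smul (θ.symm b) c
    rw [RingEquiv.apply_symm_apply] at this
    rw [this, map_smul, F.coord_smul]
    simp

@[simp] theorem rowMap_apply (T : V →ₗ[a] V) (c : ι → R) :
    F.rowMap T c = F.coord (T (F.comb c)) := rfl

/-- The matrix of an endomorphism in a frame. -/
def mat (T : V →ₗ[a] V) : SqMat ι R := SqMat.ofLinear (F.rowMap T)

theorem rowMul_mat (T : V →ₗ[a] V) (c : ι → R) :
    rowMul c (F.mat T) = F.coord (T (F.comb c)) := by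
  simp [mat]

theorem mat_mul_mat (T T' : V →ₗ[a] V) : F.mat T * F.mat T' = F.mat (T' ∘ₗ T) :=
  SqMat.ext_rowMul fun c => by
    simp [← rowMul_rowMul, rowMul_mat, F.comb_coord]

/-- The endomorphism of `V` given by a matrix. -/
def ofMat (m : SqMat ι R) : V →ₗ[a] V where
  toFun v := F.comb (rowMul (F.coord v) m)
  map_add' v w := by simp [add_rowMul]
  map_smul' b v := by rw [F.coord_smul, smul_rowMul, F.comb_smul]; rfl

theorem ofMat_apply (m : SqMat ι R) (v : V) : F.ofMat m v = F.comb (rowMul (F.coord v) m) := rfl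

theorem ofMat_mat (T : V →ₗ[a] V) : F.ofMat (F.mat T) = T :=
  LinearMap.ext fun v => by simp [ofMat_apply, rowMul_mat, F.comb_coord]

/-- The idempotent matrix of a frame. -/
def proj : SqMat ι R := F.mat LinearMap.id

theorem rowMul_proj (c : ι → R) : rowMul c F.proj = F.coord (F.comb c) := F.rowMul_mat _ c

theorem proj_mul_proj : F.proj * F.proj = F.proj := F.mat_mul_mat _ _

theorem rowMul_coord_proj (v : V) : rowMul (F.coord v) F.proj = F.coord v := by
  rw [rowMul_proj, F.comb_coord]

theorem rowMul_coord_one_sub_proj (v : V) : rowMul (F.coord v) (1 - F.proj) = 0 := by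
  rw [rowMul_sub, rowMul_one, rowMul_coord_proj, sub_self]

theorem comb_rowMul_one_sub_proj (c : ι → R) : F.comb (rowMul c (1 - F.proj)) = 0 := by
  rw [rowMul_sub, rowMul_one, rowMul_proj, map_sub, F.comb_coord, sub_self]

variable {B B' : V →+ (V →ₗ[a] a)}

/-- The Gram matrix of a form in a frame. -/
def gram (B : V →+ (V →ₗ[a] a)) : SqMat ι R :=
  SqMat.of fun k l => θ (B (F.comb (Pi.single l 1)) (F.comb (Pi.single k 1)))

/-- A form is determined by its Gram matrix. Only sesquilinearity is used. -/
theorem theta_form_comb (hB : ∀ b v w, θ (B (b • v) w) = θ (B v w) * star (θ b)) (c d : ι → R) :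
    rowInner (rowMul d (F.gram B)) c = θ (B (F.comb c) (F.comb d)) := by
  have hcomb : ∀ c : ι → R, F.comb c = ∑ k, θ.symm (c k) • F.comb (Pi.single k 1) := fun c => by
    conv_lhs => rw [← sum_smul_single c, map_sum]
    refine Finset.sum_congr rfl fun k _ => ?_
    rw [← F.comb_smul, RingEquiv.apply_symm_apply]
  rw [hcomb c, hcomb d]
  simp only [map_sum, LinearMap.sum_apply, map_smul, smul_eq_mul,
    map_mul, RingEquiv.apply_symm_apply, hB, rowInner, rowMul, gram, SqMat.entry_of,
    Finset.sum_mul, Finset.mul_sum, mul_assoc]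
  exact Finset.sum_comm

theorem gram_nonneg (hB : IsPosForm θ B) : 0 ≤ F.gram B :=
  nonneg_of_rowInner fun c => by
    rw [theta_form_comb F hB.smul]
    exact hB.pos _

/-- The Gram matrix of the extension of a form from `V` to all rows by the standard inner product
on the complement of `V`. -/
def extGram (B : V →+ (V →ₗ[a] a)) : SqMat ι R :=
  F.gram B + (1 - F.proj) * star (1 - F.proj)

theorem rowInner_extGram (hB : ∀ b v w, θ (B (b • v) w) = θ (B v w) * star (θ b)) (c d : ι → R) :
    rowInner (rowMul d (F.extGram B)) c = θ (B (F.comb c) (F.comb d)) +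
      rowInner (rowMul d (1 - F.proj)) (rowMul c (1 - F.proj)) := by
  rw [extGram, rowMul_add, add_rowInner, theta_form_comb F hB, rowInner_rowMul, rowMul_rowMul]

theorem extGram_nonneg (hB : IsPosForm θ B) : 0 ≤ F.extGram B :=
  add_nonneg (F.gram_nonneg hB) (mul_star_self_nonneg _)

theorem rowInner_extGram_coord (hB : ∀ b v w, θ (B (b • v) w) = θ (B v w) * star (θ b))
    (c : ι → R) (w : V) :
    rowInner (rowMul (F.coord w) (F.extGram B)) c = θ (B (F.comb c) w) := by
  rw [rowInner_extGram F hB, rowMul_coord_one_sub_proj, F.comb_coord, zero_rowInner, add_zero]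

/-- The functional on rows given by a functional on `V`. -/
def rowFunctional (f : V →ₗ[a] a) : (ι → R) →ₗ[R] R where
  toFun d := θ (f (F.comb d))
  map_add' c d := by simp
  map_smul' b d := by
    have := F.comb_smul (θ.symm b) d
    rw [RingEquiv.apply_symm_apply] at this
    rw [this, map_smul, smul_eq_mul, map_mul, RingEquiv.apply_symm_apply]
    rfl

theorem surjective_of_isUnit (hB : ∀ b v w, θ (B (b • v) w) = θ (B v w) * star (θ b))
    (h : IsUnit (F.extGram B)) : Function.Surjective B := by
  intro f
  obtain ⟨g, hg⟩ := h
  set φ : ι → R := fun k => star (F.rowFunctional f (Pi.single k 1))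
  refine ⟨F.comb (rowMul φ (star (↑g⁻¹ : SqMat ι R))), LinearMap.ext fun w => θ.injective ?_⟩
  rw [← rowInner_extGram_coord F hB, rowInner_rowMul, star_star, rowMul_rowMul, ← hg, g.mul_inv,
    rowMul_one, rowInner_star_apply]
  simp [rowFunctional, F.comb_coord]

/-- A coordinate function as a functional on `V`. -/
def coordFunctional (φ : ι → R) : V →ₗ[a] a where
  toFun w := θ.symm (rowInner (F.coord w) φ)
  map_add' v w := by simp [add_rowInner]
  map_smul' b v := by
    rw [F.coord_smul, smul_rowInner, map_mul, RingEquiv.symm_apply_apply]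
    rfl

/-- The extended Gram matrix of a nondegenerate positive form is invertible: the form is
nondegenerate on `V` by assumption and on the complement of `V` by `isUnit_idempotent_add`. -/
theorem isUnit_extGram (hB : IsPosForm θ B) (h : Function.Surjective B) :
    IsUnit (F.extGram B) := by
  set p := F.proj with hp
  set q := 1 - p with hq
  have hqp : q * p = 0 := by rw [hq, sub_mul, one_mul, F.proj_mul_proj, sub_self]
  have hqq : q * q = q := by
    conv_lhs => rw [hq, mul_sub, mul_one, ← hq, hqp, sub_zero]
  -- Every row functional is represented by some `c`: its restriction to `V` by nondegeneracy,
  -- its restriction to the complement through the inverse of `p p^* + q q^*`.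
  have key : ∀ φ : ι → R, ∃ c, ∀ d,
      rowInner (rowMul d (F.extGram B)) c = rowInner d φ := fun φ => by
    obtain ⟨v, hv⟩ := h (F.coordFunctional φ)
    obtain ⟨k, hk⟩ := isUnit_idempotent_add p
    set c' := rowMul (rowMul φ (star q)) (star (↑k⁻¹ : SqMat ι R)) with hc'
    have hc : ∀ d, rowInner (rowMul d q) (rowMul c' q) = rowInner (rowMul d q) φ := fun d => by
      have h1 : q * (k : SqMat ι R) = q * star q := by
        rw [hk, ← hq, mul_add, ← mul_assoc, hqp, zero_mul, zero_add, ← mul_assoc, hqq]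
      have h2 : q * star q * (↑k⁻¹ : SqMat ι R) = q := by
        rw [← h1, mul_assoc, k.mul_inv, mul_one]
      rw [rowInner_rowMul, rowMul_rowMul, hc', rowInner_rowMul, star_star, rowMul_rowMul, h2,
        rowInner_rowMul, star_star, rowMul_rowMul, hqq]
    refine ⟨F.coord v + rowMul c' q, fun d => ?_⟩
    rw [rowInner_extGram F hB.smul, map_add, F.comb_coord, F.comb_rowMul_one_sub_proj, add_zero,
      add_rowMul, F.rowMul_coord_one_sub_proj, zero_add, rowMul_rowMul, ← hp, ← hq, hqq, hc, hv]
    change θ (θ.symm _) + _ = _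
    rw [RingEquiv.apply_symm_apply, ← F.rowMul_proj, ← add_rowInner, ← rowMul_add, ← hp, hq]
    simp
  choose c hc using fun l : ι => key (Pi.single l 1)
  set z : SqMat ι R := SqMat.of fun k l => star (c l k)
  have hz : F.extGram B * z = 1 := by
    ext i l
    have := hc l (Pi.single i 1)
    rw [rowInner_single] at this
    rw [SqMat.entry_mul, SqMat.entry_one, ← Pi.single_apply, Pi.single_comm, ← this]
    simp [rowInner, z]
  have hsa : star (F.extGram B) = F.extGram B :=
    (IsSelfAdjoint.of_nonneg (F.extGram_nonneg hB)).star_eq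
  have hz' : star z * F.extGram B = 1 := by
    rw [← hsa, ← star_mul, hz, star_one]
  refine ⟨⟨F.extGram B, z, hz, ?_⟩, rfl⟩
  rwa [← left_inv_eq_right_inv hz' hz]

/-- A positive form is hermitian. -/
theorem form_symm (F : FibreFrame θ V ι) (hB : IsPosForm θ B) (v w : V) :
    θ (B w v) = star (θ (B v w)) := by
  have hsa : star (F.gram B) = F.gram B := (IsSelfAdjoint.of_nonneg (F.gram_nonneg hB)).star_eq
  rw [← F.comb_coord v, ← F.comb_coord w, ← theta_form_comb F hB.smul,
    ← theta_form_comb F hB.smul, star_rowInner, rowInner_rowMul, hsa]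

/-- A positive form which is onto the dual module is nondegenerate: being hermitian, its kernel
is annihilated by all functionals. -/
theorem bijective_of_surjective (F : FibreFrame θ V ι) (hB : IsPosForm θ B)
    (h : Function.Surjective B) : Function.Bijective B := by
  refine ⟨(injective_iff_map_eq_zero B).2 fun v hv => ?_, h⟩
  have h0 : ∀ f : V →ₗ[a] a, f v = 0 := fun f => by
    obtain ⟨w, rfl⟩ := h f
    apply θ.injective
    rw [F.form_symm hB v w, hv]
    simp
  have : F.coord v = 0 := by
    ext k
    have := h0 (F.coordFunctional (Pi.single k 1))
    change θ.symm (rowInner (F.coord v) (Pi.single k 1)) = 0 at this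
    rw [rowInner_single] at this
    simpa using this
  rw [← F.comb_coord v, this, map_zero]

/-- A form which dominates a nondegenerate positive form is nondegenerate. -/
theorem bijective_of_le (F : FibreFrame θ V ι) (hB : IsPosForm θ B) (h : Function.Bijective B)
    (hB' : IsPosForm θ B') (hle : ∀ v, θ (B v v) ≤ θ (B' v v)) : Function.Bijective B' := by
  refine F.bijective_of_surjective hB' (F.surjective_of_isUnit hB'.smul ?_)
  have := F.extGram_nonneg hB
  have hu := F.isUnit_extGram hB h.2
  refine CStarAlgebra.isUnit_of_le (F.extGram B) ?_ (hu.isStrictlyPositive this)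
  refine sub_nonneg.1 (nonneg_of_rowInner fun c => ?_)
  rw [rowMul_sub, sub_rowInner, rowInner_extGram F hB.smul, rowInner_extGram F hB'.smul]
  simpa using hle (F.comb c)

/-- A form which dominates a positive multiple of the inner product in a frame is nondegenerate. -/
theorem bijective_of_smul_le (F : FibreFrame θ V ι) {r : ℝ} (hr : 0 < r) (hB : IsPosForm θ B)
    (hle : ∀ v, r • rowInner (F.coord v) (F.coord v) ≤ θ (B v v)) : Function.Bijective B := by
  refine F.bijective_of_surjective hB (F.surjective_of_isUnit hB.smul ?_)
  set p := F.proj with hp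
  -- `k` is the Gram matrix of the standard inner products on `V` and on its complement. The
  -- extended Gram matrix of `B` is at least `μ k`, where `μ ≤ r` takes care of `V` and `μ ≤ 1` of
  -- the complement.
  set k := p * star p + (1 - p) * star (1 - p) with hk
  have hk0 : 0 ≤ k := add_nonneg (mul_star_self_nonneg _) (mul_star_self_nonneg _)
  set μ := min r 1
  have hμ : 0 < μ := lt_min hr one_pos
  have hu : IsUnit ((μ : ℂ) • k) := by
    have := (isUnit_idempotent_add p).smul (Units.mk0 (μ : ℂ) (by exact_mod_cast hμ.ne'))
    rw [Units.smul_mk_apply] at this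
    exact this
  have hpos : 0 ≤ μ • k := smul_nonneg hμ.le hk0
  refine CStarAlgebra.isUnit_of_le (μ • k) ?_ (IsUnit.isStrictlyPositive hu hpos)
  refine sub_nonneg.1 (nonneg_of_rowInner fun c => ?_)
  have h1 : rowInner (rowMul c (μ • k)) c = μ • rowInner (rowMul c p) (rowMul c p) +
      μ • rowInner (rowMul c (1 - p)) (rowMul c (1 - p)) := by
    have : rowMul c (μ • k) = μ • rowMul c k := by
      ext l
      simp only [rowMul, Pi.smul_apply, Finset.smul_sum]
      refine Finset.sum_congr rfl fun i _ => ?_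
      change c i * (μ • k.entry i l) = _
      rw [mul_smul_comm]
    rw [this, rowInner_rowMul, rowInner_rowMul, rowMul_rowMul, rowMul_rowMul, ← smul_add,
      ← add_rowInner, ← rowMul_add, ← hk]
    simp [rowInner, Finset.smul_sum]
  rw [rowMul_sub, sub_rowInner, rowInner_extGram F hB.smul, h1, sub_nonneg, hp, F.rowMul_proj]
  refine add_le_add ?_ ?_
  · refine le_trans ?_ (hle (F.comb c))
    exact smul_le_smul_of_nonneg_right (min_le_left r 1) (rowInner_self_nonneg _)
  · have := smul_le_smul_of_nonneg_right (min_le_right r 1)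
      (rowInner_self_nonneg (rowMul c (1 - F.proj)))
    rwa [one_smul] at this

/-- A frame is a Parseval frame for a form if `comb` is the adjoint of `coord`. In such a frame
the form is the restriction of the standard inner product, and adjoints of endomorphisms correspond
to adjoints of matrices. -/
def IsParseval (F : FibreFrame θ V ι) (B : V →+ (V →ₗ[a] a)) : Prop :=
  ∀ c w, θ (B (F.comb c) w) = rowInner (F.coord w) c

/-- The change of a frame by an invertible matrix. -/
def transform (F : FibreFrame θ V ι) (g : (SqMat ι R)ˣ) : FibreFrame θ V ι where
  coord :=
    { toFun := fun v => rowMul (F.coord v) g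
      map_zero' := by simp
      map_add' := fun v w => by rw [map_add, add_rowMul] }
  comb :=
    { toFun := fun c => F.comb (rowMul c (↑g⁻¹ : SqMat ι R))
      map_zero' := by simp
      map_add' := fun c d => by rw [add_rowMul, map_add] }
  coord_smul b v := by
    change rowMul (F.coord (b • v)) _ = θ b • rowMul (F.coord v) _
    rw [F.coord_smul, smul_rowMul]
  comb_smul b c := by
    change F.comb (rowMul (θ b • c) _) = b • F.comb (rowMul c _)
    rw [smul_rowMul, F.comb_smul]
  comb_coord v := by
    change F.comb (rowMul (rowMul (F.coord v) _) _) = v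
    rw [rowMul_rowMul, g.mul_inv, rowMul_one, F.comb_coord]

/-- The square root of the extended Gram matrix turns a frame into a Parseval frame. -/
theorem isParseval_transform (F : FibreFrame θ V ι) (hB : IsPosForm θ B) (g : (SqMat ι R)ˣ)
    (hg : (g : SqMat ι R) = CFC.sqrt (F.extGram B)) : (F.transform g).IsParseval B := by
  intro c w
  have hsa : star (g : SqMat ι R) = g := by
    rw [hg]
    exact (IsSelfAdjoint.of_nonneg (CFC.sqrt_nonneg _)).star_eq
  have hsa' : star (↑g⁻¹ : SqMat ι R) = ↑g⁻¹ := by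
    rw [← Units.coe_star_inv, show star g = g from Units.ext hsa]
  have hgg : F.extGram B = (g : SqMat ι R) * g := by
    rw [hg, CFC.sqrt_mul_sqrt_self _ (F.extGram_nonneg hB)]
  change θ (B (F.comb (rowMul c (↑g⁻¹ : SqMat ι R))) w) = rowInner (rowMul (F.coord w) g) c
  rw [← F.rowInner_extGram_coord hB.smul, rowInner_rowMul, hsa', rowMul_rowMul, hgg, mul_assoc,
    g.mul_inv, mul_one]

theorem isUnit_sqrt_extGram (F : FibreFrame θ V ι) (hB : IsPosForm θ B)
    (h : Function.Surjective B) : IsUnit (CFC.sqrt (F.extGram B)) :=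
  (CFC.isUnit_sqrt_iff _ (F.extGram_nonneg hB)).2 (F.isUnit_extGram hB h)

/-! ### Square roots of positive endomorphisms -/

theorem mat_nonneg (F : FibreFrame θ V ι) (hB : IsPosForm θ B) (hF : F.IsParseval B)
    {S : V →ₗ[a] V} (hS : ∀ v, 0 ≤ θ (B (S v) v)) : 0 ≤ F.mat S :=
  nonneg_of_rowInner fun c => by
    rw [F.rowMul_mat, ← hF, F.form_symm hB, star_nonneg_iff]
    exact hS _

/-- The positive square root of a positive endomorphism, computed in a Parseval frame. -/
def sqrtEnd (F : FibreFrame θ V ι) (S : V →ₗ[a] V) : V →ₗ[a] V := F.ofMat (CFC.sqrt (F.mat S))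

theorem sqrtEnd_sqrtEnd (F : FibreFrame θ V ι) (hB : IsPosForm θ B) (hF : F.IsParseval B)
    {S : V →ₗ[a] V} (hS : ∀ v, 0 ≤ θ (B (S v) v)) (v : V) :
    F.sqrtEnd S (F.sqrtEnd S v) = S v := by
  -- The projection commutes with the matrix of `S`, hence with its square root.
  have hc : Commute (CFC.sqrt (F.mat S)) F.proj := by
    refine Commute.cfcₙ_nnreal ?_ _
    have h1 : F.mat S * F.proj = F.mat S := F.mat_mul_mat _ _
    have h2 : F.proj * F.mat S = F.mat S := F.mat_mul_mat _ _
    exact h1.trans h2.symm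
  simp only [sqrtEnd, ofMat_apply]
  rw [← F.rowMul_proj, rowMul_rowMul, rowMul_rowMul, ← mul_assoc, hc.eq, mul_assoc,
    CFC.sqrt_mul_sqrt_self _ (F.mat_nonneg hB hF hS), ← rowMul_rowMul, F.rowMul_coord_proj,
    F.rowMul_mat, F.comb_coord, F.comb_coord]

theorem sqrtEnd_nonneg (F : FibreFrame θ V ι) (hF : F.IsParseval B) (S : V →ₗ[a] V) (v : V) :
    0 ≤ θ (B (F.sqrtEnd S v) v) := by
  rw [sqrtEnd, ofMat_apply, hF, rowInner_rowMul,
    (IsSelfAdjoint.of_nonneg (CFC.sqrt_nonneg (F.mat S))).star_eq]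
  exact rowInner_rowMul_nonneg (CFC.sqrt_nonneg _) _

/-- A positive endomorphism is self-adjoint. -/
theorem selfAdjoint_of_nonneg (F : FibreFrame θ V ι) (hB : IsPosForm θ B) (hF : F.IsParseval B)
    {S : V →ₗ[a] V} (hS : ∀ v, 0 ≤ θ (B (S v) v)) (v w : V) : B (S v) w = B v (S w) := by
  apply θ.injective
  have hsa := (IsSelfAdjoint.of_nonneg (F.mat_nonneg hB hF hS)).star_eq
  conv_lhs => rw [← F.comb_coord (S v), hF, ← F.comb_coord v, ← F.rowMul_mat, rowInner_rowMul, hsa,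
    F.rowMul_mat, F.comb_coord]
  conv_rhs => rw [← F.comb_coord v, hF]

/-- Uniqueness of positive square roots. -/
theorem eq_sqrtEnd (F : FibreFrame θ V ι) (hB : IsPosForm θ B) (hF : F.IsParseval B)
    {S U : V →ₗ[a] V} (hU : ∀ v, 0 ≤ θ (B (U v) v)) (hUU : ∀ v, U (U v) = S v) :
    U = F.sqrtEnd S := by
  have h : F.mat U * F.mat U = F.mat S := by
    rw [F.mat_mul_mat]
    congr 1
    exact LinearMap.ext hUU
  rw [sqrtEnd, CFC.sqrt_unique h (F.mat_nonneg hB hF hU), F.ofMat_mat]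

end FibreFrame

end Fibre

/-! ### Frames of bundles -/

/-- Continuity of a map on a space over `X` is local over `X`. -/
theorem continuous_of_locally {X Y Z : Type*} [TopologicalSpace X] [TopologicalSpace Y]
    [TopologicalSpace Z] {π : Y → X} (hπ : Continuous π) {f : Y → Z}
    (h : ∀ x, ∃ U : Set X, IsOpen U ∧ x ∈ U ∧ Continuous fun p : {p : Y // π p ∈ U} => f p) :
    Continuous f := by
  refine continuous_iff_continuousAt.2 fun y => ?_
  obtain ⟨U, hU, hy, hf⟩ := h (π y)
  have : ContinuousOn f (π ⁻¹' U) := continuousOn_iff_continuous_domRestrict.2 hf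
  exact this.continuousAt ((hU.preimage hπ).mem_nhds hy)

section Frames

variable {X : Type u} [TopologicalSpace X] [InvolutiveSpace X]
  {C : Type v} [Ring C] [Algebra ℝ C] [TopologicalSpace C]
  {R : Type*} [CStarAlgebra R] [PartialOrder R] [StarOrderedRing R]
  {𝒜 : RealAlgebraBundle X C} (e : C ≃A[ℝ] R)

/-- The fibres of `𝒜` near `x`, identified with the `C*`-algebra `R` by the chart at `x` and an
isomorphism `e` of the model fibre with `R`. -/
def theta (x : X) (y : (𝒜.chartAt x).base) : 𝒜.fiber y ≃+* R :=
  (((𝒜.chartAt x).iso y).trans e.toAlgEquiv).toRingEquiv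

theorem theta_apply (x : X) (y : (𝒜.chartAt x).base) (a : 𝒜.fiber y) :
    theta e x y a = e ((𝒜.chartAt x).iso y a) := rfl

theorem theta_real_smul (x : X) (y : (𝒜.chartAt x).base) (r : ℝ) (a : 𝒜.fiber y) :
    theta e x y (r • a) = r • theta e x y a :=
  map_smul (((𝒜.chartAt x).iso y).trans e.toAlgEquiv) r a

theorem continuous_theta {Y : Type*} [TopologicalSpace Y] {f : Y → Tot 𝒜.fiber}
    (hf : Continuous f) {x : X} (h : ∀ y, (f y).proj ∈ (𝒜.chartAt x).base) :
    Continuous fun y => theta e x ⟨(f y).proj, h y⟩ (f y).snd :=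
  e.continuous.comp ((𝒜.chartAt x).continuous_iso.comp (hf.subtype_mk h))

theorem continuous_theta_symm {Y : Type*} [TopologicalSpace Y] {x : X}
    {g : Y → (𝒜.chartAt x).base} {f : Y → R} (hg : Continuous g) (hf : Continuous f) :
    Continuous fun y => (⟨g y, (theta e x (g y)).symm (f y)⟩ : Tot 𝒜.fiber) :=
  (𝒜.chartAt x).continuous_symm.comp (hg.prodMk (e.symm.continuous.comp hf))

/-- The anti-involution `h` corresponds to the star operation of the `C*`-algebra `R` under the
charts of `𝒜`. -/
def IsCStarInvolution (h : AntiInvolution 𝒜) : Prop :=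
  ∀ x (y : (𝒜.chartAt x).base) (a : 𝒜.fiber y), theta e x y (h.star y a) = star (theta e x y a)

/-- Nonnegative elements of the fibres, for an anti-involution `h`. -/
def AntiInvolution.IsNonneg (h : AntiInvolution 𝒜) (x : X) (b : 𝒜.fiber x) : Prop :=
  ∃ c, b = h.star x c * c

variable {e} {h : AntiInvolution 𝒜}

theorem isNonneg_iff (he : IsCStarInvolution e h) (x : X) (y : (𝒜.chartAt x).base)
    (b : 𝒜.fiber y) : h.IsNonneg y b ↔ 0 ≤ theta e x y b := by
  rw [CStarAlgebra.nonneg_iff_eq_star_mul_self]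
  constructor
  · rintro ⟨c, rfl⟩
    exact ⟨theta e x y c, by rw [map_mul, he]⟩
  · rintro ⟨c, hc⟩
    refine ⟨(theta e x y).symm c, (theta e x y).injective ?_⟩
    rw [map_mul, he, RingEquiv.apply_symm_apply, hc]

theorem IsNonneg.add (he : IsCStarInvolution e h) {x : X} {b b' : 𝒜.fiber x}
    (hb : h.IsNonneg x b) (hb' : h.IsNonneg x b') : h.IsNonneg x (b + b') := by
  have key := fun b => isNonneg_iff he x ⟨x, 𝒜.mem_chartAt x⟩ b
  refine (key _).2 ?_
  rw [map_add]
  exact add_nonneg ((key b).1 hb) ((key b').1 hb')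

variable (e)

/-- A local frame of a Real bundle: over the open set `base` the fibres of `E` are retracts of
modules of rows over `R`, continuously in the point of the base. The fibres of `𝒜` are identified
with `R` by the chart at the point `pt`. -/
structure LocalFrame (E : RealBundle 𝒜) where
  pt : X
  base : Set X
  isOpen_base : IsOpen base
  base_subset : base ⊆ (𝒜.chartAt pt).base
  n : ℕ
  frame : ∀ y : base, FibreFrame (theta e pt ⟨y, base_subset y.2⟩) (E.fiber y) (Fin n)
  continuous_coord : Continuous fun p : {p : Tot E.fiber // p.proj ∈ base} =>
    (frame ⟨p.1.proj, p.2⟩).coord p.1.snd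
  continuous_comb : Continuous fun q : base × (Fin n → R) =>
    (⟨q.1, (frame q.1).comb q.2⟩ : Tot E.fiber)

variable {E : RealBundle 𝒜}

theorem exists_localFrame (E : RealBundle 𝒜) (x : X) : ∃ F : LocalFrame e E, x ∈ F.base := by
  obtain ⟨M, c, hx⟩ := E.exists_chart x
  refine ⟨{
    pt := x
    base := c.base
    isOpen_base := c.isOpen_base
    base_subset := c.base_subset
    n := M.rank
    frame := fun y =>
      { coord :=
          { toFun := fun v k => e (M.incl (c.iso y v) k)
            map_zero' := by ext; simp
            map_add' := fun v w => by ext; simp }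
        comb :=
          { toFun := fun r => (c.iso y).symm (M.retr fun k => e.symm (r k))
            map_zero' := by
              have : (fun k : Fin M.rank => e.symm ((0 : Fin M.rank → R) k)) = 0 := by ext; simp
              rw [this, map_zero, map_zero]
            map_add' := fun r s => by
              have : (fun k : Fin M.rank => e.symm ((r + s) k)) =
                  (fun k => e.symm (r k)) + fun k => e.symm (s k) := by ext; simp
              rw [this, map_add, map_add] }
        coord_smul := fun b v => by
          ext k
          simp only [AddMonoidHom.coe_mk, ZeroHom.coe_mk, c.iso_smul, map_smul, Pi.smul_apply,
            smul_eq_mul, map_mul, theta_apply]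
        comb_smul := fun b r => by
          simp only [AddMonoidHom.coe_mk, ZeroHom.coe_mk]
          rw [AddEquiv.symm_apply_eq, c.iso_smul, AddEquiv.apply_symm_apply, ← map_smul]
          congr 1
          ext k
          simp [theta_apply]
        comb_coord := fun v => by simp [M.retr_incl] }
    continuous_coord := continuous_pi fun k => e.continuous.comp
      ((continuous_apply k).comp (M.incl.continuous.comp c.continuous_iso))
    continuous_comb := c.continuous_symm.comp (continuous_fst.prodMk
      (M.retr.continuous.comp (continuous_pi fun k => e.symm.continuous.comp
        ((continuous_apply k).comp continuous_snd)))) }, hx⟩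

/-- Continuity of a family of maps between the fibres of a bundle. -/
def ContinuousEnd (E : RealBundle 𝒜) (T : ∀ x, E.fiber x → E.fiber x) : Prop :=
  Continuous fun p : Tot E.fiber => (⟨p.proj, T p.proj p.snd⟩ : Tot E.fiber)

/-- Continuity of a family of pairings on the fibres of a bundle. -/
def ContinuousForm (E : RealBundle 𝒜)
    (B : ∀ x, E.fiber x →+ (E.fiber x →ₗ[𝒜.fiber x] 𝒜.fiber x)) : Prop :=
  Continuous fun p : Tot (fun x => E.fiber x × E.fiber x) =>
    (⟨p.proj, B p.proj p.snd.1 p.snd.2⟩ : Tot 𝒜.fiber)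

theorem ContinuousForm.comp {B : ∀ x, E.fiber x →+ (E.fiber x →ₗ[𝒜.fiber x] 𝒜.fiber x)}
    (hB : ContinuousForm E B) {Y : Type*} [TopologicalSpace Y] {f : Y → X}
    {g k : ∀ y, E.fiber (f y)} (hg : Continuous fun y => (⟨f y, g y⟩ : Tot E.fiber))
    (hk : Continuous fun y => (⟨f y, k y⟩ : Tot E.fiber)) :
    Continuous fun y => (⟨f y, B (f y) (g y) (k y)⟩ : Tot 𝒜.fiber) :=
  Continuous.comp (f := fun y => (⟨f y, (g y, k y)⟩ : Tot fun x => E.fiber x × E.fiber x)) hB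
    (continuous_tot_prod.2 ⟨hg, hk⟩)

theorem ContinuousEnd.comp {T : ∀ x, E.fiber x → E.fiber x} (hT : ContinuousEnd E T)
    {Y : Type*} [TopologicalSpace Y] {f : Y → X} {g : ∀ y, E.fiber (f y)}
    (hg : Continuous fun y => (⟨f y, g y⟩ : Tot E.fiber)) :
    Continuous fun y => (⟨f y, T (f y) (g y)⟩ : Tot E.fiber) :=
  Continuous.comp (f := fun y => (⟨f y, g y⟩ : Tot E.fiber)) hT hg

namespace LocalFrame

variable {e} (F : LocalFrame e E)

theorem continuous_coord_comp {Y : Type*} [TopologicalSpace Y] {f : Y → F.base}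
    {g : ∀ y, E.fiber (f y)} (hg : Continuous fun y => (⟨f y, g y⟩ : Tot E.fiber)) :
    Continuous fun y => (F.frame (f y)).coord (g y) :=
  F.continuous_coord.comp (hg.subtype_mk fun y => (f y).2)

theorem continuous_comb_comp {Y : Type*} [TopologicalSpace Y] {f : Y → F.base}
    {c : Y → Fin F.n → R} (hf : Continuous f) (hc : Continuous c) :
    Continuous fun y => (⟨f y, (F.frame (f y)).comb (c y)⟩ : Tot E.fiber) :=
  F.continuous_comb.comp (hf.prodMk hc)

theorem continuous_theta_comp {Y : Type*} [TopologicalSpace Y] {f : Y → F.base}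
    {g : ∀ y, 𝒜.fiber (f y)} (hg : Continuous fun y => (⟨f y, g y⟩ : Tot 𝒜.fiber)) :
    Continuous fun y => theta e F.pt ⟨f y, F.base_subset (f y).2⟩ (g y) :=
  continuous_theta e hg fun y => F.base_subset (f y).2

theorem continuous_mat {T : ∀ x, E.fiber x →ₗ[𝒜.fiber x] E.fiber x}
    (hT : ContinuousEnd E fun x => T x) :
    Continuous fun y : F.base => (F.frame y).mat (T y) := by
  refine SqMat.continuous_iff.2 fun k l => (continuous_apply l).comp ?_
  exact F.continuous_coord_comp (hT.comp (F.continuous_comb_comp continuous_id continuous_const))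

theorem continuous_gram {B : ∀ x, E.fiber x →+ (E.fiber x →ₗ[𝒜.fiber x] 𝒜.fiber x)}
    (hB : ContinuousForm E B) : Continuous fun y : F.base => (F.frame y).gram (B y) := by
  refine SqMat.continuous_iff.2 fun k l => ?_
  exact F.continuous_theta_comp (hB.comp (F.continuous_comb_comp continuous_id continuous_const)
    (F.continuous_comb_comp continuous_id continuous_const))

theorem continuous_extGram {B : ∀ x, E.fiber x →+ (E.fiber x →ₗ[𝒜.fiber x] 𝒜.fiber x)}
    (hB : ContinuousForm E B) : Continuous fun y : F.base => (F.frame y).extGram (B y) := by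
  have h1 : Continuous fun y : F.base => (1 - (F.frame y).proj) :=
    continuous_const.sub (F.continuous_mat (T := fun _ => LinearMap.id) continuous_id)
  exact (F.continuous_gram hB).add (h1.mul h1.star)

/-- Continuity on the total space of a bundle may be checked over local frames. -/
theorem continuous_of_frames {Z : Type*} [TopologicalSpace Z] {f : Tot E.fiber → Z}
    (H : ∀ x, ∃ F : LocalFrame e E, x ∈ F.base ∧
      Continuous fun p : {p : Tot E.fiber // p.proj ∈ F.base} => f p) : Continuous f :=
  continuous_of_locally E.continuous_proj fun x => by
    obtain ⟨F, hx, hF⟩ := H x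
    exact ⟨F.base, F.isOpen_base, hx, hF⟩

end LocalFrame

/-! ### Positive forms on bundles -/

/-- A continuous family of positive forms on the fibres of a bundle. Neither nondegeneracy nor
compatibility with the involution is required. -/
structure PosForm (h : AntiInvolution 𝒜) (E : RealBundle 𝒜) where
  form : ∀ x, E.fiber x →+ (E.fiber x →ₗ[𝒜.fiber x] 𝒜.fiber x)
  form_smul : ∀ x (a : 𝒜.fiber x) v w, form x (a • v) w = form x v w * h.star x a
  pos : ∀ x v, h.IsNonneg x (form x v v)
  continuous_form : ContinuousForm E form

namespace PosForm

variable {e} (B : PosForm h E)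

/-- The form is nondegenerate in each fibre. -/
def Nondegenerate : Prop := ∀ x, Function.Bijective (B.form x)

theorem isPosForm (he : IsCStarInvolution e h) (x : X) (y : (𝒜.chartAt x).base) :
    IsPosForm (theta e x y) (B.form y) where
  smul b v w := by rw [B.form_smul, map_mul, he]
  pos v := (isNonneg_iff he x y _).1 (B.pos y v)

/-- A positive form is hermitian. -/
theorem symm (he : IsCStarInvolution e h) (x : X) (v w : E.fiber x) :
    B.form x w v = h.star x (B.form x v w) := by
  obtain ⟨F, hx⟩ := exists_localFrame e E x
  apply (theta e F.pt ⟨x, F.base_subset hx⟩).injective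
  rw [(F.frame ⟨x, hx⟩).form_symm (B.isPosForm he _ _) v w, he F.pt ⟨x, F.base_subset hx⟩]

/-- A form which dominates a nondegenerate positive form is nondegenerate. -/
theorem Nondegenerate.of_add (he : IsCStarInvolution e h) {B : PosForm h E}
    (hB : B.Nondegenerate) (B' : PosForm h E)
    (hle : ∀ x v, ∃ b, h.IsNonneg x b ∧ B'.form x v v = B.form x v v + b) :
    B'.Nondegenerate := by
  intro x
  obtain ⟨F, hx⟩ := exists_localFrame e E x
  refine (F.frame ⟨x, hx⟩).bijective_of_le (B.isPosForm he _ _) (hB x) (B'.isPosForm he _ _)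
    fun v => ?_
  obtain ⟨b, hb, hb'⟩ := hle x v
  rw [hb', map_add]
  exact le_add_of_nonneg_right ((isNonneg_iff he F.pt ⟨x, F.base_subset hx⟩ b).1 hb)

/-- Near each point there is a frame which is a Parseval frame in each fibre for a given
nondegenerate positive form. -/
theorem exists_parseval (he : IsCStarInvolution e h) (hB : B.Nondegenerate) (x : X) :
    ∃ F : LocalFrame e E, x ∈ F.base ∧ ∀ y, (F.frame y).IsParseval (B.form y) := by
  obtain ⟨F, hx⟩ := exists_localFrame e E x
  -- The frame is corrected by the square root of the extended Gram matrix, which is continuous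
  -- and has a continuous inverse.
  have hu : ∀ y : F.base, IsUnit (CFC.sqrt ((F.frame y).extGram (B.form y))) := fun y =>
    (F.frame y).isUnit_sqrt_extGram (B.isPosForm he _ _) (hB y).2
  have hcont : Continuous fun y : F.base => CFC.sqrt ((F.frame y).extGram (B.form y)) :=
    CFC.continuousOn_sqrt.comp_continuous (F.continuous_extGram B.continuous_form) fun y =>
      (F.frame y).extGram_nonneg (B.isPosForm he _ _)
  have hinv : Continuous fun y : F.base => (↑(hu y).unit⁻¹ : SqMat (Fin F.n) R) := by
    refine continuous_iff_continuousAt.2 fun y => ?_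
    have := (NormedRing.inverse_continuousAt (hu y).unit).comp
      (f := fun y : F.base => CFC.sqrt ((F.frame y).extGram (B.form y))) hcont.continuousAt
    refine this.congr (Filter.Eventually.of_forall fun z => ?_)
    exact Ring.inverse_unit (hu z).unit
  refine ⟨{
    pt := F.pt
    base := F.base
    isOpen_base := F.isOpen_base
    base_subset := F.base_subset
    n := F.n
    frame := fun y => (F.frame y).transform (hu y).unit
    continuous_coord := continuous_rowMul F.continuous_coord
      (hcont.comp ((E.continuous_proj.comp continuous_subtype_val).subtype_mk _))
    continuous_comb := F.continuous_comb_comp continuous_fst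
      (continuous_rowMul continuous_snd (hinv.comp continuous_fst)) }, hx, fun y => ?_⟩
  exact (F.frame y).isParseval_transform (B.isPosForm he _ _) _ rfl

/-- The endomorphism representing a pairing `D` with respect to a nondegenerate form. -/
def repr (hB : B.Nondegenerate) (D : ∀ x, E.fiber x →+ (E.fiber x →ₗ[𝒜.fiber x] 𝒜.fiber x))
    (x : X) : E.fiber x →+ E.fiber x :=
  ((AddEquiv.ofBijective (B.form x) (hB x)).symm : _ →+ E.fiber x).comp (D x)

theorem form_repr (hB : B.Nondegenerate)
    (D : ∀ x, E.fiber x →+ (E.fiber x →ₗ[𝒜.fiber x] 𝒜.fiber x)) (x : X) (v : E.fiber x) :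
    B.form x (B.repr hB D x v) = D x v :=
  (AddEquiv.ofBijective (B.form x) (hB x)).apply_symm_apply (D x v)

/-- In a Parseval frame `D(v)` is represented by the vector whose coefficients are the adjoints of
its values on the frame, which depends continuously on `v`. -/
theorem continuous_repr (he : IsCStarInvolution e h) (hB : B.Nondegenerate)
    {D : ∀ x, E.fiber x →+ (E.fiber x →ₗ[𝒜.fiber x] 𝒜.fiber x)} (hD : ContinuousForm E D) :
    ContinuousEnd E fun x => B.repr hB D x := by
  refine LocalFrame.continuous_of_frames (e := e) fun x => ?_
  obtain ⟨F, hx, hF⟩ := B.exists_parseval he hB x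
  refine ⟨F, hx, ?_⟩
  have h1 : Continuous fun p : {p : Tot E.fiber // p.proj ∈ F.base} =>
      (⟨p.1.proj, p.2⟩ : F.base) :=
    (E.continuous_proj.comp continuous_subtype_val).subtype_mk _
  have h2 := F.continuous_comb_comp (f := fun p : {p : Tot E.fiber // p.proj ∈ F.base} =>
      (⟨p.1.proj, p.2⟩ : F.base))
    (c := fun p k => star ((F.frame ⟨p.1.proj, p.2⟩).rowFunctional (D p.1.proj p.1.snd)
      (Pi.single k 1))) h1 (continuous_pi fun k => Continuous.star (F.continuous_theta_comp
        (hD.comp continuous_subtype_val (F.continuous_comb_comp h1 continuous_const))))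
  refine h2.congr fun p => congrArg (Bundle.TotalSpace.mk _) ?_
  apply (hB p.1.proj).1
  rw [form_repr]
  refine LinearMap.ext fun w => (theta e F.pt ⟨_, F.base_subset p.2⟩).injective ?_
  rw [hF ⟨p.1.proj, p.2⟩, rowInner_star_apply]
  simp [FibreFrame.rowFunctional, (F.frame ⟨p.1.proj, p.2⟩).comb_coord]

/-- Positive endomorphisms have unique positive square roots, which depend continuously on the
point of the base. -/
theorem exists_sqrt (he : IsCStarInvolution e h) (hB : B.Nondegenerate)
    {S : ∀ x, E.fiber x →ₗ[𝒜.fiber x] E.fiber x} (hS : ContinuousEnd E fun x => S x)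
    (hpos : ∀ x v, h.IsNonneg x (B.form x (S x v) v)) :
    ∃ U : ∀ x, E.fiber x →ₗ[𝒜.fiber x] E.fiber x, ContinuousEnd E (fun x => U x) ∧
      (∀ x v, U x (U x v) = S x v) ∧ (∀ x v, h.IsNonneg x (B.form x (U x v) v)) ∧
      ∀ x (U' : E.fiber x →ₗ[𝒜.fiber x] E.fiber x), (∀ v, h.IsNonneg x (B.form x (U' v) v)) →
        (∀ v, U' (U' v) = S x v) → U' = U x := by
  choose F hx hF using B.exists_parseval he hB
  have hu : ∀ x (y : (F x).base) (U' : E.fiber y →ₗ[𝒜.fiber y] E.fiber y),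
      (∀ v, h.IsNonneg y (B.form y (U' v) v)) → (∀ v, U' (U' v) = S y v) →
        U' = ((F x).frame y).sqrtEnd (S y) := fun x y U' h1 h2 =>
    ((F x).frame y).eq_sqrtEnd (B.isPosForm he _ _) (hF x y)
      (fun v => (isNonneg_iff he (F x).pt ⟨y, (F x).base_subset y.2⟩ _).1 (h1 v)) h2
  have hU : ∀ x (y : (F x).base) v, ((F x).frame y).sqrtEnd (S y)
      (((F x).frame y).sqrtEnd (S y) v) = S y v := fun x y v =>
    ((F x).frame y).sqrtEnd_sqrtEnd (B.isPosForm he _ _) (hF x y)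
      (fun v => (isNonneg_iff he (F x).pt ⟨y, (F x).base_subset y.2⟩ _).1 (hpos y v)) v
  have hU' : ∀ x (y : (F x).base) v,
      h.IsNonneg y (B.form y (((F x).frame y).sqrtEnd (S y) v) v) := fun x y v =>
    (isNonneg_iff he (F x).pt ⟨y, (F x).base_subset y.2⟩ _).2
      (((F x).frame y).sqrtEnd_nonneg (hF x y) (S y) v)
  refine ⟨fun x => ((F x).frame ⟨x, hx x⟩).sqrtEnd (S x), ?_, fun x v => hU x ⟨x, hx x⟩ v,
    fun x v => hU' x ⟨x, hx x⟩ v, fun x U' => hu x ⟨x, hx x⟩ U'⟩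
  refine LocalFrame.continuous_of_frames (e := e) fun x => ⟨F x, hx x, ?_⟩
  have h1 : Continuous fun p : {p : Tot E.fiber // p.proj ∈ (F x).base} =>
      (⟨p.1.proj, p.2⟩ : (F x).base) :=
    (E.continuous_proj.comp continuous_subtype_val).subtype_mk _
  have h2 : Continuous fun y : (F x).base => CFC.sqrt (((F x).frame y).mat (S y)) :=
    CFC.continuousOn_sqrt.comp_continuous ((F x).continuous_mat hS) fun y =>
      ((F x).frame y).mat_nonneg (B.isPosForm he _ _) (hF x y)
        (fun v => (isNonneg_iff he (F x).pt ⟨y, (F x).base_subset y.2⟩ _).1 (hpos y v))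
  refine ((F x).continuous_comb_comp h1 (continuous_rowMul (F x).continuous_coord
    (h2.comp h1))).congr fun p => congrArg (Bundle.TotalSpace.mk _) ?_
  -- In the fibre over `y`, the square roots computed in the frames at `x` and at `y` agree.
  exact LinearMap.congr_fun (hu p.1.proj ⟨p.1.proj, hx _⟩ _ (hU' x ⟨p.1.proj, p.2⟩)
    (hU x ⟨p.1.proj, p.2⟩)) p.1.snd

/-- A positive endomorphism is self-adjoint. -/
theorem selfAdjoint (he : IsCStarInvolution e h) (hB : B.Nondegenerate) {x : X}
    {S : E.fiber x →ₗ[𝒜.fiber x] E.fiber x} (hS : ∀ v, h.IsNonneg x (B.form x (S v) v))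
    (v w : E.fiber x) : B.form x (S v) w = B.form x v (S w) := by
  obtain ⟨F, hx, hF⟩ := B.exists_parseval he hB x
  exact (F.frame ⟨x, hx⟩).selfAdjoint_of_nonneg (B.isPosForm he F.pt ⟨x, F.base_subset hx⟩)
    (hF ⟨x, hx⟩)
    (fun v => (isNonneg_iff he F.pt ⟨x, F.base_subset hx⟩ _).1 (hS v)) v w

end PosForm

end Frames

section Metrics

variable {X : Type u} [TopologicalSpace X] [InvolutiveSpace X]
  {C : Type v} [Ring C] [Algebra ℝ C] [TopologicalSpace C]
  {R : Type*} [CStarAlgebra R] [PartialOrder R] [StarOrderedRing R]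
  {𝒜 : RealAlgebraBundle X C} {e : C ≃A[ℝ] R} {h : AntiInvolution 𝒜} {E : RealBundle 𝒜}

/-! ### Existence of metrics -/

namespace LocalFrame

variable (F : LocalFrame e E)

/-- The inner product on the fibres given by a frame. -/
def stdForm (y : F.base) : E.fiber y →+ (E.fiber y →ₗ[𝒜.fiber y] 𝒜.fiber y) where
  toFun v := (F.frame y).coordFunctional ((F.frame y).coord v)
  map_zero' := LinearMap.ext fun w => by simp [FibreFrame.coordFunctional]
  map_add' v v' := LinearMap.ext fun w => by simp [FibreFrame.coordFunctional, rowInner_add]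

theorem theta_stdForm (y : F.base) (v w : E.fiber y) :
    theta e F.pt ⟨y, F.base_subset y.2⟩ (F.stdForm y v w) =
      rowInner ((F.frame y).coord w) ((F.frame y).coord v) :=
  RingEquiv.apply_symm_apply _ _

open Classical in
/-- The inner product of a frame, multiplied by a function on `X` and extended by zero. -/
def cutForm (f : X → ℝ) (x : X) : E.fiber x →+ (E.fiber x →ₗ[𝒜.fiber x] 𝒜.fiber x) :=
  if hx : x ∈ F.base then
    (DistribSMul.toAddMonoidHom (E.fiber x →ₗ[𝒜.fiber x] 𝒜.fiber x) (f x)).comp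
      (F.stdForm ⟨x, hx⟩)
  else 0

theorem cutForm_of_mem {f : X → ℝ} {x : X} (hx : x ∈ F.base) (v w : E.fiber x) :
    F.cutForm f x v w = f x • F.stdForm ⟨x, hx⟩ v w := by
  rw [cutForm, dif_pos hx]
  rfl

theorem cutForm_of_eq_zero {f : X → ℝ} {x : X} (hx : f x = 0) : F.cutForm f x = 0 := by
  by_cases h : x ∈ F.base
  · ext v w
    rw [cutForm_of_mem F h, hx, zero_smul]
    rfl
  · rw [cutForm, dif_neg h]

theorem cutForm_smul (he : IsCStarInvolution e h) (f : X → ℝ) (x : X) (a : 𝒜.fiber x)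
    (v w : E.fiber x) : F.cutForm f x (a • v) w = F.cutForm f x v w * h.star x a := by
  by_cases hx : x ∈ F.base
  · rw [cutForm_of_mem F hx, cutForm_of_mem F hx, smul_mul_assoc]
    congr 1
    apply (theta e F.pt ⟨x, F.base_subset hx⟩).injective
    rw [F.theta_stdForm ⟨x, hx⟩, map_mul, F.theta_stdForm ⟨x, hx⟩, he F.pt ⟨x, F.base_subset hx⟩,
      (F.frame ⟨x, hx⟩).coord_smul, rowInner_smul]
  · rw [cutForm, dif_neg hx]
    simp

theorem cutForm_nonneg (he : IsCStarInvolution e h) {f : X → ℝ} (hf : ∀ x, 0 ≤ f x) (x : X)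
    (v : E.fiber x) : h.IsNonneg x (F.cutForm f x v v) := by
  by_cases hx : x ∈ F.base
  · rw [cutForm_of_mem F hx]
    refine (isNonneg_iff he F.pt ⟨x, F.base_subset hx⟩ _).2 ?_
    rw [theta_real_smul, F.theta_stdForm ⟨x, hx⟩]
    exact smul_nonneg (hf x) (rowInner_self_nonneg _)
  · rw [cutForm, dif_neg hx]
    exact ⟨0, by simp⟩

/-- The form `cutForm` is continuous, also at the boundary of the domain of the frame, if the
support of `f` is contained in that domain. Continuity is expressed in the chart of `𝒜` at `x₀`. -/
theorem continuous_theta_cutForm {f : X → ℝ} (hf : Continuous f) (hsupp : tsupport f ⊆ F.base)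
    (x₀ : X) {Y : Type*} [TopologicalSpace Y] {g : Y → (𝒜.chartAt x₀).base}
    {v w : ∀ y, E.fiber (g y)} (hg : Continuous g)
    (hv : Continuous fun y => (⟨g y, v y⟩ : Tot E.fiber))
    (hw : Continuous fun y => (⟨g y, w y⟩ : Tot E.fiber)) :
    Continuous fun y => theta e x₀ (g y) (F.cutForm f (g y) (v y) (w y)) := by
  have hg' : Continuous fun y => (g y : X) := continuous_subtype_val.comp hg
  refine continuous_of_locally hg' fun x => ?_
  by_cases hx : x ∈ F.base
  · refine ⟨F.base, F.isOpen_base, hx, ?_⟩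
    have hb : Continuous fun p : {p : Y // (g p : X) ∈ F.base} => (⟨g p, p.2⟩ : F.base) :=
      (hg'.comp continuous_subtype_val).subtype_mk _
    have h1 : Continuous fun p : {p : Y // (g p : X) ∈ F.base} =>
        (⟨g p, F.stdForm ⟨g p, p.2⟩ (v p) (w p)⟩ : Tot 𝒜.fiber) :=
      continuous_theta_symm e (g := fun p : {p : Y // (g p : X) ∈ F.base} =>
        (⟨g p, F.base_subset p.2⟩ : (𝒜.chartAt F.pt).base))
        ((hg'.comp continuous_subtype_val).subtype_mk _)
        (continuous_rowInner
          (F.continuous_coord_comp (f := fun p : {p : Y // (g p : X) ∈ F.base} => ⟨g p, p.2⟩)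
            (hw.comp continuous_subtype_val))
          (F.continuous_coord_comp (f := fun p : {p : Y // (g p : X) ∈ F.base} => ⟨g p, p.2⟩)
            (hv.comp continuous_subtype_val)))
    have h2 := continuous_theta e h1 fun p => (g p).2
    refine ((hf.comp (hg'.comp continuous_subtype_val)).smul h2).congr fun p => ?_
    rw [F.cutForm_of_mem p.2, theta_real_smul]
    rfl
  · refine ⟨(tsupport f)ᶜ, (isClosed_tsupport f).isOpen_compl, fun hx' => hx (hsupp hx'), ?_⟩
    refine (continuous_const (y := (0 : R))).congr fun p => ?_
    rw [F.cutForm_of_eq_zero (image_eq_zero_of_notMem_tsupport p.2)]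
    simp

end LocalFrame

/-- Over a paracompact Hausdorff space every bundle has a nondegenerate positive form: inner
products given by local frames are patched together by a partition of unity. -/
theorem exists_posForm [T2Space X] [ParacompactSpace X] (he : IsCStarInvolution e h)
    (E : RealBundle 𝒜) : ∃ B : PosForm h E, B.Nondegenerate := by
  classical
  choose F hF using exists_localFrame e E
  obtain ⟨f, hf⟩ := PartitionOfUnity.exists_isSubordinate isClosed_univ (fun x => (F x).base)
    (fun x => (F x).isOpen_base) fun x _ => Set.mem_iUnion.2 ⟨x, hF x⟩
  set form : ∀ x, E.fiber x →+ (E.fiber x →ₗ[𝒜.fiber x] 𝒜.fiber x) := fun x =>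
    ∑ i ∈ f.finsupport x, (F i).cutForm (f i) x with hform
  have happly : ∀ x v w, form x v w = ∑ i ∈ f.finsupport x, (F i).cutForm (f i) x v w := by
    intro x v w
    simp [hform, AddMonoidHom.finsetSum_apply, LinearMap.sum_apply]
  have hnonneg : ∀ x v (T : Finset X),
      h.IsNonneg x (∑ i ∈ T, (F i).cutForm (f i) x v v) := by
    intro x v T
    induction T using Finset.cons_induction with
    | empty => exact ⟨0, by simp⟩
    | cons i T hi ih =>
      rw [Finset.sum_cons]
      exact IsNonneg.add he ((F i).cutForm_nonneg he (f.nonneg i) x v) ih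
  -- Near `x₀` the sum extends over the fixed finite set `f.fintsupport x₀`.
  have hcont : ContinuousForm E form := by
    refine continuous_of_locally (E.continuous_proj.comp continuous_tot_fst) fun x₀ => ?_
    obtain ⟨W, hW, hWo, hxW⟩ := eventually_nhds_iff.1 (f.eventually_finsupport_subset x₀)
    refine ⟨(𝒜.chartAt x₀).base ∩ W, (𝒜.chartAt x₀).isOpen_base.inter hWo,
      ⟨𝒜.mem_chartAt x₀, hxW⟩, ?_⟩
    set Y := {p : Tot (fun x => E.fiber x × E.fiber x) // p.proj ∈ (𝒜.chartAt x₀).base ∩ W}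
    set g : Y → (𝒜.chartAt x₀).base := fun p => ⟨p.1.proj, p.2.1⟩
    have hg : Continuous g :=
      ((E.continuous_proj.comp continuous_tot_fst).comp continuous_subtype_val).subtype_mk _
    have h1 : Continuous fun p : Y => ∑ i ∈ f.fintsupport x₀,
        theta e x₀ (g p) ((F i).cutForm (f i) (g p) p.1.snd.1 p.1.snd.2) :=
      continuous_finsetSum _ fun i _ => (F i).continuous_theta_cutForm (f i).continuous (hf i) x₀ hg
        (continuous_tot_fst.comp continuous_subtype_val)
        (continuous_tot_snd.comp continuous_subtype_val)
    refine (continuous_theta_symm e hg h1).congr fun p => congrArg (Bundle.TotalSpace.mk _) ?_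
    rw [RingEquiv.symm_apply_eq, ← map_sum, happly]
    congr 1
    refine (Finset.sum_subset (hW _ p.2.2) fun i _ hi => ?_).symm
    rw [(F i).cutForm_of_eq_zero (f := f i)]
    · rfl
    · simpa [PartitionOfUnity.mem_finsupport] using hi
  let B : PosForm h E := ⟨form, fun x a v w => by
    rw [happly, happly, Finset.sum_mul]
    exact Finset.sum_congr rfl fun i _ => (F i).cutForm_smul he (f i) x a v w, fun x v => by
    rw [happly]
    exact hnonneg x v _, hcont⟩
  refine ⟨B, fun x => ?_⟩
  -- Over `x` the form dominates a positive multiple of the inner product of one of the frames.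
  obtain ⟨i, hi⟩ := f.exists_pos (Set.mem_univ x)
  have hx : x ∈ (F i).base := hf i (subset_tsupport _ hi.ne')
  refine ((F i).frame ⟨x, hx⟩).bijective_of_smul_le hi (B.isPosForm he _ _) fun v => ?_
  change _ ≤ theta e _ ⟨x, (F i).base_subset hx⟩ (form x v v)
  rw [happly, ← Finset.add_sum_erase _ _ ((f.mem_finsupport x).2 hi.ne'), map_add,
    (F i).cutForm_of_mem hx, theta_real_smul, (F i).theta_stdForm ⟨x, hx⟩]
  exact le_add_of_nonneg_right
    ((isNonneg_iff he (F i).pt ⟨x, (F i).base_subset hx⟩ _).1 (hnonneg x v _))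

/-! ### The involutions on the fibres -/

/-- The involution of a Real algebra bundle is bijective on fibres. -/
theorem RealAlgebraBundle.conj_bijective (𝒜 : RealAlgebraBundle X C) (x : X) :
    Function.Bijective (𝒜.conj x) := by
  constructor
  · intro a b hab
    have h1 := 𝒜.conj_conj x a
    rw [hab, 𝒜.conj_conj x b] at h1
    simpa using h1.symm
  · intro b
    have key : ∀ z, z = x → ∀ c : 𝒜.fiber z, ∃ a : 𝒜.fiber x,
        (⟨bar z, 𝒜.conj z c⟩ : Tot 𝒜.fiber) = ⟨bar x, 𝒜.conj x a⟩ := by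
      rintro z rfl c
      exact ⟨c, rfl⟩
    obtain ⟨a, ha⟩ := key _ (bar_bar x) (𝒜.conj (bar x) b)
    rw [𝒜.conj_conj (bar x) b] at ha
    exact ⟨a, by simpa using ha.symm⟩

/-- The involution of a Real bundle is bijective on fibres. -/
theorem RealBundle.conj_bijective (E : RealBundle 𝒜) (x : X) :
    Function.Bijective (E.conj x) := by
  constructor
  · intro a b hab
    have h1 := E.conj_conj x a
    rw [hab, E.conj_conj x b] at h1
    simpa using h1.symm
  · intro b
    have key : ∀ z, z = x → ∀ c : E.fiber z, ∃ a : E.fiber x,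
        (⟨bar z, E.conj z c⟩ : Tot E.fiber) = ⟨bar x, E.conj x a⟩ := by
      rintro z rfl c
      exact ⟨c, rfl⟩
    obtain ⟨a, ha⟩ := key _ (bar_bar x) (E.conj (bar x) b)
    rw [E.conj_conj (bar x) b] at ha
    exact ⟨a, by simpa using ha.symm⟩

/-- The inverse of the involution on fibres, as an isomorphism of algebras. -/
def RealAlgebraBundle.conjInv (𝒜 : RealAlgebraBundle X C) (x : X) :
    𝒜.fiber (bar x) ≃ₐ[ℝ] 𝒜.fiber x :=
  (AlgEquiv.ofBijective (𝒜.conj x) (𝒜.conj_bijective x)).symm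

@[simp] theorem RealAlgebraBundle.conj_conjInv (x : X) (b : 𝒜.fiber (bar x)) :
    𝒜.conj x (𝒜.conjInv x b) = b :=
  (AlgEquiv.ofBijective (𝒜.conj x) (𝒜.conj_bijective x)).apply_symm_apply b

@[simp] theorem RealAlgebraBundle.conjInv_conj (x : X) (b : 𝒜.fiber x) :
    𝒜.conjInv x (𝒜.conj x b) = b :=
  (AlgEquiv.ofBijective (𝒜.conj x) (𝒜.conj_bijective x)).symm_apply_apply b

theorem RealAlgebraBundle.mk_conjInv (x : X) (b : 𝒜.fiber (bar x)) :
    (⟨bar (bar x), 𝒜.conj (bar x) b⟩ : Tot 𝒜.fiber) = ⟨x, 𝒜.conjInv x b⟩ := by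
  rw [← 𝒜.conj_conj x (𝒜.conjInv x b), RealAlgebraBundle.conj_conjInv]

theorem star_conjInv (x : X) (b : 𝒜.fiber (bar x)) :
    h.star x (𝒜.conjInv x b) = 𝒜.conjInv x (h.star (bar x) b) := by
  apply (𝒜.conj_bijective x).1
  rw [← h.star_conj, RealAlgebraBundle.conj_conjInv, RealAlgebraBundle.conj_conjInv]

theorem IsNonneg.conjInv {x : X} {b : 𝒜.fiber (bar x)} (hb : h.IsNonneg (bar x) b) :
    h.IsNonneg x (𝒜.conjInv x b) := by
  obtain ⟨c, rfl⟩ := hb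
  exact ⟨𝒜.conjInv x c, by rw [map_mul, star_conjInv]⟩

/-- A nondegenerate positive form which is compatible with the involutions. -/
structure Metric (h : AntiInvolution 𝒜) (E : RealBundle 𝒜) extends SymForm h 1 E where
  pos : ∀ x v, h.IsNonneg x (toDual x v v)

/-- The underlying positive form of a metric. -/
def Metric.toPosForm (ψ : Metric h E) : PosForm h E :=
  ⟨ψ.toDual, ψ.toDual_smul, ψ.pos, ψ.continuous_form⟩

theorem Metric.nondegenerate (ψ : Metric h E) : ψ.toPosForm.Nondegenerate := ψ.bijective

/-- A nondegenerate positive form compatible with the involutions is a metric. -/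
def PosForm.toMetric (he : IsCStarInvolution e h) (B : PosForm h E) (hB : B.Nondegenerate)
    (hc : ∀ x v w, B.form (bar x) (E.conj x v) (E.conj x w) = 𝒜.conj x (B.form x v w)) :
    Metric h E where
  toDual := B.form
  toDual_smul := B.form_smul
  bijective := hB
  symm x v w := by simpa using B.symm he x v w
  map_conj := hc
  continuous_form := B.continuous_form
  pos := B.pos

/-- The transform `(v, w) ↦ conj⁻¹ (B (conj v, conj w))` of a pairing by the involutions. -/
def conjForm (B : ∀ x, E.fiber x →+ (E.fiber x →ₗ[𝒜.fiber x] 𝒜.fiber x)) (x : X) :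
    E.fiber x →+ (E.fiber x →ₗ[𝒜.fiber x] 𝒜.fiber x) where
  toFun v :=
    { toFun := fun w => 𝒜.conjInv x (B (bar x) (E.conj x v) (E.conj x w))
      map_add' := fun w w' => by simp
      map_smul' := fun a w => by
        rw [E.conj_smul, map_smul, smul_eq_mul, map_mul, RealAlgebraBundle.conjInv_conj]
        rfl }
  map_zero' := LinearMap.ext fun w => by simp
  map_add' v v' := LinearMap.ext fun w => by simp

theorem conjForm_apply (B : ∀ x, E.fiber x →+ (E.fiber x →ₗ[𝒜.fiber x] 𝒜.fiber x)) (x : X)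
    (v w : E.fiber x) :
    conjForm B x v w = 𝒜.conjInv x (B (bar x) (E.conj x v) (E.conj x w)) := rfl

/-- Transforming a pairing twice gives back the pairing. The fibre over `bar (bar x)` is
identified with the fibre over `x`. -/
theorem conjForm_conj (B : ∀ x, E.fiber x →+ (E.fiber x →ₗ[𝒜.fiber x] 𝒜.fiber x)) (x : X)
    (v w : E.fiber x) :
    conjForm B (bar x) (E.conj x v) (E.conj x w) = 𝒜.conj x (B x v w) := by
  rw [conjForm_apply]
  apply (𝒜.conj_bijective (bar x)).1
  rw [RealAlgebraBundle.conj_conjInv]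
  have key : ∀ z (v' w' : E.fiber z), (⟨z, v'⟩ : Tot E.fiber) = ⟨x, v⟩ →
      (⟨z, w'⟩ : Tot E.fiber) = ⟨x, w⟩ →
      (⟨z, B z v' w'⟩ : Tot 𝒜.fiber) = ⟨x, B x v w⟩ := by
    intro z v' w' h1 h2
    cases h1
    cases h2
    rfl
  have := (key _ _ _ (E.conj_conj x v) (E.conj_conj x w)).trans (𝒜.conj_conj x _).symm
  simpa using this

theorem continuous_conjForm {B : ∀ x, E.fiber x →+ (E.fiber x →ₗ[𝒜.fiber x] 𝒜.fiber x)}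
    (hB : ContinuousForm E B) : ContinuousForm E (conjForm B) := by
  refine (𝒜.continuous_conj.comp (hB.comp (f := fun p : Tot (fun x => E.fiber x × E.fiber x) =>
    bar p.proj) (E.continuous_conj.comp continuous_tot_fst)
    (E.continuous_conj.comp continuous_tot_snd))).congr fun p => ?_
  exact RealAlgebraBundle.mk_conjInv _ _

theorem ContinuousForm.add {B B' : ∀ x, E.fiber x →+ (E.fiber x →ₗ[𝒜.fiber x] 𝒜.fiber x)}
    (hB : ContinuousForm E B) (hB' : ContinuousForm E B') :
    ContinuousForm E fun x => B x + B' x :=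
  Continuous.comp (f := fun p : Tot (fun x => E.fiber x × E.fiber x) =>
    (⟨p.proj, (B p.proj p.snd.1 p.snd.2, B' p.proj p.snd.1 p.snd.2)⟩ :
      Tot fun x => 𝒜.fiber x × 𝒜.fiber x)) 𝒜.continuous_add
    (continuous_tot_prod.2 ⟨hB, hB'⟩)

/-- Over a paracompact Hausdorff space every Real bundle has a metric, obtained by averaging a
nondegenerate positive form over the involution. -/
theorem exists_metric [T2Space X] [ParacompactSpace X] (he : IsCStarInvolution e h)
    (E : RealBundle 𝒜) : Nonempty (Metric h E) := by
  obtain ⟨B, hB⟩ := exists_posForm he E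
  have hpos : ∀ x v, h.IsNonneg x (conjForm B.form x v v) := fun x v =>
    IsNonneg.conjInv (B.pos (bar x) _)
  let B' : PosForm h E :=
    { form := fun x => B.form x + conjForm B.form x
      form_smul := fun x a v w => by
        rw [AddMonoidHom.add_apply, LinearMap.add_apply, AddMonoidHom.add_apply,
          LinearMap.add_apply, add_mul, B.form_smul, conjForm_apply, conjForm_apply, E.conj_smul,
          B.form_smul, map_mul, h.star_conj, RealAlgebraBundle.conjInv_conj]
      pos := fun x v => IsNonneg.add he (B.pos x v) (hpos x v)
      continuous_form := B.continuous_form.add (continuous_conjForm B.continuous_form) }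
  have hB' : B'.Nondegenerate := hB.of_add he B' fun x v => ⟨_, hpos x v, rfl⟩
  refine ⟨B'.toMetric he hB' fun x v w => ?_⟩
  change B.form (bar x) (E.conj x v) (E.conj x w) +
    conjForm B.form (bar x) (E.conj x v) (E.conj x w) =
      𝒜.conj x (B.form x v w + conjForm B.form x v w)
  rw [conjForm_conj, map_add, conjForm_apply, RealAlgebraBundle.conj_conjInv, add_comm]

end Metrics

/-! ### Adjoining an element `j` to an algebra -/

/-- The algebra `d` is obtained from `a` by adjoining an element `j` with `j² = ε` and
`j b = σ(b) j`: every element of `d` is uniquely of the form `b + c j`, and `α`, `β` are the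
coefficients `b`, `c`. -/
structure JExt (a d : Type*) [Ring a] [Algebra ℝ a] [Ring d] [Algebra ℝ d] (σ : a →ₐ[ℝ] a)
    (ε : ℤˣ) where
  ι : a →+* d
  j : d
  j_mul_j : j * j = ((ε : ℤ) : d)
  j_mul : ∀ b, j * ι b = ι (σ b) * j
  α : d →+ a
  β : d →+ a
  eq : ∀ x, x = ι (α x) + ι (β x) * j
  α_eq : ∀ b c, α (ι b + ι c * j) = b
  β_eq : ∀ b c, β (ι b + ι c * j) = c

namespace JExt

variable {a d : Type*} [Ring a] [Algebra ℝ a] [Ring d] [Algebra ℝ d] {σ : a →ₐ[ℝ] a} {ε : ℤˣ}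
  (K : JExt a d σ ε)

theorem ε_mul_ε (ε : ℤˣ) : (ε : ℤ) * ε = 1 := by
  rw [← Units.val_mul, Int.units_mul_self, Units.val_one]

@[simp] theorem α_ι (b : a) : K.α (K.ι b) = b := by simpa using K.α_eq b 0

@[simp] theorem β_ι (b : a) : K.β (K.ι b) = 0 := by simpa using K.β_eq b 0

@[simp] theorem α_j : K.α K.j = 0 := by simpa using K.α_eq 0 1

@[simp] theorem β_j : K.β K.j = 1 := by simpa using K.β_eq 0 1

theorem ι_mul_α (b : a) (x : d) : K.α (K.ι b * x) = b * K.α x := by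
  conv_lhs => rw [K.eq x, mul_add, ← mul_assoc, ← map_mul, ← map_mul, K.α_eq]

theorem ι_mul_β (b : a) (x : d) : K.β (K.ι b * x) = b * K.β x := by
  conv_lhs => rw [K.eq x, mul_add, ← mul_assoc, ← map_mul, ← map_mul, K.β_eq]

theorem mul_eq (x y : d) : x * y = K.ι (K.α x * K.α y + (ε : ℤ) * (K.β x * σ (K.β y))) +
    K.ι (K.α x * K.β y + K.β x * σ (K.α y)) * K.j := by
  conv_lhs => rw [K.eq x, K.eq y]
  have h1 : K.ι (K.β x) * K.j * K.ι (K.α y) = K.ι (K.β x * σ (K.α y)) * K.j := by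
    rw [mul_assoc, K.j_mul, ← mul_assoc, ← map_mul]
  have h2 : K.ι (K.β x) * K.j * (K.ι (K.β y) * K.j) =
      K.ι ((ε : ℤ) * (K.β x * σ (K.β y))) := by
    rw [mul_assoc, ← mul_assoc K.j, K.j_mul, mul_assoc, K.j_mul_j, ← mul_assoc, ← map_mul K.ι,
      map_mul K.ι ((ε : ℤ) : a), map_intCast, (Int.cast_commute _ _).eq]
  have h3 : K.ι (K.α x) * K.ι (K.α y) = K.ι (K.α x * K.α y) := (map_mul K.ι _ _).symm
  have h4 : K.ι (K.α x) * (K.ι (K.β y) * K.j) = K.ι (K.α x * K.β y) * K.j := by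
    rw [← mul_assoc, ← map_mul K.ι]
  rw [mul_add, add_mul, add_mul, h1, h2, h3, h4, map_add K.ι, map_add K.ι, add_mul]
  abel

theorem α_mul (x y : d) :
    K.α (x * y) = K.α x * K.α y + (ε : ℤ) * (K.β x * σ (K.β y)) := by
  rw [K.mul_eq, K.α_eq]

theorem β_mul (x y : d) : K.β (x * y) = K.α x * K.β y + K.β x * σ (K.α y) := by
  rw [K.mul_eq, K.β_eq]

/-- Conjugation by `j` is an involution of `a`. -/
theorem σ_σ (K : JExt a d σ ε) (b : a) : σ (σ b) = b := by
  have h1 : K.j * (K.j * K.ι b) = K.ι (σ (σ b)) * ((ε : ℤ) : d) := by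
    rw [K.j_mul, ← mul_assoc, K.j_mul, mul_assoc, K.j_mul_j]
  rw [← mul_assoc, K.j_mul_j, (Int.cast_commute _ _).eq] at h1
  have h2 := congrArg (fun z => K.α (z * ((ε : ℤ) : d))) h1
  simp only [mul_assoc, ← Int.cast_mul, ε_mul_ε, Int.cast_one, mul_one, α_ι] at h2
  exact h2.symm

section Module

variable {V : Type*} [AddCommGroup V] [Module a V]

/-- The `d`-module structure on an `a`-module given by a `σ`-linear map `J` with `J² = ε`. -/
@[reducible] def module (J : V →+ V) (hJ : ∀ (b : a) v, J (b • v) = σ b • J v)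
    (hJJ : ∀ v, J (J v) = (ε : ℤ) • v) : Module d V where
  smul x v := K.α x • v + K.β x • J v
  one_smul v := by
    change K.α 1 • v + K.β 1 • J v = v
    rw [← map_one K.ι, K.α_ι, K.β_ι, one_smul, zero_smul, add_zero]
  mul_smul x y v := by
    change K.α (x * y) • v + K.β (x * y) • J v =
      K.α x • (K.α y • v + K.β y • J v) + K.β x • J (K.α y • v + K.β y • J v)
    rw [K.α_mul, K.β_mul, map_add, hJ, hJ, hJJ, smul_add, smul_add, add_smul, add_smul, mul_smul,
      mul_smul, mul_smul, mul_smul, mul_smul, Int.cast_smul_eq_zsmul,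
      smul_comm (σ (K.β y)) (ε : ℤ) v, smul_comm (K.β x) (ε : ℤ)]
    abel
  smul_zero x := by
    change K.α x • (0 : V) + K.β x • J 0 = 0
    simp
  smul_add x v w := by
    change K.α x • (v + w) + K.β x • J (v + w) =
      (K.α x • v + K.β x • J v) + (K.α x • w + K.β x • J w)
    rw [map_add, smul_add, smul_add]
    abel
  add_smul x y v := by
    change K.α (x + y) • v + K.β (x + y) • J v =
      (K.α x • v + K.β x • J v) + (K.α y • v + K.β y • J v)
    rw [map_add, map_add, add_smul, add_smul]
    abel
  zero_smul v := by
    change K.α 0 • v + K.β 0 • J v = 0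
    simp

end Module

end JExt

/-! ### Finitely generated projective modules under change of rings -/

section FG

variable {C D : Type v} [Ring C] [Algebra ℝ C] [TopologicalSpace C]
  [Ring D] [Algebra ℝ D] [TopologicalSpace D]

theorem FGProjective.continuous_add [ContinuousAdd C] (M : FGProjective C) :
    Continuous fun p : M.carrier × M.carrier => p.1 + p.2 := by
  have : Continuous fun p : M.carrier × M.carrier => M.retr (M.incl p.1 + M.incl p.2) :=
    M.retr.continuous.comp ((M.incl.continuous.comp continuous_fst).add
      (M.incl.continuous.comp continuous_snd))
  refine this.congr fun p => ?_
  rw [map_add, M.retr_incl, M.retr_incl]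

theorem FGProjective.continuous_smul_const [ContinuousMul C] (M : FGProjective C)
    (m : M.carrier) : Continuous fun c : C => c • m := by
  have : Continuous fun c : C => M.retr (c • M.incl m) :=
    M.retr.continuous.comp (continuous_pi fun k => continuous_id.mul continuous_const)
  refine this.congr fun c => ?_
  rw [map_smul, M.retr_incl]

theorem FGProjective.continuous_zsmul [IsTopologicalRing C] (M : FGProjective C) (n : ℤ) :
    Continuous fun m : M.carrier => n • m := by
  have : Continuous fun m : M.carrier => M.retr (n • M.incl m) :=
    M.retr.continuous.comp (M.incl.continuous.zsmul n)
  refine this.congr fun c => ?_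
  rw [map_zsmul, M.retr_incl]

theorem FGProjective.sum_smul (M : FGProjective C) (c : Fin M.rank → C) :
    ∑ k, c k • M.retr (Pi.single k 1) = M.retr c := by
  rw [← Fintype.sum_congr _ _ fun k => map_smul M.retr (c k) (Pi.single k 1), ← map_sum]
  congr 1
  ext l
  simp [Finset.sum_apply, Pi.single_apply]

variable {σ : C →ₐ[ℝ] C} {ε : ℤˣ} (K : JExt C D σ ε)

/-- A finitely generated projective module over `D = C + C j` is finitely generated projective
over `C`, since `Dⁿ` is `C²ⁿ` as a `C`-module. -/
def FGProjective.restrict (hα : Continuous K.α) (hβ : Continuous K.β)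
    (hmk : Continuous fun p : C × C => K.ι p.1 + K.ι p.2 * K.j) (N : FGProjective D) :
    FGProjective C :=
  letI : Module C N.carrier := Module.compHom N.carrier K.ι
  { carrier := N.carrier
    rank := N.rank + N.rank
    incl :=
      { toFun := fun m => Fin.append (fun k => K.α (N.incl m k)) (fun k => K.β (N.incl m k))
        map_add' := fun m m' => by
          ext i
          refine Fin.addCases (fun i => ?_) (fun i => ?_) i <;>
            simp only [Fin.append_left, Fin.append_right, map_add, Pi.add_apply]
        map_smul' := fun c m => by
          have h1 : N.incl (c • m) = K.ι c • N.incl m := map_smul N.incl (K.ι c) m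
          ext i
          refine Fin.addCases (fun i => ?_) (fun i => ?_) i
          · simp only [h1, Fin.append_left, Pi.smul_apply, smul_eq_mul, K.ι_mul_α, RingHom.id_apply]
          · simp only [h1, Fin.append_right, Pi.smul_apply, smul_eq_mul, K.ι_mul_β,
              RingHom.id_apply]
        cont := by
          refine continuous_pi fun i => ?_
          refine Fin.addCases (fun i => ?_) (fun i => ?_) i
          · simpa only [Fin.append_left, Function.comp_def] using
              hα.comp ((continuous_apply i).comp N.incl.continuous)
          · simpa only [Fin.append_right, Function.comp_def] using
              hβ.comp ((continuous_apply i).comp N.incl.continuous) }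
    retr :=
      { toFun := fun f => N.retr fun k =>
          K.ι (f (Fin.castAdd _ k)) + K.ι (f (Fin.natAdd _ k)) * K.j
        map_add' := fun f g => by
          rw [← map_add]
          congr 1
          ext k
          simp only [Pi.add_apply, map_add, add_mul]
          abel
        map_smul' := fun c f => by
          change _ = K.ι c • N.retr _
          rw [← map_smul]
          congr 1
          ext k
          simp [mul_add, mul_assoc]
        cont := N.retr.continuous.comp (continuous_pi fun k =>
          hmk.comp (f := fun a : Fin (N.rank + N.rank) → C =>
            (a (Fin.castAdd _ k), a (Fin.natAdd _ k)))
            ((continuous_apply _).prodMk (continuous_apply _))) }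
    retr_incl := fun m => by
      change N.retr _ = m
      conv_rhs => rw [← N.retr_incl m]
      congr 1
      ext k
      refine (congrArg₂ (fun y z => K.ι y + K.ι z * K.j)
        (Fin.append_left (fun k => K.α (N.incl m k)) (fun k => K.β (N.incl m k)) k)
        (Fin.append_right (fun k => K.α (N.incl m k)) (fun k => K.β (N.incl m k)) k)).trans
        (K.eq _).symm }

/-- A finitely generated projective `C`-module with a `σ`-linear map `J`, `J² = ε`, is a
finitely generated projective module over `D = C + C j`. The retraction `Dⁿ → M` is the `D`-linear
extension of the given `Cⁿ → M`. Its section is the average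
`m ↦ ½ (incl m + ε j · incl (J m))` of the inclusion over the action of `j`. -/
def FGProjective.extend [IsTopologicalRing C] [ContinuousConstSMul ℝ C] (hα : Continuous K.α)
    (hβ : Continuous K.β) (hmk : Continuous fun p : C × C => K.ι p.1 + K.ι p.2 * K.j)
    (hσ : Continuous σ) (M : FGProjective C) (J : M.carrier →+ M.carrier)
    (hJ : ∀ (b : C) v, J (b • v) = σ b • J v) (hJJ : ∀ v, J (J v) = (ε : ℤ) • v)
    (hJc : Continuous J) : FGProjective D :=
  letI : Module D M.carrier := K.module J hJ hJJ
  have smul_def : ∀ (x : D) (m : M.carrier), x • m = K.α x • m + K.β x • J m := fun _ _ => rfl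
  { carrier := M.carrier
    rank := M.rank
    incl :=
      { toFun := fun m k => K.ι ((2⁻¹ : ℝ) • M.incl m k) +
          K.ι ((ε : ℤ) * σ ((2⁻¹ : ℝ) • M.incl (J m) k)) * K.j
        map_add' := fun m m' => by
          ext k
          simp only [map_add, Pi.add_apply, smul_add, mul_add, add_mul]
          abel
        map_smul' := fun x m => by
          ext k
          have h1 : M.incl (x • m) k = K.α x * M.incl m k + K.β x * M.incl (J m) k := by
            rw [smul_def, map_add, map_smul, map_smul]
            rfl
          have hεε : ∀ z : C, ((ε : ℤ) : C) * (((ε : ℤ) : C) * z) = z := fun z => by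
            rw [← mul_assoc, ← Int.cast_mul, JExt.ε_mul_ε, Int.cast_one, one_mul]
          have hc : ∀ y z : C, y * (((ε : ℤ) : C) * z) = ((ε : ℤ) : C) * (y * z) := fun y z => by
            rw [← mul_assoc, ← (Int.cast_commute _ _).eq, mul_assoc]
          have h2 : M.incl (J (x • m)) k =
              σ (K.α x) * M.incl (J m) k + (ε : ℤ) * (σ (K.β x) * M.incl m k) := by
            rw [smul_def, map_add, hJ, hJ, hJJ, map_add, map_smul, map_smul, map_zsmul]
            simp [hc]
          simp only [RingHom.id_apply, Pi.smul_apply, smul_eq_mul]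
          rw [K.mul_eq x, K.α_eq, K.β_eq, h1, h2]
          have h3 : (2⁻¹ : ℝ) • (K.α x * M.incl m k + K.β x * M.incl (J m) k) =
              K.α x * (2⁻¹ : ℝ) • M.incl m k + (ε : ℤ) * (K.β x *
                σ ((ε : ℤ) * σ ((2⁻¹ : ℝ) • M.incl (J m) k))) := by
            simp only [map_mul, map_intCast, K.σ_σ, smul_add, mul_smul_comm, hεε, hc]
          have h4 : ((ε : ℤ) : C) * σ ((2⁻¹ : ℝ) • (σ (K.α x) * M.incl (J m) k +
                (ε : ℤ) * (σ (K.β x) * M.incl m k))) =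
              K.α x * ((ε : ℤ) * σ ((2⁻¹ : ℝ) • M.incl (J m) k)) +
                K.β x * σ ((2⁻¹ : ℝ) • M.incl m k) := by
            simp only [map_add, map_mul, map_intCast, K.σ_σ, smul_add, mul_add, map_smul,
              mul_smul_comm, hεε, hc]
          rw [h3, h4]
        cont := continuous_pi fun k => by
          refine hmk.comp (Continuous.prodMk ?_ (continuous_const.mul (hσ.comp ?_)))
          · exact ((continuous_apply k).comp M.incl.continuous).const_smul _
          · exact ((continuous_apply k).comp (M.incl.continuous.comp hJc)).const_smul _ }
    retr :=
      { toFun := fun f => ∑ k, f k • M.retr (Pi.single k 1)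
        map_add' := fun f g => by simp [add_smul, Finset.sum_add_distrib]
        map_smul' := fun x f => by simp [mul_smul, Finset.smul_sum]
        cont := by
          have hadd := M.continuous_add
          have hsum : ∀ (T : Finset (Fin M.rank)),
              Continuous fun f : Fin M.rank → D => ∑ k ∈ T, f k • M.retr (Pi.single k 1) := by
            intro T
            induction T using Finset.cons_induction with
            | empty => simpa using continuous_const
            | cons k T hk ih =>
              simp only [Finset.sum_cons]
              refine hadd.comp (Continuous.prodMk ?_ ih)
              exact hadd.comp (Continuous.prodMk
                ((M.continuous_smul_const _).comp (hα.comp (continuous_apply k)))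
                ((M.continuous_smul_const _).comp (hβ.comp (continuous_apply k))))
          exact hsum _ }
    retr_incl := fun m => by
      change ∑ k, (K.ι ((2⁻¹ : ℝ) • M.incl m k) +
        K.ι ((ε : ℤ) * σ ((2⁻¹ : ℝ) • M.incl (J m) k)) * K.j) • M.retr (Pi.single k 1) = m
      have h1 : ∀ k, (K.ι ((2⁻¹ : ℝ) • M.incl m k) +
          K.ι ((ε : ℤ) * σ ((2⁻¹ : ℝ) • M.incl (J m) k)) * K.j) • M.retr (Pi.single k 1) =
          ((2⁻¹ : ℝ) • M.incl m) k • M.retr (Pi.single k 1) +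
            (ε : ℤ) • J (((2⁻¹ : ℝ) • M.incl (J m)) k • M.retr (Pi.single k 1)) := fun k => by
        rw [smul_def, K.α_eq, K.β_eq, hJ, mul_smul, Int.cast_smul_eq_zsmul]
        rfl
      have hhalf : ∀ m : M.carrier, M.retr ((2⁻¹ : ℝ) • M.incl m) =
          algebraMap ℝ C 2⁻¹ • m := fun m => by
        conv_rhs => rw [← M.retr_incl m, ← map_smul]
        congr 1
        ext k
        simp [Algebra.smul_def]
      rw [Finset.sum_congr rfl fun k _ => h1 k, Finset.sum_add_distrib, ← Finset.smul_sum,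
        ← map_sum, M.sum_smul, M.sum_smul, hhalf, hhalf, hJ, hJJ, AlgHom.commutes, smul_comm,
        smul_smul, JExt.ε_mul_ε, one_smul, ← add_smul, ← map_add]
      norm_num }

end FG

/-! ### Bundles with an action of `j` -/

section JBundles

variable {X : Type u} [TopologicalSpace X] [InvolutiveSpace X]
  {C : Type v} [Ring C] [Algebra ℝ C] [TopologicalSpace C]
  {D : Type v} [Ring D] [Algebra ℝ D] [TopologicalSpace D]
  {R : Type*} [CStarAlgebra R] [PartialOrder R] [StarOrderedRing R]
  {𝒜 : RealAlgebraBundle X C} {𝒟 : RealAlgebraBundle X D}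

theorem AntiInvolution.star_one (s : AntiInvolution 𝒜) (x : X) : s.star x 1 = 1 := by
  have h := s.star_mul x 1 (s.star x 1)
  rwa [one_mul, s.star_star, one_mul, eq_comm] at h

/-- The composite of two anti-involutions, an endomorphism of the fibres. -/
def twist (s h : AntiInvolution 𝒜) (x : X) : 𝒜.fiber x →ₐ[ℝ] 𝒜.fiber x :=
  AlgHom.ofLinearMap (h.star x ∘ₗ s.star x) (by simp [AntiInvolution.star_one]) fun a b => by
    simp [s.star_mul, h.star_mul]

theorem twist_apply (s h : AntiInvolution 𝒜) (x : X) (b : 𝒜.fiber x) :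
    twist s h x b = h.star x (s.star x b) := rfl

theorem star_twist (s h : AntiInvolution 𝒜) (x : X) (b : 𝒜.fiber x) :
    h.star x (twist s h x b) = s.star x b := h.star_star x _

theorem twist_conj (s h : AntiInvolution 𝒜) (x : X) (b : 𝒜.fiber x) :
    twist s h (bar x) (𝒜.conj x b) = 𝒜.conj x (twist s h x b) := by
  rw [twist_apply, twist_apply, s.star_conj, h.star_conj]

/-- The setting of the correspondence between forms and module structures. The fibres of `𝒜` are
`C*`-algebras for the anti-involution `h` (through an isomorphism `e` of the model fibre with
`R`), and `𝒟` is obtained from `𝒜` by adjoining an element `j`, fixed by the involution, with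
`j² = ε` and `j b = h(s(b)) j`, where `s` is a second anti-involution, commuting with `h`. The
charts of `𝒟` extend those of `𝒜` and send `j` to an element `j` of the model fibre. -/
structure JData (e : C ≃A[ℝ] R) (s h : AntiInvolution 𝒜) (ε : ℤˣ) (𝒟 : RealAlgebraBundle X D) where
  isCStar : IsCStarInvolution e h
  comm : ∀ x b, h.star x (s.star x b) = s.star x (h.star x b)
  ext : ∀ x, JExt (𝒜.fiber x) (𝒟.fiber x) (twist s h x) ε
  conj_ι : ∀ x b, 𝒟.conj x ((ext x).ι b) = (ext (bar x)).ι (𝒜.conj x b)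
  conj_j : ∀ x, 𝒟.conj x (ext x).j = (ext (bar x)).j
  σ : C →ₐ[ℝ] C
  model : JExt C D σ ε
  continuous_σ : Continuous σ
  continuous_α : Continuous model.α
  continuous_β : Continuous model.β
  continuous_mk : Continuous fun p : C × C => model.ι p.1 + model.ι p.2 * model.j
  base_eq : ∀ x, (𝒟.chartAt x).base = (𝒜.chartAt x).base
  chart_ι : ∀ x y (hy : y ∈ (𝒜.chartAt x).base) (hy' : y ∈ (𝒟.chartAt x).base) b,
    (𝒟.chartAt x).iso ⟨y, hy'⟩ ((ext y).ι b) = model.ι ((𝒜.chartAt x).iso ⟨y, hy⟩ b)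
  chart_j : ∀ x y (hy' : y ∈ (𝒟.chartAt x).base), (𝒟.chartAt x).iso ⟨y, hy'⟩ (ext y).j = model.j

variable {e : C ≃A[ℝ] R} {s h : AntiInvolution 𝒜} {ε : ℤˣ}

/-- A ring isomorphic to a topological ring is a topological ring. -/
theorem isTopologicalRing_of_equiv (e : C ≃A[ℝ] R) : IsTopologicalRing C where
  continuous_add := by
    refine (e.symm.continuous.comp ((e.continuous.comp continuous_fst).add
      (e.continuous.comp continuous_snd))).congr fun p => ?_
    change e.symm (e p.1 + e p.2) = _
    rw [← map_add]
    exact e.symm_apply_apply _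
  continuous_mul := by
    refine (e.symm.continuous.comp ((e.continuous.comp continuous_fst).mul
      (e.continuous.comp continuous_snd))).congr fun p => ?_
    change e.symm (e p.1 * e p.2) = _
    rw [← map_mul]
    exact e.symm_apply_apply _
  continuous_neg := by
    refine (e.symm.continuous.comp e.continuous.neg).congr fun p => ?_
    change e.symm (-e p) = _
    rw [← map_neg]
    exact e.symm_apply_apply _

theorem continuousConstSMul_of_equiv (e : C ≃A[ℝ] R) : ContinuousConstSMul ℝ C where
  continuous_const_smul r := by
    refine (e.symm.continuous.comp (e.continuous.const_smul r)).congr fun p => ?_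
    change e.symm (r • e p) = _
    rw [← map_smul]
    exact e.symm_apply_apply _

namespace JData

variable (K : JData e s h ε 𝒟)
include K

theorem twist_twist (x : X) (b : 𝒜.fiber x) : twist s h x (twist s h x b) = b :=
  (K.ext x).σ_σ b

theorem twist_star (x : X) (b : 𝒜.fiber x) :
    twist s h x (h.star x b) = s.star x b := by
  rw [twist_apply, ← K.comm, h.star_star]

theorem star_s_twist (x : X) (b : 𝒜.fiber x) :
    s.star x (twist s h x b) = h.star x b := by
  rw [twist_apply, K.comm, s.star_star]

theorem isNonneg_twist {x : X} {b : 𝒜.fiber x} (hb : h.IsNonneg x b) :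
    h.IsNonneg x (twist s h x b) := by
  obtain ⟨c, rfl⟩ := hb
  exact ⟨twist s h x c, by rw [map_mul, K.twist_star, star_twist]⟩

theorem mem_iff {x y : X} : y ∈ (𝒟.chartAt x).base ↔ y ∈ (𝒜.chartAt x).base := by
  rw [K.base_eq]

theorem chart_twist (x : X) (y : X) (hy : y ∈ (𝒜.chartAt x).base) (b : 𝒜.fiber y) :
    (𝒜.chartAt x).iso ⟨y, hy⟩ (twist s h y b) = K.σ ((𝒜.chartAt x).iso ⟨y, hy⟩ b) := by
  have hy' := K.mem_iff.2 hy
  have h1 := congrArg ((𝒟.chartAt x).iso ⟨y, hy'⟩) ((K.ext y).j_mul b)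
  rw [map_mul, map_mul, K.chart_j, K.chart_ι x y hy, K.chart_ι x y hy, K.model.j_mul] at h1
  have h2 := congrArg K.model.β h1
  rw [← zero_add (_ * _), ← map_zero K.model.ι, K.model.β_eq, ← zero_add (_ * _),
    ← map_zero K.model.ι, K.model.β_eq] at h2
  exact h2.symm

theorem chart_eq (x y : X) (hy : y ∈ (𝒜.chartAt x).base) (hy' : y ∈ (𝒟.chartAt x).base)
    (d : 𝒟.fiber y) :
    (𝒟.chartAt x).iso ⟨y, hy'⟩ d = K.model.ι ((𝒜.chartAt x).iso ⟨y, hy⟩ ((K.ext y).α d)) +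
      K.model.ι ((𝒜.chartAt x).iso ⟨y, hy⟩ ((K.ext y).β d)) * K.model.j := by
  conv_lhs => rw [(K.ext y).eq d]
  rw [map_add, map_mul, K.chart_ι x y hy, K.chart_ι x y hy, K.chart_j]

theorem conj_eq (x : X) (d : 𝒟.fiber x) :
    𝒟.conj x d = (K.ext (bar x)).ι (𝒜.conj x ((K.ext x).α d)) +
      (K.ext (bar x)).ι (𝒜.conj x ((K.ext x).β d)) * (K.ext (bar x)).j := by
  conv_lhs => rw [(K.ext x).eq d]
  rw [map_add, map_mul, K.conj_ι, K.conj_ι, K.conj_j]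

end JData

/-- A continuous family of maps `J` on the fibres of `E` by which `j` can act. -/
structure JStructure (s h : AntiInvolution 𝒜) (ε : ℤˣ) (E : RealBundle 𝒜) where
  J : ∀ x, E.fiber x →+ E.fiber x
  smul : ∀ x (b : 𝒜.fiber x) v, J x (b • v) = twist s h x b • J x v
  sq : ∀ x v, J x (J x v) = (ε : ℤ) • v
  conj : ∀ x v, J (bar x) (E.conj x v) = E.conj x (J x v)
  continuous_J : ContinuousEnd E fun x => J x

/-- A continuous family of endomorphisms of a fixed projective module which at the point `x` is
multiplication by `2` is bijective near `x`, with continuous inverse. -/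
theorem exists_nhds_inverse (e : C ≃A[ℝ] R) (M : FGProjective C) {B : Type*} [TopologicalSpace B]
    (g : B → M.carrier →ₗ[C] M.carrier)
    (hg : Continuous fun p : B × M.carrier => g p.1 p.2) (x : B) (hx : ∀ m, g x m = m + m) :
    ∃ (U : Set B) (g' : U → M.carrier → M.carrier), IsOpen U ∧ x ∈ U ∧
      (∀ (y : U) m, g' y (g y m) = m) ∧ (∀ (y : U) m, g y (g' y m) = m) ∧
      Continuous fun p : U × M.carrier => g' p.1 p.2 := by
  let θ : C ≃+* R := e.toAlgEquiv.toRingEquiv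
  let F : FibreFrame θ M.carrier (Fin M.rank) :=
    { coord :=
        { toFun := fun v k => e (M.incl v k)
          map_zero' := by ext; simp
          map_add' := fun v w => by ext; simp }
      comb :=
        { toFun := fun r => M.retr fun k => e.symm (r k)
          map_zero' := by
            have : (fun k : Fin M.rank => e.symm ((0 : Fin M.rank → R) k)) = 0 := by ext; simp
            rw [this, map_zero]
          map_add' := fun r s => by
            have : (fun k : Fin M.rank => e.symm ((r + s) k)) =
                (fun k => e.symm (r k)) + fun k => e.symm (s k) := by ext; simp
            rw [this, map_add] }
      coord_smul := fun b v => by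
        ext k
        exact (congrArg e (congrFun (map_smul M.incl b v) k)).trans (map_mul e _ _)
      comb_smul := fun b r => by
        simp only [AddMonoidHom.coe_mk, ZeroHom.coe_mk]
        rw [← map_smul]
        congr 1
        ext k
        change e.symm (e b * r k) = b * e.symm (r k)
        rw [map_mul]
        exact congrArg (· * _) (e.symm_apply_apply b)
      comb_coord := fun v => by simp [M.retr_incl] }
  have hcoord : Continuous F.coord := continuous_pi fun k => e.continuous.comp
    ((continuous_apply k).comp M.incl.continuous)
  have hcomb : Continuous F.comb := M.retr.continuous.comp (continuous_pi fun k =>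
    e.symm.continuous.comp (continuous_apply k))
  -- `W` extends the endomorphism by the identity of the complement of `M` in the module of rows.
  let W : B → SqMat (Fin M.rank) R := fun y => F.mat (g y) + (1 - F.proj)
  have hW : Continuous W := by
    refine Continuous.add (SqMat.continuous_iff.2 fun k l => (continuous_apply l).comp ?_)
      continuous_const
    exact hcoord.comp (hg.comp (continuous_id.prodMk continuous_const))
  have hrow : ∀ y c, rowMul c (W y) = F.coord (g y (F.comb c)) + rowMul c (1 - F.proj) :=
    fun y c => by rw [rowMul_add, F.rowMul_mat]
  have hWx : IsUnit (W x) := by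
    have h1 : W x = 1 + F.proj := by
      refine SqMat.ext_rowMul fun c => ?_
      rw [hrow, hx, map_add, rowMul_sub, rowMul_add, rowMul_one, F.rowMul_proj]
      abel
    have h2 : F.proj * F.proj = F.proj := F.proj_mul_proj
    have h3 : (1 + F.proj) * (1 - (2⁻¹ : ℂ) • F.proj) = 1 := by
      rw [mul_sub, mul_one, add_mul, one_mul, mul_smul_comm, h2, ← two_smul ℂ ((2⁻¹ : ℂ) • F.proj),
        smul_smul, mul_inv_cancel₀ two_ne_zero, one_smul, add_sub_cancel_right]
    have h4 : (1 - (2⁻¹ : ℂ) • F.proj) * (1 + F.proj) = 1 := by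
      rw [sub_mul, one_mul, mul_add, mul_one, smul_mul_assoc, h2,
        ← two_smul ℂ ((2⁻¹ : ℂ) • F.proj),
        smul_smul, mul_inv_cancel₀ two_ne_zero, one_smul, add_sub_cancel_right]
    rw [h1]
    exact ⟨⟨_, _, h3, h4⟩, rfl⟩
  let U : Set B := W ⁻¹' {w | IsUnit w}
  have hu : ∀ y : U, IsUnit (W y) := fun y => y.2
  have hinv : Continuous fun y : U => (↑(hu y).unit⁻¹ : SqMat (Fin M.rank) R) := by
    refine continuous_iff_continuousAt.2 fun y => ?_
    have := (NormedRing.inverse_continuousAt (hu y).unit).comp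
      (f := fun y : U => W y) (hW.comp continuous_subtype_val).continuousAt
    refine this.congr (Filter.Eventually.of_forall fun z => ?_)
    exact Ring.inverse_unit (hu z).unit
  have hl : ∀ (y : U) m, F.comb (rowMul (F.coord (g y m)) (↑(hu y).unit⁻¹ : SqMat _ R)) = m := by
    intro y m
    have h1 : F.coord (g y m) = rowMul (F.coord m) (W y) := by
      rw [hrow, F.comb_coord, F.rowMul_coord_one_sub_proj, add_zero]
    rw [h1, rowMul_rowMul, IsUnit.mul_val_inv, rowMul_one, F.comb_coord]
  have hr : ∀ (y : U) m, g y (F.comb (rowMul (F.coord m) (↑(hu y).unit⁻¹ : SqMat _ R))) = m := by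
    intro y m
    have h1 := hrow y (rowMul (F.coord m) (↑(hu y).unit⁻¹ : SqMat _ R))
    rw [rowMul_rowMul, IsUnit.val_inv_mul, rowMul_one] at h1
    have h2 := congrArg F.comb h1
    rw [F.comb_coord, map_add, F.comb_coord, F.comb_rowMul_one_sub_proj, add_zero] at h2
    exact h2.symm
  exact ⟨U, fun y m => F.comb (rowMul (F.coord m) (↑(hu y).unit⁻¹ : SqMat _ R)),
    Units.isOpen.preimage hW, hWx, hl, hr,
    hcomb.comp (continuous_rowMul (hcoord.comp continuous_snd) (hinv.comp continuous_fst))⟩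

namespace JStructure

variable {E : RealBundle 𝒜}

/-- Local triviality as a `𝒟`-bundle. A chart `c` of the `𝒜`-bundle identifies the fibres near `x`
with `M`, on which `j` acts by its action `J₀` on the fibre over `x`. The average
`c + ε J₀ c J` of `c` over the action of `j` is `𝒟`-linear, it equals `2 c` at `x`, and hence is
bijective near `x`. -/
theorem exists_chart (K : JData e s h ε 𝒟) (𝒥 : JStructure s h ε E) (x : X) :
    letI (y : X) : Module (𝒟.fiber y) (E.fiber y) :=
      (K.ext y).module (𝒥.J y) (𝒥.smul y) (𝒥.sq y)
    ∃ (M : FGProjective D) (c : ModuleChart 𝒟 E.fiber (𝒟.chartAt x) M), x ∈ c.base := by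
  let (y : X) : Module (𝒟.fiber y) (E.fiber y) :=
      (K.ext y).module (𝒥.J y) (𝒥.smul y) (𝒥.sq y)
  have smul_def : ∀ y (d : 𝒟.fiber y) (v : E.fiber y),
    d • v = (K.ext y).α d • v + (K.ext y).β d • 𝒥.J y v := fun _ _ _ => rfl
  have := isTopologicalRing_of_equiv e
  have := continuousConstSMul_of_equiv e
  obtain ⟨M, c, hx⟩ := E.exists_chart x
  let x' : c.base := ⟨x, hx⟩
  let J₀ : M.carrier →+ M.carrier := ((c.iso x' : _ →+ M.carrier).comp (𝒥.J x)).comp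
    ((c.iso x').symm : M.carrier →+ _)
  have hJ₀ : ∀ m, J₀ m = c.iso x' (𝒥.J x ((c.iso x').symm m)) := fun _ => rfl
  have J₀_smul : ∀ (b : C) m, J₀ (b • m) = K.σ b • J₀ m := by
    intro b m
    obtain ⟨b, rfl⟩ : ∃ b' : 𝒜.fiber x, (𝒜.chartAt x).iso ⟨x, c.base_subset hx⟩ b' = b :=
      ((𝒜.chartAt x).iso ⟨x, c.base_subset hx⟩).surjective b
    obtain ⟨v, rfl⟩ : ∃ v : E.fiber x, c.iso x' v = m := (c.iso x').surjective m
    have h1 := c.iso_smul x' b v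
    have h2 : (c.iso x').symm (c.iso x' v) = v := AddEquiv.symm_apply_apply _ _
    have h3 : (c.iso x').symm (c.iso x' (b • v)) = b • v := AddEquiv.symm_apply_apply _ _
    rw [hJ₀, hJ₀, h2, ← K.chart_twist]
    refine (congrArg (fun m => c.iso x' (𝒥.J x ((c.iso x').symm m))) h1.symm).trans ?_
    refine (congrArg (fun m => c.iso x' (𝒥.J x m)) h3).trans ?_
    rw [𝒥.smul]
    exact c.iso_smul x' _ _
  have J₀_sq : ∀ m, J₀ (J₀ m) = (ε : ℤ) • m := by
    intro m
    rw [hJ₀, hJ₀, AddEquiv.symm_apply_apply, 𝒥.sq, map_zsmul, AddEquiv.apply_symm_apply]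
  have hJy : Continuous fun q : c.base × M.carrier =>
      c.iso q.1 (𝒥.J q.1 ((c.iso q.1).symm q.2)) :=
    c.continuous_iso.comp ((𝒥.continuous_J.comp c.continuous_symm).subtype_mk fun q => q.1.2)
  have J₀_cont : Continuous J₀ := hJy.comp (f := fun m => (x', m))
    (continuous_const.prodMk continuous_id)
  let N : FGProjective D := FGProjective.extend K.model K.continuous_α K.continuous_β
    K.continuous_mk K.continuous_σ M J₀ J₀_smul J₀_sq J₀_cont
  have smul_N : ∀ (d : D) (m : N.carrier),
    d • m = (HSMul.hSMul (α := C) (β := M.carrier) (K.model.α d) m : M.carrier) +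
      (HSMul.hSMul (α := C) (β := M.carrier) (K.model.β d) (J₀ m) : M.carrier) := fun _ _ => rfl
  -- The family `w` intertwines the actions of `j` on the fibres and on the model.
  let w : ∀ y : c.base, E.fiber y →+ M.carrier := fun y =>
    (c.iso y : _ →+ M.carrier) + (ε : ℤ) • J₀.comp ((c.iso y : _ →+ M.carrier).comp (𝒥.J y))
  have hw : ∀ y v, w y v = c.iso y v + (ε : ℤ) • J₀ (c.iso y (𝒥.J y v)) := fun _ _ => rfl
  have w_smul : ∀ (y : c.base) (b : 𝒜.fiber y) v,
      w y (b • v) = (𝒜.chartAt x).iso ⟨y, c.base_subset y.2⟩ b • w y v := by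
    intro y b v
    rw [hw, hw, 𝒥.smul, c.iso_smul, c.iso_smul, J₀_smul, K.chart_twist, K.model.σ_σ, smul_add,
      smul_comm (ε : ℤ)]
  have w_J : ∀ (y : c.base) v, w y (𝒥.J y v) = J₀ (w y v) := by
    intro y v
    rw [hw, hw, 𝒥.sq, map_add, map_zsmul, map_zsmul, map_zsmul, J₀_sq, smul_smul, smul_smul,
      JExt.ε_mul_ε, one_smul, one_smul, add_comm]
  let g : c.base → M.carrier →ₗ[C] M.carrier := fun y =>
    { toFun := fun m => w y ((c.iso y).symm m)
      map_add' := fun m m' => by simp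
      map_smul' := fun b m => by
        obtain ⟨b, rfl⟩ := ((𝒜.chartAt x).iso ⟨y, c.base_subset y.2⟩).surjective b
        obtain ⟨v, rfl⟩ := (c.iso y).surjective m
        rw [← c.iso_smul, AddEquiv.symm_apply_apply, AddEquiv.symm_apply_apply, w_smul]
        rfl }
  have hg' : ∀ y m, g y m = m + (ε : ℤ) • J₀ (c.iso y (𝒥.J y ((c.iso y).symm m))) := by
    intro y m
    change w y ((c.iso y).symm m) = _
    rw [hw, AddEquiv.apply_symm_apply]
  have hg : Continuous fun p : c.base × M.carrier => g p.1 p.2 := by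
    simp only [hg']
    exact M.continuous_add.comp (continuous_snd.prodMk
      ((M.continuous_zsmul _).comp (J₀_cont.comp hJy)))
  obtain ⟨U, g', hU, hxU, hl, hr, hcont⟩ := exists_nhds_inverse e M g hg x' fun m => by
    rw [hg', ← hJ₀, J₀_sq, smul_smul, JExt.ε_mul_ε, one_smul]
  have hmem : ∀ y : Subtype.val '' U, ∃ hy : (y : X) ∈ c.base, (⟨y, hy⟩ : c.base) ∈ U := by
    rintro ⟨_, y, hy, rfl⟩
    exact ⟨y.2, hy⟩
  have hgw : ∀ y v, g y (c.iso y v) = w y v := fun y v =>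
    congrArg (w y) ((c.iso y).symm_apply_apply v)
  refine ⟨N,
    { base := Subtype.val '' U
      isOpen_base := c.isOpen_base.isOpenMap_subtype_val U hU
      base_subset := by
        rintro _ ⟨y, hy, rfl⟩
        exact K.mem_iff.2 (c.base_subset y.2)
      iso := fun y =>
        { toFun := w ⟨y, (hmem y).1⟩
          invFun := fun m => (c.iso ⟨y, (hmem y).1⟩).symm (g' ⟨_, (hmem y).2⟩ m)
          left_inv := fun v => by
            rw [AddEquiv.symm_apply_eq, ← hgw ⟨y, (hmem y).1⟩ v]
            exact hl ⟨_, (hmem y).2⟩ _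
          right_inv := fun m => hr ⟨_, (hmem y).2⟩ m
          map_add' := map_add _ }
      iso_smul := fun y d v => ?_
      continuous_iso := ?_
      continuous_symm := ?_ }, ⟨x', hxU, rfl⟩⟩
  · have h1 := K.chart_eq x y (c.base_subset (hmem y).1) (K.mem_iff.2 (c.base_subset (hmem y).1)) d
    have h2 : w ⟨y, (hmem y).1⟩ (d • v) =
        (𝒜.chartAt x).iso ⟨y, c.base_subset (hmem y).1⟩ ((K.ext y).α d) • w ⟨y, (hmem y).1⟩ v +
          (𝒜.chartAt x).iso ⟨y, c.base_subset (hmem y).1⟩ ((K.ext y).β d) •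
            J₀ (w ⟨y, (hmem y).1⟩ v) := by
      rw [smul_def, map_add, w_smul ⟨y, (hmem y).1⟩, w_smul ⟨y, (hmem y).1⟩, w_J ⟨y, (hmem y).1⟩]
    have h3 : ∀ (b b' : C) (m : M.carrier),
        (HSMul.hSMul (β := N.carrier) (K.model.ι b + K.model.ι b' * K.model.j) m : N.carrier) =
          (b • m + b' • J₀ m : M.carrier) := fun b b' m =>
      (smul_N _ m).trans (by rw [K.model.α_eq, K.model.β_eq])
    exact h2.trans ((congrArg (fun d' : D => (HSMul.hSMul (β := N.carrier) d'
      (w ⟨y, (hmem y).1⟩ v) : N.carrier)) h1).trans (h3 _ _ _)).symm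
  · have h1 : Continuous fun p : {p : Tot E.fiber // p.proj ∈ Subtype.val '' U} =>
        (⟨⟨p.1.proj, (hmem ⟨_, p.2⟩).1⟩, c.iso ⟨p.1.proj, (hmem ⟨_, p.2⟩).1⟩ p.1.snd⟩ :
          c.base × M.carrier) :=
      Continuous.prodMk ((E.continuous_proj.comp continuous_subtype_val).subtype_mk _)
        (c.continuous_iso.comp
          (f := fun p : {p : Tot E.fiber // p.proj ∈ Subtype.val '' U} =>
            (⟨p.1, (hmem ⟨_, p.2⟩).1⟩ : {p : Tot E.fiber // p.proj ∈ c.base}))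
          (Continuous.subtype_mk continuous_subtype_val _))
    exact (hg.comp h1).congr fun p => hgw ⟨p.1.proj, (hmem ⟨_, p.2⟩).1⟩ p.1.snd
  · refine c.continuous_symm.comp (Continuous.prodMk
      ((continuous_subtype_val.comp continuous_fst).subtype_mk fun q => (hmem q.1).1)
      (hcont.comp (Continuous.prodMk (Continuous.subtype_mk
        ((continuous_subtype_val.comp continuous_fst).subtype_mk fun q => (hmem q.1).1)
        fun q => (hmem q.1).2) continuous_snd)))

end JStructure

namespace JData

variable (K : JData e s h ε 𝒟)

/-- The `𝒟`-bundle defined by an `𝒜`-bundle with an action of `j`. -/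
def extend (E : RealBundle 𝒜) (𝒥 : JStructure s h ε E) : RealBundle 𝒟 :=
  letI (y : X) : Module (𝒟.fiber y) (E.fiber y) :=
    (K.ext y).module (𝒥.J y) (𝒥.smul y) (𝒥.sq y)
  { fiber := E.fiber
    continuous_proj := E.continuous_proj
    exists_chart := 𝒥.exists_chart K
    conj := E.conj
    conj_smul := fun x d v => by
      change E.conj x ((K.ext x).α d • v + (K.ext x).β d • 𝒥.J x v) =
        (K.ext (bar x)).α (𝒟.conj x d) • E.conj x v +
          (K.ext (bar x)).β (𝒟.conj x d) • 𝒥.J (bar x) (E.conj x v)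
      rw [K.conj_eq, JExt.α_eq, JExt.β_eq, map_add, E.conj_smul, E.conj_smul, 𝒥.conj]
    conj_conj := E.conj_conj
    continuous_conj := E.continuous_conj }

theorem extend_ι_smul (E : RealBundle 𝒜) (𝒥 : JStructure s h ε E) (x : X) (b : 𝒜.fiber x)
    (v : E.fiber x) :
    HSMul.hSMul (β := (K.extend E 𝒥).fiber x) ((K.ext x).ι b) v = (b • v : E.fiber x) := by
  change (K.ext x).α ((K.ext x).ι b) • v + (K.ext x).β ((K.ext x).ι b) • 𝒥.J x v = b • v
  simp

theorem extend_j_smul (E : RealBundle 𝒜) (𝒥 : JStructure s h ε E) (x : X) (v : E.fiber x) :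
    HSMul.hSMul (β := (K.extend E 𝒥).fiber x) (K.ext x).j v = 𝒥.J x v := by
  change (K.ext x).α (K.ext x).j • v + (K.ext x).β (K.ext x).j • 𝒥.J x v = 𝒥.J x v
  simp

/-- Restriction of scalars from `𝒟` to `𝒜`. -/
def restrict (F : RealBundle 𝒟) : RealBundle 𝒜 :=
  letI (y : X) : Module (𝒜.fiber y) (F.fiber y) := Module.compHom (F.fiber y) (K.ext y).ι
  { fiber := F.fiber
    continuous_proj := F.continuous_proj
    exists_chart := fun x => by
      obtain ⟨N, c, hx⟩ := F.exists_chart x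
      refine ⟨FGProjective.restrict K.model K.continuous_α K.continuous_β K.continuous_mk N,
        { base := c.base
          isOpen_base := c.isOpen_base
          base_subset := fun y hy => K.mem_iff.1 (c.base_subset hy)
          iso := c.iso
          iso_smul := fun y b v => (c.iso_smul y ((K.ext y).ι b) v).trans ?_
          continuous_iso := c.continuous_iso
          continuous_symm := c.continuous_symm }, hx⟩
      rw [K.chart_ι x y (K.mem_iff.1 (c.base_subset y.2))]
      rfl
    conj := F.conj
    conj_smul := fun x b v => by
      refine (F.conj_smul x ((K.ext x).ι b) v).trans ?_
      rw [K.conj_ι]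
      rfl
    conj_conj := F.conj_conj
    continuous_conj := F.continuous_conj }

end JData

end JBundles

/-! ### Automorphisms relating two metrics -/

section JForms

variable {X : Type u} [TopologicalSpace X] [InvolutiveSpace X]
  {C : Type v} [Ring C] [Algebra ℝ C] [TopologicalSpace C]
  {D : Type v} [Ring D] [Algebra ℝ D] [TopologicalSpace D]
  {R : Type*} [CStarAlgebra R] [PartialOrder R] [StarOrderedRing R]
  {𝒜 : RealAlgebraBundle X C} {𝒟 : RealAlgebraBundle X D}
  {e : C ≃A[ℝ] R} {s h : AntiInvolution 𝒜} {ε : ℤˣ} {E E' : RealBundle 𝒜}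

/-- The inverse of the involution on the fibres of a Real bundle. -/
def RealBundle.conjInv (E : RealBundle 𝒜) (x : X) : E.fiber (bar x) ≃+ E.fiber x :=
  (AddEquiv.ofBijective (E.conj x) (E.conj_bijective x)).symm

@[simp] theorem RealBundle.conj_conjInv (x : X) (v : E.fiber (bar x)) :
    E.conj x (E.conjInv x v) = v :=
  (AddEquiv.ofBijective (E.conj x) (E.conj_bijective x)).apply_symm_apply v

@[simp] theorem RealBundle.conjInv_conj (x : X) (v : E.fiber x) :
    E.conjInv x (E.conj x v) = v :=
  (AddEquiv.ofBijective (E.conj x) (E.conj_bijective x)).symm_apply_apply v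

theorem continuousEnd_zsmul (e : C ≃A[ℝ] R) (E : RealBundle 𝒜) (n : ℤ) :
    ContinuousEnd E fun _ v => n • v := by
  refine LocalFrame.continuous_of_frames (e := e) fun x => ?_
  obtain ⟨F, hx⟩ := exists_localFrame e E x
  refine ⟨F, hx, (F.continuous_comb_comp
    ((E.continuous_proj.comp continuous_subtype_val).subtype_mk fun p => p.2)
    (F.continuous_coord.zsmul n)).congr fun p => congrArg (Bundle.TotalSpace.mk _) ?_⟩
  change (F.frame ⟨p.1.proj, p.2⟩).comb (n • (F.frame ⟨p.1.proj, p.2⟩).coord p.1.snd) = _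
  rw [map_zsmul, (F.frame ⟨p.1.proj, p.2⟩).comb_coord]

namespace Metric

/-- Two positive endomorphisms with the same square are equal. -/
theorem eq_of_sq (he : IsCStarInvolution e h) (ψ : Metric h E) {x : X}
    {U U' : E.fiber x →ₗ[𝒜.fiber x] E.fiber x} (hU : ∀ v, h.IsNonneg x (ψ.toDual x (U v) v))
    (hU' : ∀ v, h.IsNonneg x (ψ.toDual x (U' v) v)) (hsq : ∀ v, U (U v) = U' (U' v)) :
    U = U' := by
  obtain ⟨F, hx, hF⟩ := ψ.toPosForm.exists_parseval he ψ.nondegenerate x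
  have key : ∀ V : E.fiber x →ₗ[𝒜.fiber x] E.fiber x,
      (∀ v, h.IsNonneg x (ψ.toDual x (V v) v)) → (∀ v, V (V v) = (U ∘ₗ U) v) →
      V = (F.frame ⟨x, hx⟩).sqrtEnd (U ∘ₗ U) := fun V h1 h2 =>
    (F.frame ⟨x, hx⟩).eq_sqrtEnd (ψ.toPosForm.isPosForm he F.pt ⟨x, F.base_subset hx⟩)
      (hF ⟨x, hx⟩) (fun v => (isNonneg_iff he F.pt ⟨x, F.base_subset hx⟩ _).1 (h1 v)) h2
  rw [key U hU fun _ => rfl, key U' hU' fun v => (hsq v).symm]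

/-- A positive endomorphism whose square commutes with the involution commutes with it, by
uniqueness of positive square roots. -/
theorem comm_conj_of_sq (he : IsCStarInvolution e h) (ψ : Metric h E)
    {U : ∀ x, E.fiber x →ₗ[𝒜.fiber x] E.fiber x}
    (hU : ∀ x v, h.IsNonneg x (ψ.toDual x (U x v) v))
    (hsq : ∀ x v, U (bar x) (U (bar x) (E.conj x v)) = E.conj x (U x (U x v))) (x : X)
    (v : E.fiber x) : U (bar x) (E.conj x v) = E.conj x (U x v) := by
  let U' : E.fiber x →ₗ[𝒜.fiber x] E.fiber x :=
    { toFun := fun v => E.conjInv x (U (bar x) (E.conj x v))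
      map_add' := fun v w => by simp
      map_smul' := fun b v => by
        apply (E.conj_bijective x).1
        simp [E.conj_smul] }
  have h1 : U' = U x := by
    refine ψ.eq_of_sq he (fun v => ?_) (hU x) fun v => ?_
    · have h2 := hU (bar x) (E.conj x v)
      rw [← E.conj_conjInv x (U (bar x) (E.conj x v)), ψ.map_conj] at h2
      have h3 := IsNonneg.conjInv h2
      rwa [RealAlgebraBundle.conjInv_conj] at h3
    · change E.conjInv x (U (bar x) (E.conj x (E.conjInv x (U (bar x) (E.conj x v))))) = _
      rw [E.conj_conjInv, hsq, E.conjInv_conj]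
  rw [← h1]
  exact (E.conj_conjInv x _).symm

theorem ext_form (ψ : Metric h E) {x : X} {v v' : E.fiber x}
    (H : ∀ w, ψ.toDual x v w = ψ.toDual x v' w) : v = v' :=
  (ψ.bijective x).1 (LinearMap.ext H)

theorem star_form (ψ : Metric h E) {x : X} (v w : E.fiber x) :
    h.star x (ψ.toDual x v w) = ψ.toDual x w v := by
  rw [ψ.symm x v w, Units.val_one, one_smul]

/-- The pull-back of a metric under an isomorphism. -/
def congr (f : E.Iso E') (ψ : Metric h E') : Metric h E where
  toDual x :=
    { toFun := fun v => ψ.toDual x (f.equiv x v) ∘ₗ (f.equiv x : E.fiber x →ₗ[𝒜.fiber x] _)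
      map_zero' := by ext; simp
      map_add' := fun v w => by ext; simp }
  toDual_smul x a v w := by simp [ψ.toDual_smul]
  bijective x := by
    constructor
    · intro v v' hv
      refine (f.equiv x).injective (ψ.ext_form fun w => ?_)
      simpa using LinearMap.congr_fun hv ((f.equiv x).symm w)
    · intro l
      obtain ⟨v, hv⟩ := (ψ.bijective x).2 (l ∘ₗ ((f.equiv x).symm : _ →ₗ[𝒜.fiber x] E.fiber x))
      refine ⟨(f.equiv x).symm v, LinearMap.ext fun w => ?_⟩
      simpa using LinearMap.congr_fun hv (f.equiv x w)
  symm x v w := ψ.symm x _ _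
  map_conj x v w := by simp [f.map_conj, ψ.map_conj]
  continuous_form := ContinuousForm.comp (B := ψ.toDual) ψ.continuous_form
    (f.continuous_toFun.comp continuous_tot_fst) (f.continuous_toFun.comp continuous_tot_snd)
  pos x v := ψ.pos x _

theorem congr_apply (f : E.Iso E') (ψ : Metric h E') (x : X) (v w : E.fiber x) :
    (ψ.congr f).toDual x v w = ψ.toDual x (f.equiv x v) (f.equiv x w) := rfl

/-- The orthogonal sum of metrics. -/
def sum (he : IsCStarInvolution e h) (ψ : Metric h E) (ψ' : Metric h E') :
    Metric h (E.sum E') where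
  toSymForm := (SymBundle.sum ⟨E, ψ.toSymForm⟩ ⟨E', ψ'.toSymForm⟩).form
  pos x v := IsNonneg.add he (ψ.pos x v.1) (ψ'.pos x v.2)

/-- Any two metrics on a bundle are related by a positive automorphism: the positive square root of
the endomorphism `S` with `ψ(S v, w) = ψ'(v, w)`, whose inverse is obtained by exchanging the
metrics. -/
theorem exists_iso (he : IsCStarInvolution e h) (ψ ψ' : Metric h E) :
    ∃ f : E.Iso E, (∀ x v, h.IsNonneg x (ψ.toDual x (f.equiv x v) v)) ∧
      ∀ x v w, ψ.toDual x (f.equiv x (f.equiv x v)) w = ψ'.toDual x v w := by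
  have hlin : ∀ (ψ ψ' : Metric h E) x (b : 𝒜.fiber x) v,
      ψ.toPosForm.repr ψ.nondegenerate ψ'.toDual x (b • v) =
        b • ψ.toPosForm.repr ψ.nondegenerate ψ'.toDual x v := fun ψ ψ' x b v =>
    ψ.ext_form fun w => by
      have h1 := fun v => LinearMap.congr_fun
        (ψ.toPosForm.form_repr ψ.nondegenerate ψ'.toDual x v) w
      rw [ψ.toDual_smul]
      exact (h1 _).trans ((ψ'.toDual_smul x b v w).trans (congrArg (· * _) (h1 v).symm))
  let S : ∀ (ψ ψ' : Metric h E) x, E.fiber x →ₗ[𝒜.fiber x] E.fiber x := fun ψ ψ' x =>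
    { ψ.toPosForm.repr ψ.nondegenerate ψ'.toDual x with map_smul' := hlin ψ ψ' x }
  have hS : ∀ (ψ ψ' : Metric h E) x v w,
      ψ.toDual x (S ψ ψ' x v) w = ψ'.toDual x v w := fun ψ ψ' x v w => LinearMap.congr_fun (ψ.toPosForm.form_repr ψ.nondegenerate ψ'.toDual x v) w
  have hSc : ∀ ψ ψ' : Metric h E, ContinuousEnd E fun x => S ψ ψ' x := fun ψ ψ' =>
    ψ.toPosForm.continuous_repr he ψ.nondegenerate ψ'.continuous_form
  have hSS : ∀ x v, S ψ' ψ x (S ψ ψ' x v) = v := fun x v =>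
    ψ'.ext_form fun w => by rw [hS, hS]
  have hSS' : ∀ x v, S ψ ψ' x (S ψ' ψ x v) = v := fun x v =>
    ψ.ext_form fun w => by rw [hS, hS]
  obtain ⟨U, hUc, hUU, hUpos, -⟩ := ψ.toPosForm.exists_sqrt he ψ.nondegenerate
    (hSc ψ ψ') fun x v => by
      change h.IsNonneg x (ψ.toDual x (S ψ ψ' x v) v)
      rw [hS]
      exact ψ'.pos x v
  have hconj : ∀ x v, U (bar x) (E.conj x v) = E.conj x (U x v) :=
    ψ.comm_conj_of_sq he hUpos fun x v => by
      rw [hUU, hUU]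
      refine ψ.ext_form fun w => ?_
      obtain ⟨w, rfl⟩ := (E.conj_bijective x).2 w
      rw [hS, ψ'.map_conj, ψ.map_conj, hS]
  have hl : ∀ x v, S ψ' ψ x (U x (U x v)) = v := fun x v => by rw [hUU, hSS]
  have hinj : ∀ x, Function.Injective (U x) := fun x v v' hv => by
    rw [← hl x v, hv, hl]
  have hr : ∀ x v, U x (S ψ' ψ x (U x v)) = v := fun x v => hinj x (by rw [hUU, hSS'])
  refine ⟨{
    equiv := fun x => LinearEquiv.ofLinearMap (U x) (S ψ' ψ x ∘ₗ U x)
      (LinearMap.ext (hr x)) (LinearMap.ext (hl x))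
    continuous_toFun := hUc
    continuous_invFun := (hSc ψ' ψ).comp hUc
    map_conj := hconj }, hUpos, fun x v w => ?_⟩
  change ψ.toDual x (U x (U x v)) w = _
  rw [hUU, hS]

theorem selfAdjoint (he : IsCStarInvolution e h) (ψ : Metric h E) {x : X}
    {U : E.fiber x →ₗ[𝒜.fiber x] E.fiber x} (hU : ∀ v, h.IsNonneg x (ψ.toDual x (U v) v))
    (v w : E.fiber x) : ψ.toDual x (U v) w = ψ.toDual x v (U w) :=
  ψ.toPosForm.selfAdjoint he ψ.nondegenerate hU v w

end Metric

/-! ### Forms and actions of `j` -/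

namespace JData

variable (K : JData e s h ε 𝒟)
include K

theorem zsmul_zsmul {M : Type*} [AddCommGroup M] (m : M) : (ε : ℤ) • (ε : ℤ) • m = m := by
  rw [smul_smul, JExt.ε_mul_ε, one_smul]

/-- A form is represented, with respect to a metric, by a twisted linear bijection. -/
theorem exists_repr (ψ : Metric h E) (φ : SymForm s ε E) :
    ∃ T : ∀ x, E.fiber x →+ E.fiber x, (∀ x v w, ψ.toDual x (T x v) w = φ.toDual x v w) ∧
      (∀ x (b : 𝒜.fiber x) v, T x (b • v) = twist s h x b • T x v) ∧
      (∀ x v, T (bar x) (E.conj x v) = E.conj x (T x v)) ∧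
      (∀ x, Function.Bijective (T x)) ∧ ContinuousEnd E fun x => T x := by
  have h1 : ∀ x v w, ψ.toDual x (ψ.toPosForm.repr ψ.nondegenerate φ.toDual x v) w =
      φ.toDual x v w := fun x v w =>
    LinearMap.congr_fun (ψ.toPosForm.form_repr ψ.nondegenerate φ.toDual x v) w
  refine ⟨ψ.toPosForm.repr ψ.nondegenerate φ.toDual, h1, fun x b v => ?_, fun x v => ?_,
    fun x => ?_, ψ.toPosForm.continuous_repr K.isCStar ψ.nondegenerate φ.continuous_form⟩
  · refine ψ.ext_form fun w => ?_
    rw [h1, ψ.toDual_smul, h1, φ.toDual_smul, star_twist]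
  · refine ψ.ext_form fun w => ?_
    obtain ⟨w, rfl⟩ := (E.conj_bijective x).2 w
    rw [h1, φ.map_conj, ψ.map_conj, h1]
  · exact (AddEquiv.ofBijective _ (ψ.nondegenerate x)).symm.bijective.comp (φ.bijective x)

/-- The symmetry of a form in terms of the endomorphism representing it. -/
theorem form_repr_apply (ψ : Metric h E) (φ : SymForm s ε E) {x : X}
    {T : E.fiber x →+ E.fiber x} (hT : ∀ v w, ψ.toDual x (T v) w = φ.toDual x v w)
    (v w : E.fiber x) :
    ψ.toDual x (T v) w = (ε : ℤ) • twist s h x (ψ.toDual x v (T w)) := by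
  rw [hT, φ.symm x w v, ← hT, ← ψ.star_form v (T w), ← K.comm]
  rfl

/-- Every form is obtained from a metric and an action of `j`. If a metric `ψ₀` represents the
form by `T`, then `S = ε T²` is positive, and with `U = √S` the metric `ψ₀(U v, w)` represents the
form by `J = U⁻¹ T`, which satisfies `J² = ε`. -/
theorem exists_metric_jStructure [T2Space X] [ParacompactSpace X] (φ : SymForm s ε E) :
    ∃ (ψ : Metric h E) (𝒥 : JStructure s h ε E),
      ∀ x v w, φ.toDual x v w = ψ.toDual x (𝒥.J x v) w := by
  have he := K.isCStar
  obtain ⟨ψ₀⟩ := exists_metric he E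
  obtain ⟨T, hT, hTs, hTc, hTb, hTcont⟩ := K.exists_repr ψ₀ φ
  have hT' : ∀ x v w, ψ₀.toDual x (T x v) w = (ε : ℤ) • twist s h x (ψ₀.toDual x v (T x w)) :=
    fun x => K.form_repr_apply ψ₀ φ (hT x)
  let S : ∀ x, E.fiber x →ₗ[𝒜.fiber x] E.fiber x := fun x =>
    { toFun := fun v => (ε : ℤ) • T x (T x v)
      map_add' := fun v w => by simp
      map_smul' := fun b v => by rw [hTs, hTs, K.twist_twist, RingHom.id_apply, smul_comm] }
  have hS : ∀ x v, S x v = (ε : ℤ) • T x (T x v) := fun _ _ => rfl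
  have hST : ∀ x v, S x (T x v) = T x (S x v) := fun x v => by rw [hS, hS, map_zsmul]
  have hTS : ∀ x v, T x (T x v) = (ε : ℤ) • S x v := fun x v => by rw [hS, zsmul_zsmul K]
  have hSpos : ∀ x v, h.IsNonneg x (ψ₀.toDual x (S x v) v) := fun x v => by
    rw [hS, map_zsmul, LinearMap.smul_apply, hT', zsmul_zsmul K]
    exact K.isNonneg_twist (ψ₀.pos x _)
  obtain ⟨U, hUc, hUU, hUpos, -⟩ := ψ₀.toPosForm.exists_sqrt he ψ₀.nondegenerate
    (S := S) (ContinuousEnd.comp (continuousEnd_zsmul e E _) (hTcont.comp hTcont)) hSpos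
  have hUadj : ∀ x v w, ψ₀.toDual x (U x v) w = ψ₀.toDual x v (U x w) := fun x =>
    ψ₀.selfAdjoint he (hUpos x)
  have hUconj : ∀ x v, U (bar x) (E.conj x v) = E.conj x (U x v) :=
    ψ₀.comm_conj_of_sq he hUpos fun x v => by
      rw [hUU, hUU, hS, hS, hTc, hTc, map_zsmul]
  -- `U` commutes with `T`: the positive operators `ε T U T` and `U³` have the same square `S³`.
  have hUT : ∀ x v, U x (T x v) = T x (U x v) := by
    intro x v
    let P : E.fiber x →ₗ[𝒜.fiber x] E.fiber x :=
      { toFun := fun v => (ε : ℤ) • T x (U x (T x v))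
        map_add' := fun v w => by simp
        map_smul' := fun b v => by
          rw [hTs, map_smul, hTs, K.twist_twist, RingHom.id_apply, smul_comm] }
    have hP : ∀ v, P v = (ε : ℤ) • T x (U x (T x v)) := fun _ => rfl
    have hUS : ∀ v, U x (S x v) = S x (U x v) := fun v => by rw [← hUU, ← hUU]
    have h1 : P = U x ∘ₗ S x := by
      refine ψ₀.eq_of_sq he (fun v => ?_) (fun v => ?_) fun v => ?_
      · rw [hP, map_zsmul, LinearMap.smul_apply, hT', zsmul_zsmul K]
        exact K.isNonneg_twist (hUpos x _)
      · rw [LinearMap.comp_apply, ← hUU, hUadj]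
        exact hUpos x _
      · rw [hP, hP, map_zsmul, map_zsmul, map_zsmul, zsmul_zsmul K, hTS, map_zsmul, map_zsmul,
          hUS, hUU, LinearMap.comp_apply, LinearMap.comp_apply, hUS, hUU, ← hST, ← hST, hTS,
          map_zsmul, map_zsmul, zsmul_zsmul K]
    obtain ⟨w, rfl⟩ := (hTb x).2 v
    have h2 := congrArg (fun V : E.fiber x →ₗ[𝒜.fiber x] E.fiber x => (ε : ℤ) • V w) h1
    simp only [LinearMap.comp_apply, hP, zsmul_zsmul K] at h2
    rw [h2, hS, map_zsmul, zsmul_zsmul K]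
  have hUb : ∀ x, Function.Bijective (U x) := fun x => by
    have h1 : Function.Bijective fun v => U x (U x v) := by
      have h2 : (fun v => U x (U x v)) = fun v => T x (T x ((ε : ℤ) • v)) := by
        ext v
        rw [hUU, hS, map_zsmul, map_zsmul]
      rw [h2]
      refine (hTb x).comp ((hTb x).comp ?_)
      exact ⟨fun v w hvw => by simpa [zsmul_zsmul K] using congrArg ((ε : ℤ) • ·) hvw,
        fun v => ⟨(ε : ℤ) • v, zsmul_zsmul K v⟩⟩
    exact ⟨fun v w hvw => h1.1 (congrArg (U x) hvw), fun v => by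
      obtain ⟨w, hw⟩ := h1.2 v
      exact ⟨_, hw⟩⟩
  let B : PosForm h E :=
    { form := fun x => (ψ₀.toDual x).comp (U x : E.fiber x →+ E.fiber x)
      form_smul := fun x a v w => by
        change ψ₀.toDual x (U x (a • v)) w = ψ₀.toDual x (U x v) w * _
        rw [map_smul, ψ₀.toDual_smul]
      pos := hUpos
      continuous_form := ContinuousForm.comp (B := ψ₀.toDual) ψ₀.continuous_form
        (hUc.comp continuous_tot_fst) continuous_tot_snd }
  have hB : ∀ x v w, B.form x v w = ψ₀.toDual x (U x v) w := fun _ _ _ => rfl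
  let ψ : Metric h E := B.toMetric he (fun x => (ψ₀.bijective x).comp (hUb x)) fun x v w => by
    rw [hB, hB, hUconj, ψ₀.map_conj]
  have hψ : ∀ x v w, ψ.toDual x v w = ψ₀.toDual x (U x v) w := fun _ _ _ => rfl
  obtain ⟨J, hJ, hJs, hJc, -, hJcont⟩ := K.exists_repr ψ φ
  have hUJ : ∀ x v, U x (J x v) = T x v := fun x v =>
    ψ₀.ext_form fun w => by rw [← hψ, hJ, hT]
  refine ⟨ψ, ⟨J, hJs, fun x v => ?_, hJc, hJcont⟩, fun x v w => (hJ x v w).symm⟩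
  apply (hUb x).1
  apply (hUb x).1
  rw [hUJ, hUT, hUJ, hTS, map_zsmul, map_zsmul, hUU]

/-- With respect to a metric through which `j` induces a symmetric form, `j` is isometric up to
the twist. -/
theorem form_J_J {ψ : Metric h E} {𝒥 : JStructure s h ε E} {φ : SymForm s ε E}
    (H : ∀ x v w, φ.toDual x v w = ψ.toDual x (𝒥.J x v) w) (x : X) (v w : E.fiber x) :
    ψ.toDual x (𝒥.J x v) (𝒥.J x w) = twist s h x (ψ.toDual x v w) := by
  rw [K.form_repr_apply ψ φ (fun v w => (H x v w).symm), 𝒥.sq, map_zsmul, map_zsmul,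
    zsmul_zsmul K]

/-- Every action of `j` is isometric up to the twist for some metric, obtained from an arbitrary
metric by averaging over the action of `j`. -/
theorem exists_compatible_metric [T2Space X] [ParacompactSpace X] (𝒥 : JStructure s h ε E) :
    ∃ ψ : Metric h E, ∀ x v w,
      ψ.toDual x (𝒥.J x v) (𝒥.J x w) = twist s h x (ψ.toDual x v w) := by
  have he := K.isCStar
  obtain ⟨ψ₀⟩ := exists_metric he E
  let B' : ∀ x, E.fiber x →+ (E.fiber x →ₗ[𝒜.fiber x] 𝒜.fiber x) := fun x =>
    { toFun := fun v =>
        { toFun := fun w => twist s h x (ψ₀.toDual x (𝒥.J x v) (𝒥.J x w))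
          map_add' := fun w w' => by simp
          map_smul' := fun a w => by
            rw [𝒥.smul, map_smul, smul_eq_mul, map_mul, K.twist_twist]
            rfl }
      map_zero' := LinearMap.ext fun w => by simp
      map_add' := fun v v' => LinearMap.ext fun w => by simp }
  have hB' : ∀ x v w, B' x v w = twist s h x (ψ₀.toDual x (𝒥.J x v) (𝒥.J x w)) :=
    fun _ _ _ => rfl
  have hpos : ∀ x v, h.IsNonneg x (B' x v v) := fun x v => K.isNonneg_twist (ψ₀.pos x _)
  have hcont : ContinuousForm E B' :=
    h.continuous_star.comp (s.continuous_star.comp (ContinuousForm.comp (B := ψ₀.toDual)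
      ψ₀.continuous_form (𝒥.continuous_J.comp continuous_tot_fst)
      (𝒥.continuous_J.comp continuous_tot_snd)))
  let B : PosForm h E :=
    { form := fun x => ψ₀.toDual x + B' x
      form_smul := fun x a v w => by
        rw [AddMonoidHom.add_apply, LinearMap.add_apply, AddMonoidHom.add_apply,
          LinearMap.add_apply, add_mul, ψ₀.toDual_smul, hB', hB', 𝒥.smul, ψ₀.toDual_smul,
          map_mul, star_twist, twist_apply s h x (s.star x a), s.star_star]
      pos := fun x v => IsNonneg.add he (ψ₀.pos x v) (hpos x v)
      continuous_form := ContinuousForm.add (B := ψ₀.toDual) ψ₀.continuous_form hcont }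
  have hB : ∀ x v w, B.form x v w =
      ψ₀.toDual x v w + twist s h x (ψ₀.toDual x (𝒥.J x v) (𝒥.J x w)) := fun _ _ _ => rfl
  have hnd : B.Nondegenerate := PosForm.Nondegenerate.of_add he (B := ψ₀.toPosForm)
    ψ₀.nondegenerate B fun x v => ⟨_, hpos x v, rfl⟩
  refine ⟨B.toMetric he hnd fun x v w => ?_, fun x v w => ?_⟩
  · rw [hB, hB, 𝒥.conj, 𝒥.conj, ψ₀.map_conj, ψ₀.map_conj, twist_conj, map_add]
  · change B.form x _ _ = twist s h x (B.form x v w)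
    rw [hB, hB, 𝒥.sq, 𝒥.sq, map_add, K.twist_twist, add_comm]
    simp only [map_zsmul, LinearMap.smul_apply, zsmul_zsmul K]

/-- The form defined by a metric and a compatible action of `j`. -/
def symForm (ψ : Metric h E) (𝒥 : JStructure s h ε E)
    (H : ∀ x v w, ψ.toDual x (𝒥.J x v) (𝒥.J x w) = twist s h x (ψ.toDual x v w)) :
    SymForm s ε E where
  toDual x := (ψ.toDual x).comp (𝒥.J x)
  toDual_smul x a v w := by
    change ψ.toDual x (𝒥.J x (a • v)) w = ψ.toDual x (𝒥.J x v) w * _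
    rw [𝒥.smul, ψ.toDual_smul, star_twist]
  bijective x := (ψ.bijective x).comp
    ⟨fun v w hvw => by simpa [𝒥.sq, zsmul_zsmul K] using congrArg (fun z => (ε : ℤ) • 𝒥.J x z) hvw,
      fun v => ⟨(ε : ℤ) • 𝒥.J x v, by rw [map_zsmul, 𝒥.sq, zsmul_zsmul K]⟩⟩
  symm x v w := by
    change ψ.toDual x (𝒥.J x w) v = (ε : ℤ) • s.star x (ψ.toDual x (𝒥.J x v) w)
    have h1 := H x v (𝒥.J x w)
    rw [𝒥.sq, map_zsmul] at h1
    rw [← map_zsmul, h1, K.star_s_twist, ψ.star_form]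
  map_conj x v w := by
    change ψ.toDual (bar x) (𝒥.J (bar x) (E.conj x v)) (E.conj x w) =
      𝒜.conj x (ψ.toDual x (𝒥.J x v) w)
    rw [𝒥.conj, ψ.map_conj]
  continuous_form := ContinuousForm.comp (B := ψ.toDual) ψ.continuous_form
    (𝒥.continuous_J.comp continuous_tot_fst) continuous_tot_snd

/-- The action of `j` is determined by the form, up to isomorphism: if `R = U²` is the positive
endomorphism relating the two metrics, then `U` intertwines the two actions. -/
theorem exists_iso_of_form_eq {φ : SymForm s ε E} {ψ ψ' : Metric h E}
    {𝒥 𝒥' : JStructure s h ε E} (H : ∀ x v w, φ.toDual x v w = ψ.toDual x (𝒥.J x v) w)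
    (H' : ∀ x v w, φ.toDual x v w = ψ'.toDual x (𝒥'.J x v) w) :
    ∃ f : E.Iso E, ∀ x v, f.equiv x (𝒥'.J x v) = 𝒥.J x (f.equiv x v) := by
  have he := K.isCStar
  obtain ⟨f, hpos, hf⟩ := Metric.exists_iso he ψ ψ'
  refine ⟨f, fun x => ?_⟩
  let U : E.fiber x →ₗ[𝒜.fiber x] E.fiber x := f.equiv x
  let J := 𝒥.J x
  let J' := 𝒥'.J x
  have hUpos : ∀ v, h.IsNonneg x (ψ.toDual x (U v) v) := hpos x
  have hJJ : ∀ v, J (J v) = (ε : ℤ) • v := 𝒥.sq x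
  have hJJ' : ∀ v, J' (J' v) = (ε : ℤ) • v := 𝒥'.sq x
  have hJtw : ∀ v w, ψ.toDual x (J v) w = (ε : ℤ) • twist s h x (ψ.toDual x v (J w)) :=
    K.form_repr_apply ψ φ fun v w => (H x v w).symm
  -- With `R = U²` one has `R J' = J`, hence `J' = J R`.
  have h1 : ∀ v, U (U (J' v)) = J v := fun v => ψ.ext_form fun w => by
    rw [← H, H']
    exact hf x _ w
  have h2 : ∀ v, J (U (U v)) = J' v := fun v => by
    have h3 := h1 (J' v)
    rw [hJJ', map_zsmul, map_zsmul] at h3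
    rw [← zsmul_zsmul K (U (U v)), h3, map_zsmul, hJJ, zsmul_zsmul K]
  let P : E.fiber x →ₗ[𝒜.fiber x] E.fiber x :=
    { toFun := fun v => (ε : ℤ) • J (U (J v))
      map_add' := fun v w => by simp
      map_smul' := fun b v => by
        rw [𝒥.smul, map_smul, 𝒥.smul, K.twist_twist, RingHom.id_apply, smul_comm] }
  have hP : ∀ v, P v = (ε : ℤ) • J (U (J v)) := fun _ => rfl
  have hPpos : ∀ v, h.IsNonneg x (ψ.toDual x (P v) v) := fun v => by
    rw [hP, map_zsmul, LinearMap.smul_apply, hJtw, zsmul_zsmul K]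
    exact K.isNonneg_twist (hUpos _)
  have hPP : ∀ v, P (P v) = (ε : ℤ) • J (U (U (J v))) := fun v => by
    rw [hP, hP, map_zsmul, map_zsmul, map_zsmul, hJJ, map_zsmul, map_zsmul, zsmul_zsmul K]
  have hPR : ∀ v, P (P (U (U v))) = v := fun v => by
    rw [hPP, h2 v, h1, hJJ, zsmul_zsmul K]
  have hRP : ∀ v, U (U (P (P v))) = v := fun v => by
    rw [hPP, h2, map_zsmul, map_zsmul, h1, hJJ, zsmul_zsmul K]
  -- `P² = R⁻¹`, so `P R` is a positive square root of `R`.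
  have hcomm : ∀ v, P (U (U v)) = U (U (P v)) := fun v => by
    rw [← hRP (P (U (U v))), hPR]
  have key : P ∘ₗ U ∘ₗ U = U := by
    refine ψ.eq_of_sq he (fun v => ?_) hUpos fun v => ?_
    · have h3 := hPpos (P (U (U v)))
      rw [ψ.selfAdjoint he hPpos, hPR] at h3
      exact h3
    · simp only [LinearMap.comp_apply]
      rw [hcomm (P (U (U v))), hPR]
  intro v
  have h3 := LinearMap.congr_fun key v
  simp only [LinearMap.comp_apply, hP] at h3
  have h4 := congrArg (fun z => J z) h3
  simp only [map_zsmul, hJJ, zsmul_zsmul K, h2] at h4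
  exact h4

/-- The form is determined by the action of `j`, up to isometry: the positive automorphism relating
two metrics compatible with `j` commutes with `j`. -/
theorem exists_isometry_of_J_eq {ψ ψ' : Metric h E} {𝒥 : JStructure s h ε E}
    (H : ∀ x v w, ψ.toDual x (𝒥.J x v) (𝒥.J x w) = twist s h x (ψ.toDual x v w))
    (H' : ∀ x v w, ψ'.toDual x (𝒥.J x v) (𝒥.J x w) = twist s h x (ψ'.toDual x v w)) :
    ∃ f : E.Iso E, (∀ x v, f.equiv x (𝒥.J x v) = 𝒥.J x (f.equiv x v)) ∧
      ∀ x v w, ψ.toDual x (f.equiv x v) (f.equiv x w) = ψ'.toDual x v w := by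
  have he := K.isCStar
  obtain ⟨f, hpos, hf⟩ := Metric.exists_iso he ψ ψ'
  refine ⟨f, fun x => ?_, fun x v w => ?_⟩
  · let U : E.fiber x →ₗ[𝒜.fiber x] E.fiber x := f.equiv x
    let J := 𝒥.J x
    have hUpos : ∀ v, h.IsNonneg x (ψ.toDual x (U v) v) := hpos x
    have hUU : ∀ v w, ψ.toDual x (U (U v)) w = ψ'.toDual x v w := hf x
    have hJJ : ∀ v, J (J v) = (ε : ℤ) • v := 𝒥.sq x
    have hJtw : ∀ v w, ψ.toDual x (J v) w = (ε : ℤ) • twist s h x (ψ.toDual x v (J w)) :=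
      fun v w => by
        rw [← H, ← map_zsmul]
        change _ = ψ.toDual x (J v) ((ε : ℤ) • J (J w))
        rw [hJJ, zsmul_zsmul K]
    have h1 : ∀ v, U (U (J v)) = J (U (U v)) := fun v => ψ.ext_form fun w => by
      rw [hUU, hJtw, hUU, ← H', ← map_zsmul]
      change _ = ψ'.toDual x (J v) ((ε : ℤ) • J (J w))
      rw [hJJ, zsmul_zsmul K]
    let P : E.fiber x →ₗ[𝒜.fiber x] E.fiber x :=
      { toFun := fun v => (ε : ℤ) • J (U (J v))
        map_add' := fun v w => by simp
        map_smul' := fun b v => by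
          rw [𝒥.smul, map_smul, 𝒥.smul, K.twist_twist, RingHom.id_apply, smul_comm] }
    have hP : ∀ v, P v = (ε : ℤ) • J (U (J v)) := fun _ => rfl
    -- `U` and its conjugate `P` by `j` are positive with the same square.
    have key : P = U := by
      refine ψ.eq_of_sq he (fun v => ?_) hUpos fun v => ?_
      · rw [hP, map_zsmul, LinearMap.smul_apply, hJtw, zsmul_zsmul K]
        exact K.isNonneg_twist (hUpos _)
      · rw [hP, hP, map_zsmul, map_zsmul, map_zsmul, hJJ, map_zsmul, map_zsmul, zsmul_zsmul K,
          ← h1, hJJ, map_zsmul, map_zsmul, zsmul_zsmul K]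
    intro v
    have h3 := congrArg (fun z => J z) (LinearMap.congr_fun key v)
    simp only [hP, map_zsmul, hJJ, zsmul_zsmul K] at h3
    exact h3
  · rw [← hf x v w]
    exact (ψ.selfAdjoint he (U := (f.equiv x : E.fiber x →ₗ[𝒜.fiber x] E.fiber x))
      (hpos x) _ _).symm

end JData

end JForms

/-! ### Isomorphisms of Grothendieck groups -/

section Grothendieck

variable {M N : Type*} [AddCommMonoid M] [AddCommMonoid N]

open Algebra.GrothendieckAddGroup in
/-- An additive relation between commutative monoids which is a bijection induces a unique
isomorphism of Grothendieck groups. -/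
theorem existsUnique_addEquiv_of_rel (r : M → N → Prop) (hr : ∀ m, ∃ n, r m n)
    (hl : ∀ n, ∃ m, r m n) (hr' : ∀ {m n n'}, r m n → r m n' → n = n')
    (hl' : ∀ {m m' n}, r m n → r m' n → m = m')
    (hadd : ∀ {m m' n n'}, r m n → r m' n' → r (m + m') (n + n')) :
    ∃! Φ : Algebra.GrothendieckAddGroup M ≃+ Algebra.GrothendieckAddGroup N,
      ∀ m n, r m n → Φ (of m) = of n := by
  choose f hf using hr
  choose g hg using hl
  have hfr : ∀ {m n}, r m n → f m = n := fun h => hr' (hf _) h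
  have hgr : ∀ {m n}, r m n → g n = m := fun h => hl' (hg _) h
  let f' : M ≃+ N :=
    { toFun := f
      invFun := g
      left_inv := fun m => hgr (hf m)
      right_inv := fun n => hfr (hg n)
      map_add' := fun m m' => hfr (hadd (hf m) (hf m')) }
  let F : Algebra.GrothendieckAddGroup M →+ Algebra.GrothendieckAddGroup N :=
    lift (of.comp (f' : M →+ N))
  let G : Algebra.GrothendieckAddGroup N →+ Algebra.GrothendieckAddGroup M :=
    lift (of.comp (f'.symm : N →+ M))
  have hF : ∀ m, F (of m) = of (f' m) := fun m =>
    DFunLike.congr_fun (lift.symm_apply_apply (of.comp (f' : M →+ N))) m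
  have hG : ∀ n, G (of n) = of (f'.symm n) := fun n =>
    DFunLike.congr_fun (lift.symm_apply_apply (of.comp (f'.symm : N →+ M))) n
  have hGF : G.comp F = AddMonoidHom.id _ := lift.symm.injective (AddMonoidHom.ext fun m => by
    change G (F (of m)) = of m
    rw [hF, hG, AddEquiv.symm_apply_apply])
  have hFG : F.comp G = AddMonoidHom.id _ := lift.symm.injective (AddMonoidHom.ext fun n => by
    change F (G (of n)) = of n
    rw [hG, hF, AddEquiv.apply_symm_apply])
  refine ⟨F.toAddEquiv G hGF hFG, fun m n hmn => ?_, fun Ψ hΨ => ?_⟩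
  · change F (of m) = of n
    rw [hF]
    exact congrArg of (hfr hmn)
  · have h1 : (Ψ : _ →+ Algebra.GrothendieckAddGroup N) = F :=
      lift.symm.injective (AddMonoidHom.ext fun m => by
        change Ψ (of m) = F (of m)
        rw [hF]
        exact hΨ m _ (hf m))
    exact AddEquiv.ext fun z => DFunLike.congr_fun h1 z

end Grothendieck

/-! ### The correspondence between forms and `𝒟`-bundles -/

section Corr

variable {X : Type u} [TopologicalSpace X] [InvolutiveSpace X]
  {C : Type v} [Ring C] [Algebra ℝ C] [TopologicalSpace C]
  {D : Type v} [Ring D] [Algebra ℝ D] [TopologicalSpace D]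
  {R : Type*} [CStarAlgebra R] [PartialOrder R] [StarOrderedRing R]
  {𝒜 : RealAlgebraBundle X C} {𝒟 : RealAlgebraBundle X D}
  {e : C ≃A[ℝ] R} {s h : AntiInvolution 𝒜} {ε : ℤˣ} {E E' : RealBundle 𝒜}

/-- The pull-back of an action of `j` under an isomorphism. -/
def JStructure.congr (f : E.Iso E') (𝒥 : JStructure s h ε E') : JStructure s h ε E where
  J x := (((f.equiv x).symm : _ →+ E.fiber x).comp (𝒥.J x)).comp (f.equiv x : E.fiber x →+ _)
  smul x b v := by simp [𝒥.smul]
  sq x v := by simp [𝒥.sq]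
  conj x v := by
    simp only [AddMonoidHom.comp_apply, AddMonoidHom.coe_coe]
    rw [f.map_conj, 𝒥.conj]
    exact f.symm.map_conj _ _
  continuous_J := by
    exact f.continuous_invFun.comp (𝒥.continuous_J.comp f.continuous_toFun)

theorem JStructure.apply_congr (f : E.Iso E') (𝒥 : JStructure s h ε E') (x : X)
    (v : E.fiber x) : f.equiv x ((𝒥.congr f).J x v) = 𝒥.J x (f.equiv x v) :=
  (f.equiv x).apply_symm_apply _

namespace JData

variable (K : JData e s h ε 𝒟)

/-- Isomorphisms commuting with the action of `j` are `𝒟`-linear. -/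
def extendIso {𝒥 : JStructure s h ε E} {𝒥' : JStructure s h ε E'} (f : E.Iso E')
    (hf : ∀ x v, f.equiv x (𝒥.J x v) = 𝒥'.J x (f.equiv x v)) :
    (K.extend E 𝒥).Iso (K.extend E' 𝒥') where
  equiv x :=
    { (f.equiv x).toAddEquiv with
      map_smul' := fun d (v : E.fiber x) => by
        change f.equiv x ((K.ext x).α d • v + (K.ext x).β d • 𝒥.J x v) =
          (K.ext x).α d • f.equiv x v + (K.ext x).β d • 𝒥'.J x (f.equiv x v)
        rw [map_add, map_smul, map_smul, hf] }
  continuous_toFun := f.continuous_toFun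
  continuous_invFun := f.continuous_invFun
  map_conj := f.map_conj

/-- The isomorphism of `𝒜`-bundles underlying an isomorphism of `𝒟`-bundles. -/
def ofExtendIso {𝒥 : JStructure s h ε E} {𝒥' : JStructure s h ε E'}
    (f : (K.extend E 𝒥).Iso (K.extend E' 𝒥')) : E.Iso E' where
  equiv x :=
    { (f.equiv x).toAddEquiv with
      map_smul' := fun b v =>
        (congrArg (f.equiv x) (K.extend_ι_smul E 𝒥 x b v).symm).trans
          (((f.equiv x).map_smul _ _).trans (K.extend_ι_smul E' 𝒥' x b _)) }
  continuous_toFun := f.continuous_toFun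
  continuous_invFun := f.continuous_invFun
  map_conj := f.map_conj

theorem ofExtendIso_J {𝒥 : JStructure s h ε E} {𝒥' : JStructure s h ε E'}
    (f : (K.extend E 𝒥).Iso (K.extend E' 𝒥')) (x : X) (v : E.fiber x) :
    (K.ofExtendIso f).equiv x (𝒥.J x v) = 𝒥'.J x ((K.ofExtendIso f).equiv x v) :=
  (congrArg (f.equiv x) (K.extend_j_smul E 𝒥 x v).symm).trans
    (((f.equiv x).map_smul _ _).trans (K.extend_j_smul E' 𝒥' x _))

theorem continuous_j_smul (F : RealBundle 𝒟) :
    Continuous fun p : Tot F.fiber => (⟨p.proj, (K.ext p.proj).j • p.snd⟩ : Tot F.fiber) := by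
  have := isTopologicalRing_of_equiv e
  have hmul : Continuous fun d : D => K.model.j * d := by
    refine (K.continuous_mk.comp ((continuous_const.mul (K.continuous_σ.comp K.continuous_β)).prodMk
      (K.continuous_σ.comp K.continuous_α)) :
        Continuous fun d : D => K.model.ι (((ε : ℤ) : C) * K.σ (K.model.β d)) +
          K.model.ι (K.σ (K.model.α d)) * K.model.j).congr fun d => ?_
    rw [K.model.mul_eq]
    simp
  refine continuous_of_locally F.continuous_proj fun x => ?_
  obtain ⟨N, c, hx⟩ := F.exists_chart x
  refine ⟨c.base, c.isOpen_base, hx, ?_⟩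
  have h1 : Continuous fun m : N.carrier => N.retr (K.model.j • N.incl m) :=
    N.retr.continuous.comp (continuous_pi fun k =>
      hmul.comp ((continuous_apply k).comp N.incl.continuous))
  refine (c.continuous_symm.comp (((F.continuous_proj.comp continuous_subtype_val).subtype_mk
    fun p => p.2).prodMk (h1.comp c.continuous_iso))).congr fun p =>
      congrArg (Bundle.TotalSpace.mk _) ?_
  change (c.iso ⟨p.1.proj, p.2⟩).symm (N.retr (K.model.j • N.incl (c.iso ⟨p.1.proj, p.2⟩ p.1.snd)))
    = _
  rw [AddEquiv.symm_apply_eq, c.iso_smul, K.chart_j, map_smul, N.retr_incl]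

/-- The action of `j` on the restriction of a `𝒟`-bundle to `𝒜`. -/
def restrictJ (F : RealBundle 𝒟) : JStructure s h ε (K.restrict F) where
  J x := DistribSMul.toAddMonoidHom (F.fiber x) (K.ext x).j
  smul x b (v : F.fiber x) := by
    change (K.ext x).j • (K.ext x).ι b • v = (K.ext x).ι (twist s h x b) • (K.ext x).j • v
    rw [smul_smul, (K.ext x).j_mul, mul_smul]
  sq x (v : F.fiber x) := by
    change (K.ext x).j • (K.ext x).j • v = (ε : ℤ) • v
    rw [smul_smul, (K.ext x).j_mul_j, Int.cast_smul_eq_zsmul]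
  conj x (v : F.fiber x) := by
    change (K.ext (bar x)).j • F.conj x v = F.conj x ((K.ext x).j • v)
    rw [F.conj_smul, K.conj_j]
  continuous_J := K.continuous_j_smul F

/-- The form `E` and the `𝒟`-bundle `F` correspond: up to an isomorphism `u`, the bundle of `E` is
the restriction of `F`, and its form is `φ(v, w) = ψ(j v, w)` for some metric `ψ`. -/
def Corresponds (E : SymBundle s ε) (F : RealBundle 𝒟) : Prop :=
  ∃ (u : ∀ x, E.bundle.fiber x ≃+ F.fiber x) (ψ : Metric h E.bundle),
    Continuous (fun p : Tot E.bundle.fiber => (⟨p.proj, u p.proj p.snd⟩ : Tot F.fiber)) ∧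
    Continuous (fun p : Tot F.fiber => (⟨p.proj, (u p.proj).symm p.snd⟩ : Tot E.bundle.fiber)) ∧
    (∀ x v, u (bar x) (E.bundle.conj x v) = F.conj x (u x v)) ∧
    (∀ x (b : 𝒜.fiber x) v, u x (b • v) = (K.ext x).ι b • u x v) ∧
    (∀ x v w, E.form.toDual x v w = ψ.toDual x ((u x).symm ((K.ext x).j • u x v)) w)

/-- The correspondence in terms of metrics and actions of `j` on the bundle of the form. -/
theorem corresponds_iff (E : SymBundle s ε) (F : RealBundle 𝒟) :
    K.Corresponds E F ↔ ∃ (ψ : Metric h E.bundle) (𝒥 : JStructure s h ε E.bundle),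
      (∀ x v w, E.form.toDual x v w = ψ.toDual x (𝒥.J x v) w) ∧
        Nonempty ((K.extend E.bundle 𝒥).Iso F) := by
  constructor
  · rintro ⟨u, ψ, hu, hu', hc, hs, hφ⟩
    let f : E.bundle.Iso (K.restrict F) :=
      { equiv := fun x => { u x with map_smul' := hs x }
        continuous_toFun := hu
        continuous_invFun := hu'
        map_conj := hc }
    refine ⟨ψ, (K.restrictJ F).congr f, hφ, ⟨{
      equiv := fun x =>
        { u x with
          map_smul' := fun d (v : E.bundle.fiber x) => ?_ }
      continuous_toFun := hu
      continuous_invFun := hu'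
      map_conj := hc }⟩⟩
    have h1 : ∀ v, u x (((K.restrictJ F).congr f).J x v) = (K.ext x).j • u x v := fun v =>
      (u x).apply_symm_apply _
    change u x ((K.ext x).α d • v +
      (K.ext x).β d • ((K.restrictJ F).congr f).J x v) = d • u x v
    rw [map_add, hs, hs, h1, smul_smul, ← add_smul, ← (K.ext x).eq]
  · rintro ⟨ψ, 𝒥, hφ, ⟨f⟩⟩
    refine ⟨fun x => (f.equiv x).toAddEquiv, ψ, f.continuous_toFun, f.continuous_invFun, f.map_conj,
      fun x b v => (congrArg (f.equiv x) (K.extend_ι_smul E.bundle 𝒥 x b v).symm).trans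
        ((f.equiv x).map_smul _ _), fun x v w => ?_⟩
    have h1 : f.equiv x (𝒥.J x v) = (K.ext x).j • f.equiv x v :=
      (congrArg (f.equiv x) (K.extend_j_smul E.bundle 𝒥 x v).symm).trans ((f.equiv x).map_smul _ _)
    rw [hφ]
    exact congrArg (fun z => ψ.toDual x z w) ((f.equiv x).symm_apply_eq.2 h1.symm).symm

theorem exists_corresponds_right [T2Space X] [ParacompactSpace X] (E : SymBundle s ε) :
    ∃ F : RealBundle 𝒟, K.Corresponds E F := by
  obtain ⟨ψ, 𝒥, H⟩ := K.exists_metric_jStructure E.form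
  exact ⟨K.extend E.bundle 𝒥, (K.corresponds_iff _ _).2 ⟨ψ, 𝒥, H, ⟨.refl _⟩⟩⟩

theorem exists_corresponds_left [T2Space X] [ParacompactSpace X] (F : RealBundle 𝒟) :
    ∃ E : SymBundle s ε, K.Corresponds E F := by
  obtain ⟨ψ, H⟩ := K.exists_compatible_metric (K.restrictJ F)
  exact ⟨⟨K.restrict F, K.symForm ψ (K.restrictJ F) H⟩, fun x => AddEquiv.refl _, ψ,
    continuous_id, continuous_id, fun _ _ => rfl, fun _ _ _ => rfl, fun _ _ _ => rfl⟩

/-- Up to isomorphism, the `𝒟`-bundle is determined by the form. -/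
theorem Corresponds.iso_of_isometry {E E' : SymBundle s ε} {F F' : RealBundle 𝒟}
    (hF : K.Corresponds E F) (hF' : K.Corresponds E' F') (f : E.Iso E') :
    Nonempty (F.Iso F') := by
  obtain ⟨ψ, 𝒥, H, ⟨k⟩⟩ := (K.corresponds_iff _ _).1 hF
  obtain ⟨ψ', 𝒥', H', ⟨k'⟩⟩ := (K.corresponds_iff _ _).1 hF'
  obtain ⟨g, hg⟩ := K.exists_iso_of_form_eq H (ψ' := ψ'.congr f.iso) (𝒥' := 𝒥'.congr f.iso)
    fun x v w => by
      rw [Metric.congr_apply, JStructure.apply_congr, ← H', f.isometry]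
  exact ⟨k.symm.trans ((K.extendIso g hg).symm.trans
    ((K.extendIso f.iso (𝒥'.apply_congr f.iso)).trans k'))⟩

/-- Up to isometry, the form is determined by the `𝒟`-bundle. -/
theorem Corresponds.isometry_of_iso {E E' : SymBundle s ε} {F F' : RealBundle 𝒟}
    (hF : K.Corresponds E F) (hF' : K.Corresponds E' F') (f : F.Iso F') :
    Nonempty (E.Iso E') := by
  obtain ⟨ψ, 𝒥, H, ⟨k⟩⟩ := (K.corresponds_iff _ _).1 hF
  obtain ⟨ψ', 𝒥', H', ⟨k'⟩⟩ := (K.corresponds_iff _ _).1 hF'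
  let g : E.bundle.Iso E'.bundle := K.ofExtendIso (k.trans (f.trans k'.symm))
  have hg : ∀ x v, g.equiv x (𝒥.J x v) = 𝒥'.J x (g.equiv x v) := K.ofExtendIso_J _
  obtain ⟨l, hl, hl'⟩ := K.exists_isometry_of_J_eq (K.form_J_J H) (ψ' := ψ'.congr g)
    fun x v w => by
      rw [Metric.congr_apply, Metric.congr_apply, hg, hg, K.form_J_J H']
  refine ⟨⟨l.symm.trans g, fun x v w => ?_⟩⟩
  obtain ⟨v, rfl⟩ := (l.equiv x).surjective v
  obtain ⟨w, rfl⟩ := (l.equiv x).surjective w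
  have h1 : ∀ v, (l.symm.trans g).equiv x (l.equiv x v) = g.equiv x v := fun v =>
    congrArg (g.equiv x) ((l.equiv x).symm_apply_apply v)
  rw [h1, h1, H, H', ← hg, ← hl, hl', Metric.congr_apply]

theorem Corresponds.sum {E E' : SymBundle s ε} {F F' : RealBundle 𝒟}
    (hF : K.Corresponds E F) (hF' : K.Corresponds E' F') :
    K.Corresponds (E.sum E') (F.sum F') := by
  obtain ⟨u, ψ, h1, h2, h3, h4, h5⟩ := hF
  obtain ⟨u', ψ', h1', h2', h3', h4', h5'⟩ := hF'
  refine ⟨fun x => (u x).prodCongr (u' x), ψ.sum K.isCStar ψ',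
    continuous_tot_prod.2 ⟨h1.comp continuous_tot_fst, h1'.comp continuous_tot_snd⟩,
    continuous_tot_prod.2 ⟨h2.comp continuous_tot_fst, h2'.comp continuous_tot_snd⟩,
    fun x v => Prod.ext (h3 x v.1) (h3' x v.2), fun x b v => Prod.ext (h4 x b v.1) (h4' x b v.2),
    fun x v w => congrArg₂ (· + ·) (h5 x v.1 w.1) (h5' x v.2 w.2)⟩

/-- The correspondence induces a unique isomorphism of Grothendieck groups. -/
theorem existsUnique_addEquiv [T2Space X] [ParacompactSpace X] :
    ∃! Φ : GR s ε ≃+ KR 𝒟, ∀ E F, K.Corresponds E F → Φ (GR.mk E) = KR.mk F := by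
  let r : SymBundle.IsoClass s ε → RealBundle.IsoClass 𝒟 → Prop := fun m n =>
    ∃ E F, K.Corresponds E F ∧ Quotient.mk (SymBundle.setoid s ε) E = m ∧
      Quotient.mk (RealBundle.setoid 𝒟) F = n
  obtain ⟨Φ, hΦ, hu⟩ := existsUnique_addEquiv_of_rel r
    (by
      rintro ⟨E⟩
      obtain ⟨F, hF⟩ := K.exists_corresponds_right E
      exact ⟨_, E, F, hF, rfl, rfl⟩)
    (by
      rintro ⟨F⟩
      obtain ⟨E, hE⟩ := K.exists_corresponds_left F
      exact ⟨_, E, F, hE, rfl, rfl⟩)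
    (by
      rintro _ _ _ ⟨E, F, hF, rfl, rfl⟩ ⟨E', F', hF', hEE', rfl⟩
      obtain ⟨f⟩ := Quotient.exact hEE'
      exact Quotient.sound (Corresponds.iso_of_isometry K hF hF' f.symm))
    (by
      rintro _ _ _ ⟨E, F, hF, rfl, rfl⟩ ⟨E', F', hF', rfl, hFF'⟩
      obtain ⟨f⟩ := Quotient.exact hFF'
      exact Quotient.sound (Corresponds.isometry_of_iso K hF hF' f.symm))
    (by
      rintro _ _ _ _ ⟨E, F, hF, rfl, rfl⟩ ⟨E', F', hF', rfl, rfl⟩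
      exact ⟨_, _, Corresponds.sum K hF hF', rfl, rfl⟩)
  refine ⟨Φ, fun E F hEF => hΦ _ _ ⟨E, F, hEF, rfl, rfl⟩, fun Ψ hΨ => hu Ψ ?_⟩
  rintro _ _ ⟨E, F, hEF, rfl, rfl⟩
  exact hΨ E F hEF

end JData

end Corr

/-! ### The complexification of a real `C*`-algebra -/

section Doubling

variable (H : Type v) [NormedAddCommGroup H] [InnerProductSpace ℝ H]

/-- The orthogonal sum of two copies of a Hilbert space, the underlying real Hilbert space of its
complexification. -/
def Doubled : Type v := WithLp 2 (H × H)

instance : NormedAddCommGroup (Doubled H) := inferInstanceAs (NormedAddCommGroup (WithLp 2 (H × H)))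

instance : InnerProductSpace ℝ (Doubled H) :=
  inferInstanceAs (InnerProductSpace ℝ (WithLp 2 (H × H)))

instance [CompleteSpace H] : CompleteSpace (Doubled H) :=
  inferInstanceAs (CompleteSpace (WithLp 2 (H × H)))

variable {H}

namespace Doubled

/-- The vector with components `x` and `y`. -/
def mk (x y : H) : Doubled H := WithLp.toLp 2 (x, y)

/-- The first component. -/
def fst (z : Doubled H) : H := WithLp.fst z

/-- The second component. -/
def snd (z : Doubled H) : H := WithLp.snd z

@[simp] theorem fst_mk (x y : H) : (mk x y).fst = x := rfl

@[simp] theorem snd_mk (x y : H) : (mk x y).snd = y := rfl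

theorem mk_add (x y x' y' : H) : mk x y + mk x' y' = mk (x + x') (y + y') := rfl

theorem smul_mk (r : ℝ) (x y : H) : r • mk x y = mk (r • x) (r • y) := rfl

@[simp] theorem fst_add (z w : Doubled H) : (z + w).fst = z.fst + w.fst := rfl

@[simp] theorem snd_add (z w : Doubled H) : (z + w).snd = z.snd + w.snd := rfl

@[simp] theorem fst_smul (r : ℝ) (z : Doubled H) : (r • z).fst = r • z.fst := rfl

@[simp] theorem snd_smul (r : ℝ) (z : Doubled H) : (r • z).snd = r • z.snd := rfl

theorem inner_eq (z w : Doubled H) :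
    inner ℝ z w = inner ℝ z.fst w.fst + inner ℝ z.snd w.snd := WithLp.prod_inner_apply z w

theorem norm_sq (z : Doubled H) : ‖z‖ ^ 2 = ‖z.fst‖ ^ 2 + ‖z.snd‖ ^ 2 :=
  WithLp.prod_norm_sq_eq_of_L2 (α := H) (β := H) z

theorem norm_fst_le (z : Doubled H) : ‖z.fst‖ ≤ ‖z‖ := by
  refine le_of_sq_le_sq ?_ (norm_nonneg z)
  rw [norm_sq]
  exact le_add_of_nonneg_right (sq_nonneg _)

theorem norm_snd_le (z : Doubled H) : ‖z.snd‖ ≤ ‖z‖ := by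
  refine le_of_sq_le_sq ?_ (norm_nonneg z)
  rw [norm_sq]
  exact le_add_of_nonneg_left (sq_nonneg _)

theorem norm_mk_zero (x : H) : ‖mk x 0‖ = ‖x‖ := by
  refine (pow_left_inj₀ (norm_nonneg _) (norm_nonneg _) two_ne_zero).1 ?_
  rw [norm_sq, fst_mk, snd_mk, norm_zero]
  simp

end Doubled

open Doubled

/-- The operator `a ⊕ a`. -/
def diagMap (a : H →L[ℝ] H) : Doubled H →L[ℝ] Doubled H :=
  LinearMap.mkContinuous
    { toFun := fun z => mk (a z.fst) (a z.snd)
      map_add' := fun z w => by simp [mk_add]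
      map_smul' := fun r z => by simp [smul_mk] } ‖a‖ fun z => by
    refine le_of_sq_le_sq ?_ (by positivity)
    rw [mul_pow, norm_sq, norm_sq z, mul_add, ← mul_pow, ← mul_pow]
    exact add_le_add (pow_le_pow_left₀ (norm_nonneg _) (a.le_opNorm _) 2)
      (pow_le_pow_left₀ (norm_nonneg _) (a.le_opNorm _) 2)

theorem norm_diagMap_le (a : H →L[ℝ] H) : ‖diagMap a‖ ≤ ‖a‖ :=
  LinearMap.mkContinuous_norm_le _ (norm_nonneg a) _

/-- The algebra homomorphism `a ↦ a ⊕ a`. -/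
def diagOp : (H →L[ℝ] H) →ₐ[ℝ] (Doubled H →L[ℝ] Doubled H) :=
  AlgHom.ofLinearMap
    { toFun := diagMap
      map_add' := fun _ _ => rfl
      map_smul' := fun _ _ => rfl } rfl fun _ _ => rfl

variable (H) in
/-- Multiplication by the imaginary unit. -/
def rotOp : Doubled H →L[ℝ] Doubled H :=
  LinearMap.mkContinuous
    { toFun := fun z => mk (-z.snd) z.fst
      map_add' := fun z w => by simp [mk_add, add_comm]
      map_smul' := fun r z => by simp [smul_mk] } 1 fun z => by
    refine le_of_sq_le_sq ?_ (by positivity)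
    rw [one_mul, norm_sq, norm_sq z, add_comm]
    exact (congrArg (_ + · ^ 2) (norm_neg _)).le

theorem norm_rotOp_le : ‖rotOp H‖ ≤ 1 := LinearMap.mkContinuous_norm_le _ zero_le_one _

theorem rotOp_mul_self : rotOp H * rotOp H = -1 :=
  ContinuousLinearMap.ext fun _ => rfl

theorem rotOp_comm (a : H →L[ℝ] H) : Commute (diagOp a) (rotOp H) :=
  ContinuousLinearMap.ext fun _ => congrArg (mk · _) (map_neg a _)

theorem star_diagOp [CompleteSpace H] (a : H →L[ℝ] H) : star (diagOp a) = diagOp (star a) := by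
  rw [ContinuousLinearMap.star_eq_adjoint, ContinuousLinearMap.star_eq_adjoint, eq_comm,
    ContinuousLinearMap.eq_adjoint_iff]
  intro x y
  rw [inner_eq, inner_eq]
  exact congrArg₂ (· + ·) (ContinuousLinearMap.adjoint_inner_left _ _ _)
    (ContinuousLinearMap.adjoint_inner_left _ _ _)

theorem star_rotOp [CompleteSpace H] : star (rotOp H) = -rotOp H := by
  rw [ContinuousLinearMap.star_eq_adjoint, eq_comm, ContinuousLinearMap.eq_adjoint_iff]
  intro x y
  rw [inner_eq, inner_eq]
  change inner ℝ (-(-x.snd)) y.fst + inner ℝ (-x.fst) y.snd =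
    inner ℝ x.fst (-y.snd) + inner ℝ x.snd y.fst
  rw [neg_neg, inner_neg_left, inner_neg_right, add_comm]

end Doubling

section Complexification

variable (A : Type v) [NormedRing A] [NormedAlgebra ℝ A] [StarRing A] [StarModule ℝ A]

/-- A faithful representation of `A ⊗ ℂ` in an algebra with a `C*`-norm which induces the topology
of `A × A` on `A ⊗ ℂ`. -/
structure CplxRep where
  T : Type v
  [normedRing : NormedRing T]
  [normedAlgebra : NormedAlgebra ℝ T]
  [starRing : StarRing T]
  [cstarRing : CStarRing T]
  π : A ⊗[ℝ] ℂ →ₐ[ℝ] T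
  map_star : ∀ z, π (star z) = star (π z)
  norm_le : ∀ a b : A, ‖π (a ⊗ₜ 1 + b ⊗ₜ Complex.I)‖ ≤ ‖a‖ + ‖b‖
  le_norm_left : ∀ a b : A, ‖a‖ ≤ ‖π (a ⊗ₜ 1 + b ⊗ₜ Complex.I)‖
  le_norm_right : ∀ a b : A, ‖b‖ ≤ ‖π (a ⊗ₜ 1 + b ⊗ₜ Complex.I)‖

attribute [instance] CplxRep.normedRing CplxRep.normedAlgebra CplxRep.starRing CplxRep.cstarRing

/-- If `A` acts on the real Hilbert space `H`, then `A ⊗ ℂ` acts on `H ⊕ H`, with `i` acting by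
`(x, y) ↦ (-y, x)`. The image of `(x, 0)` under `a + i b` is `(a x, b x)`, which bounds the norms
of `a` and `b` by that of `a + i b`. -/
theorem nonempty_cplxRep [IsRealCStarAlgebra A] : Nonempty (CplxRep A) := by
  obtain ⟨H, _, _, _, f, hf⟩ := IsRealCStarAlgebra.exists_isometry (A := A)
  let r : ℂ →ₐ[ℝ] (Doubled H →L[ℝ] Doubled H) := Complex.lift ⟨rotOp H, rotOp_mul_self⟩
  have hr : ∀ z : ℂ, r z = z.re • (1 : Doubled H →L[ℝ] Doubled H) + z.im • rotOp H := fun z => by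
    simp [r, Complex.liftAux_apply, Algebra.algebraMap_eq_smul_one]
  have hcomm : ∀ (a : H →L[ℝ] H) z, Commute (diagOp a) (r z) := fun a z => by
    rw [hr]
    exact ((Commute.one_right _).smul_right _).add_right ((rotOp_comm a).smul_right _)
  let π : A ⊗[ℝ] ℂ →ₐ[ℝ] (Doubled H →L[ℝ] Doubled H) :=
    Algebra.TensorProduct.lift (diagOp.comp f.toAlgHom) r fun a z => hcomm (f a) z
  have hπ : ∀ (a : A) (z : ℂ), π (a ⊗ₜ z) = diagOp (f a) * r z := fun a z =>
    Algebra.TensorProduct.lift_tmul _ _ _ _ _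
  have hrI : r Complex.I = rotOp H := by
    rw [hr, Complex.I_re, Complex.I_im, zero_smul, one_smul, zero_add]
  have hπ' : ∀ a b : A, π (a ⊗ₜ 1 + b ⊗ₜ Complex.I) = diagOp (f a) + diagOp (f b) * rotOp H :=
    fun a b => by rw [map_add, hπ, hπ, hrI, map_one, mul_one]
  have hnorm : ∀ a, ‖f a‖ = ‖a‖ := fun a => hf.norm_map_of_map_zero (map_zero f) a
  have happly : ∀ (a b : A) (x : H), (diagOp (f a) + diagOp (f b) * rotOp H) (Doubled.mk x 0) =
      Doubled.mk (f a x) (f b x) := fun a b x => by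
    change Doubled.mk (f a x) (f a 0) + Doubled.mk (f b (-0)) (f b x) = _
    rw [Doubled.mk_add, neg_zero, map_zero, map_zero, add_zero, zero_add]
  refine ⟨{
    T := Doubled H →L[ℝ] Doubled H
    π := π
    map_star := fun z => ?_
    norm_le := fun a b => ?_
    le_norm_left := fun a b => ?_
    le_norm_right := fun a b => ?_ }⟩
  · induction z using TensorProduct.induction_on with
    | zero => rw [star_zero, map_zero, star_zero]
    | add z w hz hw => rw [star_add, map_add, map_add, star_add, hz, hw]
    | tmul a z =>
      have h1 : star (r z) = r (star z) := by
        rw [hr, hr, star_add, star_smul, star_smul, star_one, star_rotOp]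
        simp
      rw [TensorProduct.star_tmul, hπ, hπ, star_mul, h1, star_diagOp, map_star]
      exact (hcomm _ _).eq
  · rw [hπ']
    refine (norm_add_le _ _).trans (add_le_add ((norm_diagMap_le _).trans (hnorm a).le) ?_)
    refine (norm_mul_le _ _).trans ?_
    calc _ ≤ ‖b‖ * 1 := mul_le_mul ((norm_diagMap_le _).trans (hnorm b).le) norm_rotOp_le
          (norm_nonneg _) (norm_nonneg _)
      _ = ‖b‖ := mul_one _
  · rw [hπ', ← hnorm a]
    refine ContinuousLinearMap.opNorm_le_bound _ (norm_nonneg _) fun x => ?_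
    have h1 := (diagOp (f a) + diagOp (f b) * rotOp H).le_opNorm (Doubled.mk x 0)
    rw [happly, Doubled.norm_mk_zero] at h1
    exact (Doubled.norm_fst_le _).trans h1
  · rw [hπ', ← hnorm b]
    refine ContinuousLinearMap.opNorm_le_bound _ (norm_nonneg _) fun x => ?_
    have h1 := (diagOp (f a) + diagOp (f b) * rotOp H).le_opNorm (Doubled.mk x 0)
    rw [happly, Doubled.norm_mk_zero] at h1
    exact (Doubled.norm_snd_le _).trans h1

/-- The complexification `A ⊗ ℂ` of a real `C*`-algebra, as a complex `C*`-algebra. This is a copy of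
the tensor product, which carries the topology of a norm rather than `tensorTopology`. -/
def Cplx : Type v := A ⊗[ℝ] ℂ

namespace Cplx

instance : Ring (Cplx A) := inferInstanceAs (Ring (A ⊗[ℝ] ℂ))

instance : StarRing (Cplx A) := inferInstanceAs (StarRing (A ⊗[ℝ] ℂ))

variable {A}

/-- The identity, as a map to the complexification. -/
def ofTensor : A ⊗[ℝ] ℂ ≃+* Cplx A := RingEquiv.refl _

theorem eq_add (z : A ⊗[ℝ] ℂ) :
    z = slice ℂ Complex.reLm z ⊗ₜ 1 + slice ℂ Complex.imLm z ⊗ₜ Complex.I := by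
  induction z using TensorProduct.induction_on with
  | zero => simp
  | add z w hz hw =>
    rw [map_add, map_add, TensorProduct.add_tmul, TensorProduct.add_tmul]
    nth_rewrite 1 [hz, hw]
    abel
  | tmul a z =>
    rw [slice_tmul, slice_tmul, TensorProduct.smul_tmul, TensorProduct.smul_tmul,
      ← TensorProduct.tmul_add]
    congr 1
    apply Complex.ext <;> simp

variable [IsRealCStarAlgebra A]

variable (A) in
/-- A chosen representation. -/
def rep : CplxRep A := Classical.choice (nonempty_cplxRep A)

variable (A) in
/-- The chosen representation as a ring homomorphism on the complexification. -/
def repHom : Cplx A →+* (rep A).T := (rep A).π.toRingHom.comp (ofTensor (A := A)).symm.toRingHom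

theorem repHom_injective : Function.Injective (repHom A) := by
  rw [injective_iff_map_eq_zero]
  intro z hz
  obtain ⟨z, rfl⟩ := (ofTensor (A := A)).surjective z
  change (rep A).π z = 0 at hz
  have h1 := (rep A).le_norm_left (slice ℂ Complex.reLm z) (slice ℂ Complex.imLm z)
  have h2 := (rep A).le_norm_right (slice ℂ Complex.reLm z) (slice ℂ Complex.imLm z)
  rw [← eq_add, hz, norm_zero, norm_le_zero_iff] at h1 h2
  rw [eq_add z, h1, h2, TensorProduct.zero_tmul, TensorProduct.zero_tmul, add_zero, map_zero]

instance : NormedRing (Cplx A) := NormedRing.induced (Cplx A) (rep A).T (repHom A) repHom_injective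

theorem norm_def (z : Cplx A) : ‖z‖ = ‖repHom A z‖ := rfl

theorem repHom_star (z : Cplx A) : repHom A (star z) = star (repHom A z) := (rep A).map_star z

instance : CStarRing (Cplx A) where
  norm_mul_self_le z := by
    rw [norm_def, norm_def, map_mul, repHom_star]
    exact CStarRing.norm_mul_self_le _

/-- The scalars. -/
def scalar : ℂ →+* Cplx A :=
  ofTensor.toRingHom.comp (Algebra.TensorProduct.includeRight (R := ℝ) (A := A)).toRingHom

theorem scalar_comm (c : ℂ) (z : Cplx A) : scalar c * z = z * scalar c := by
  obtain ⟨z, rfl⟩ := (ofTensor (A := A)).surjective z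
  change ofTensor ((1 : A) ⊗ₜ[ℝ] c) * _ = _ * ofTensor ((1 : A) ⊗ₜ[ℝ] c)
  rw [← map_mul, ← map_mul]
  congr 1
  induction z using TensorProduct.induction_on with
  | zero => simp
  | add z w hz hw => rw [mul_add, add_mul, hz, hw]
  | tmul a z => simp [mul_comm]

instance : Algebra ℂ (Cplx A) := RingHom.toAlgebra' scalar scalar_comm

theorem smul_def (c : ℂ) (z : Cplx A) : c • z = scalar c * z := rfl

theorem star_scalar (c : ℂ) : star (scalar c : Cplx A) = scalar (star c) := by
  change ofTensor (star ((1 : A) ⊗ₜ[ℝ] c)) = ofTensor ((1 : A) ⊗ₜ[ℝ] star c)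
  rw [TensorProduct.star_tmul, star_one]

theorem scalar_ofReal (r : ℝ) : (scalar (r : ℂ) : Cplx A) = ofTensor (algebraMap ℝ _ r) := by
  change ofTensor ((1 : A) ⊗ₜ[ℝ] (algebraMap ℝ ℂ r)) = _
  congr 1
  exact (Algebra.TensorProduct.algebraMap_apply' r).symm

theorem norm_scalar_le (c : ℂ) : ‖(scalar c : Cplx A)‖ ≤ ‖c‖ := by
  have h1 : ‖(1 : (rep A).T)‖ ≤ 1 := by
    have h2 := CStarRing.norm_star_mul_self (x := (1 : (rep A).T))
    rw [star_one, one_mul] at h2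
    nlinarith [norm_nonneg (1 : (rep A).T)]
  refine le_of_sq_le_sq ?_ (norm_nonneg c)
  have h3 : star c * c = ((‖c‖ ^ 2 : ℝ) : ℂ) := by
    rw [Complex.star_def, Complex.conj_mul', Complex.ofReal_pow]
  rw [sq, ← CStarRing.norm_star_mul_self, star_scalar, ← map_mul, h3, scalar_ofReal, norm_def]
  change ‖(rep A).π (algebraMap ℝ _ _)‖ ≤ _
  rw [AlgHom.commutes, norm_algebraMap]
  calc _ ≤ ‖‖c‖ ^ 2‖ * 1 := mul_le_mul_of_nonneg_left h1 (norm_nonneg _)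
    _ = ‖c‖ ^ 2 := by simp

instance : NormedAlgebra ℂ (Cplx A) where
  norm_smul_le c z := (norm_mul_le _ _).trans
    (mul_le_mul_of_nonneg_right (norm_scalar_le c) (norm_nonneg z))

instance : StarModule ℂ (Cplx A) where
  star_smul c z := by rw [smul_def, star_mul, star_scalar, ← scalar_comm, smul_def]

theorem norm_slice_re_le (z : A ⊗[ℝ] ℂ) : ‖slice ℂ Complex.reLm z‖ ≤ ‖ofTensor z‖ := by
  have h1 := (rep A).le_norm_left (slice ℂ Complex.reLm z) (slice ℂ Complex.imLm z)
  rwa [← eq_add] at h1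

theorem norm_slice_im_le (z : A ⊗[ℝ] ℂ) : ‖slice ℂ Complex.imLm z‖ ≤ ‖ofTensor z‖ := by
  have h1 := (rep A).le_norm_right (slice ℂ Complex.reLm z) (slice ℂ Complex.imLm z)
  rwa [← eq_add] at h1

theorem norm_ofTensor_le (z : A ⊗[ℝ] ℂ) :
    ‖ofTensor z‖ ≤ ‖slice ℂ Complex.reLm z‖ + ‖slice ℂ Complex.imLm z‖ := by
  have h1 := (rep A).norm_le (slice ℂ Complex.reLm z) (slice ℂ Complex.imLm z)
  rwa [← eq_add] at h1

variable (A) in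
/-- The real part. -/
def re : Cplx A →+ A := (slice ℂ Complex.reLm).toAddMonoidHom.comp
  (ofTensor (A := A)).symm.toAddEquiv.toAddMonoidHom

variable (A) in
/-- The imaginary part. -/
def im : Cplx A →+ A := (slice ℂ Complex.imLm).toAddMonoidHom.comp
  (ofTensor (A := A)).symm.toAddEquiv.toAddMonoidHom

theorem lipschitz_re : LipschitzWith 1 (re A) := LipschitzWith.of_dist_le_mul fun z w => by
  rw [dist_eq_norm, dist_eq_norm, ← map_sub, NNReal.coe_one, one_mul]
  exact norm_slice_re_le _

theorem lipschitz_im : LipschitzWith 1 (im A) := LipschitzWith.of_dist_le_mul fun z w => by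
  rw [dist_eq_norm, dist_eq_norm, ← map_sub, NNReal.coe_one, one_mul]
  exact norm_slice_im_le _

theorem norm_le_re_add_im (z : Cplx A) : ‖z‖ ≤ ‖re A z‖ + ‖im A z‖ := norm_ofTensor_le z

/-- The element with given real and imaginary parts. -/
def mk (a b : A) : Cplx A := ofTensor (a ⊗ₜ 1 + b ⊗ₜ Complex.I)

@[simp] theorem re_mk (a b : A) : re A (mk a b) = a := by
  change slice ℂ Complex.reLm (a ⊗ₜ 1 + b ⊗ₜ Complex.I) = a
  simp

@[simp] theorem im_mk (a b : A) : im A (mk a b) = b := by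
  change slice ℂ Complex.imLm (a ⊗ₜ 1 + b ⊗ₜ Complex.I) = b
  simp

open Filter Topology in
theorem tendsto_iff {α : Type*} {l : Filter α} {u : α → Cplx A} {z : Cplx A} :
    Tendsto u l (𝓝 z) ↔ Tendsto (fun n => re A (u n)) l (𝓝 (re A z)) ∧
      Tendsto (fun n => im A (u n)) l (𝓝 (im A z)) := by
  refine ⟨fun h => ⟨(lipschitz_re.continuous.tendsto z).comp h,
    (lipschitz_im.continuous.tendsto z).comp h⟩, fun ⟨h1, h2⟩ => ?_⟩
  rw [tendsto_iff_norm_sub_tendsto_zero] at h1 h2 ⊢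
  refine squeeze_zero (fun _ => norm_nonneg _) (fun n => ?_) (by simpa using h1.add h2)
  rw [← map_sub, ← map_sub]
  exact norm_le_re_add_im _

theorem continuous_iff {Y : Type*} [TopologicalSpace Y] {u : Y → Cplx A} :
    Continuous u ↔ Continuous (fun y => re A (u y)) ∧ Continuous fun y => im A (u y) := by
  simp only [continuous_iff_continuousAt, ContinuousAt, tendsto_iff, forall_and]

instance : CompleteSpace (Cplx A) := by
  have : CompleteSpace A := IsRealCStarAlgebra.complete
  refine Metric.complete_of_cauchySeq_tendsto fun u hu => ?_
  obtain ⟨a, ha⟩ := cauchySeq_tendsto_of_complete ((lipschitz_re (A := A)).uniformContinuous.comp_cauchySeq hu)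
  obtain ⟨b, hb⟩ := cauchySeq_tendsto_of_complete ((lipschitz_im (A := A)).uniformContinuous.comp_cauchySeq hu)
  refine ⟨mk a b, tendsto_iff.2 ?_⟩
  rw [re_mk, im_mk]
  exact ⟨ha, hb⟩

instance : CStarAlgebra (Cplx A) where

instance : PartialOrder (Cplx A) := CStarAlgebra.spectralOrder _

instance : StarOrderedRing (Cplx A) := CStarAlgebra.spectralOrderedRing _

variable (A) in
/-- The algebra `A ⊗ ℂ` with its tensor product topology is isomorphic to the `C*`-algebra
`Cplx A`. -/
def equiv : A ⊗[ℝ] ℂ ≃A[ℝ] Cplx A where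
  toAlgEquiv := AlgEquiv.ofRingEquiv (f := ofTensor) fun r => by
    rw [← scalar_ofReal, Algebra.algebraMap_eq_smul_one, ← Complex.coe_smul, smul_def, mul_one]
  continuous_toFun := continuous_iff.2 ⟨continuous_tensor.1 continuous_id Complex.reLm,
    continuous_tensor.1 continuous_id Complex.imLm⟩
  continuous_invFun := continuous_tensor.2 fun f => by
    have h1 : Continuous fun z : Cplx A => f 1 • re A z + f Complex.I • im A z :=
      (lipschitz_re.continuous.const_smul _).add (lipschitz_im.continuous.const_smul _)
    refine h1.congr fun z => ?_
    change _ = slice ℂ f (z : A ⊗[ℝ] ℂ)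
    conv_rhs => rw [eq_add (A := A) z]
    rw [map_add, slice_tmul, slice_tmul]
    rfl

theorem equiv_star (z : A ⊗[ℝ] ℂ) : equiv A (star z) = star (equiv A z) := rfl

end Cplx

end Complexification

/-! ### Adjoining `j` to tensor products with `ℂ` -/

section TensorExt

namespace JExt

variable {a d : Type*} [Ring a] [Algebra ℝ a] [Ring d] [Algebra ℝ d] {σ : a →ₐ[ℝ] a} {ε : ℤˣ}

/-- Replacing the automorphism `σ` by an equal one. -/
def congr (K : JExt a d σ ε) {σ' : a →ₐ[ℝ] a} (hσ : ∀ b, σ b = σ' b) :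
    JExt a d σ' ε where
  ι := K.ι
  j := K.j
  j_mul_j := K.j_mul_j
  j_mul b := by rw [K.j_mul, hσ]
  α := K.α
  β := K.β
  eq := K.eq
  α_eq := K.α_eq
  β_eq := K.β_eq

@[simp] theorem α_ι_mul_j (K : JExt a d σ ε) (c : a) : K.α (K.ι c * K.j) = 0 := by
  simpa using K.α_eq 0 c

@[simp] theorem β_ι_mul_j (K : JExt a d σ ε) (c : a) : K.β (K.ι c * K.j) = c := by
  simpa using K.β_eq 0 c

section Linear

-- The extension is one of `ℝ`-algebras: the ring homomorphism `K.ι` is `ℝ`-linear.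
variable (K : JExt a d σ ε) {ι : a →ₐ[ℝ] d} (hι : ∀ b, K.ι b = ι b)

include hι in
theorem smul_eq (r : ℝ) (x : d) : r • x = K.ι (r • K.α x) + K.ι (r • K.β x) * K.j := by
  rw [hι, hι, map_smul, map_smul, smul_mul_assoc, ← smul_add, ← hι, ← hι, ← K.eq]

/-- `α` as an `ℝ`-linear map. -/
def αₗ : d →ₗ[ℝ] a where
  toFun := K.α
  map_add' := map_add K.α
  map_smul' r x := by rw [K.smul_eq hι, K.α_eq, RingHom.id_apply]

/-- `β` as an `ℝ`-linear map. -/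
def βₗ : d →ₗ[ℝ] a where
  toFun := K.β
  map_add' := map_add K.β
  map_smul' r x := by rw [K.smul_eq hι, K.β_eq, RingHom.id_apply]

/-- The extension of `B ⊗ a` obtained from an extension of `a`. -/
def tensor (B : Type*) [Ring B] [Algebra ℝ B] :
    JExt (B ⊗[ℝ] a) (B ⊗[ℝ] d) (Algebra.TensorProduct.map (AlgHom.id ℝ B) σ) ε where
  ι := (Algebra.TensorProduct.map (AlgHom.id ℝ B) ι).toRingHom
  j := 1 ⊗ₜ K.j
  j_mul_j := by
    rw [Algebra.TensorProduct.tmul_mul_tmul, K.j_mul_j, one_mul]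
    exact map_intCast (Algebra.TensorProduct.includeRight : d →ₐ[ℝ] B ⊗[ℝ] d) _
  j_mul x := by
    change _ * Algebra.TensorProduct.map (AlgHom.id ℝ B) ι x =
      Algebra.TensorProduct.map (AlgHom.id ℝ B) ι _ * _
    induction x with
    | zero => simp
    | add x y hx hy => rw [map_add, map_add, map_add, mul_add, add_mul, hx, hy]
    | tmul b z => simp [← hι, K.j_mul]
  α := ((K.αₗ hι).lTensor B).toAddMonoidHom
  β := ((K.βₗ hι).lTensor B).toAddMonoidHom
  eq x := by
    change x = Algebra.TensorProduct.map (AlgHom.id ℝ B) ι ((K.αₗ hι).lTensor B x) +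
      Algebra.TensorProduct.map (AlgHom.id ℝ B) ι ((K.βₗ hι).lTensor B x) * _
    induction x with
    | zero => simp
    | add x y hx hy =>
      conv_lhs => rw [hx, hy]
      simp only [map_add, add_mul]
      abel
    | tmul b x =>
      simp only [LinearMap.lTensor_tmul, Algebra.TensorProduct.map_tmul, AlgHom.id_apply, ← hι,
        Algebra.TensorProduct.tmul_mul_tmul, mul_one, ← TensorProduct.tmul_add]
      exact congrArg (b ⊗ₜ[ℝ] ·) (K.eq x)
  α_eq x y := by
    change (K.αₗ hι).lTensor B (Algebra.TensorProduct.map (AlgHom.id ℝ B) ι x +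
      Algebra.TensorProduct.map (AlgHom.id ℝ B) ι y * _) = x
    rw [map_add]
    have h1 : (K.αₗ hι).lTensor B (Algebra.TensorProduct.map (AlgHom.id ℝ B) ι x) = x := by
      induction x with
      | zero => simp
      | add x y hx hy => rw [map_add, map_add, hx, hy]
      | tmul b x => simp [αₗ, ← hι]
    have h2 : (K.αₗ hι).lTensor B
        (Algebra.TensorProduct.map (AlgHom.id ℝ B) ι y * 1 ⊗ₜ K.j) = 0 := by
      induction y with
      | zero => simp
      | add x y hx hy => rw [map_add, add_mul, map_add, hx, hy, add_zero]
      | tmul b x => simp [αₗ, ← hι]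
    rw [h1, h2, add_zero]
  β_eq x y := by
    change (K.βₗ hι).lTensor B (Algebra.TensorProduct.map (AlgHom.id ℝ B) ι x +
      Algebra.TensorProduct.map (AlgHom.id ℝ B) ι y * _) = y
    rw [map_add]
    have h1 : (K.βₗ hι).lTensor B (Algebra.TensorProduct.map (AlgHom.id ℝ B) ι x) = 0 := by
      induction x with
      | zero => simp
      | add x y hx hy => rw [map_add, map_add, hx, hy, add_zero]
      | tmul b x => simp [βₗ, ← hι]
    have h2 : (K.βₗ hι).lTensor B
        (Algebra.TensorProduct.map (AlgHom.id ℝ B) ι y * 1 ⊗ₜ K.j) = y := by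
      induction y with
      | zero => simp
      | add x y hx hy => rw [map_add, add_mul, map_add, hx, hy]
      | tmul b x => simp [βₗ, ← hι]
    rw [h1, h2, zero_add]

end Linear

end JExt

/-- `slice_map` for maps between different algebras. -/
theorem slice_map_of_hom {D D' : Type} [Ring D] [Algebra ℝ D] [Ring D'] [Algebra ℝ D']
    {A B : Type v} [Ring A] [Algebra ℝ A] [Ring B] [Algebra ℝ B]
    (g : A →ₗ[ℝ] B) (h : D →ₗ[ℝ] D') (f : D' →ₗ[ℝ] ℝ) (t : A ⊗[ℝ] D) :
    slice D' f (TensorProduct.map g h t) = g (slice D (f ∘ₗ h) t) := by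
  induction t with
  | zero => simp
  | tmul a d => simp
  | add a b ha hb => simp [ha, hb]

theorem continuous_tensorMap {D D' : Type} [Ring D] [Algebra ℝ D] [Ring D'] [Algebra ℝ D']
    {A : Type v} [Ring A] [Algebra ℝ A] [TopologicalSpace A] (h : D →ₗ[ℝ] D') :
    Continuous (h.lTensor A) :=
  continuous_tensor.2 fun f =>
    (continuous_tensor.1 continuous_id (f ∘ₗ h)).congr fun t =>
      (slice_map_of_hom LinearMap.id h f t).symm

end TensorExt

/-! ### The extensions of `ℂ` by `M₂(ℝ)` and `ℍ` -/

theorem iotaPlus_apply (z : ℂ) : iotaPlus z = !![z.re, -z.im; z.im, z.re] := by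
  have h : iotaPlus z = algebraMap ℝ M2 z.re + z.im • !![0, -1; 1, 0] := rfl
  rw [h]
  ext k l
  fin_cases k <;> fin_cases l <;> simp [Matrix.algebraMap_matrix_apply]

theorem quatI_coords : quatI.re = 0 ∧ quatI.imI = 1 ∧ quatI.imJ = 0 ∧ quatI.imK = 0 :=
  ⟨rfl, rfl, rfl, rfl⟩

theorem quatJ_coords : quatJ.re = 0 ∧ quatJ.imI = 0 ∧ quatJ.imJ = 1 ∧ quatJ.imK = 0 :=
  ⟨rfl, rfl, rfl, rfl⟩

theorem iotaMinus_coords (z : ℂ) : (iotaMinus z).re = z.re ∧ (iotaMinus z).imI = z.im ∧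
    (iotaMinus z).imJ = 0 ∧ (iotaMinus z).imK = 0 := by
  have h : iotaMinus z = algebraMap ℝ ℍ[ℝ] z.re + z.im • quatI := rfl
  simp [h, quatI_coords]

/-- The embedding `ℂ → ℍ` with `i ↦ j`. -/
def iotaQuat : ℂ →ₐ[ℝ] ℍ[ℝ] := Complex.lift ⟨quatJ, quatJ_mul_self⟩

theorem iotaQuat_coords (z : ℂ) : (iotaQuat z).re = z.re ∧ (iotaQuat z).imI = 0 ∧
    (iotaQuat z).imJ = z.im ∧ (iotaQuat z).imK = 0 := by
  have h : iotaQuat z = algebraMap ℝ ℍ[ℝ] z.re + z.im • quatJ := rfl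
  simp [h, quatJ_coords]

/-- `M₂(ℝ)` is obtained from `ℂ` by adjoining `j` with `j² = 1`. -/
def plusExt : JExt ℂ M2 Complex.conjAe.toAlgHom 1 where
  ι := iotaPlus.toRingHom
  j := jPlus
  j_mul_j := by
    rw [Units.val_one, Int.cast_one]
    exact jPlus.val_inv
  j_mul z := by
    change (jPlus : M2) * iotaPlus z = iotaPlus ((starRingEnd ℂ) z) * jPlus
    rw [iotaPlus_apply, iotaPlus_apply]
    ext k l
    fin_cases k <;> fin_cases l <;> simp [jPlus]
  α :=
    { toFun := fun m => ⟨(m 0 0 + m 1 1) / 2, (m 1 0 - m 0 1) / 2⟩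
      map_zero' := by apply Complex.ext <;> simp
      map_add' := fun m n => by apply Complex.ext <;> simp <;> ring }
  β :=
    { toFun := fun m => ⟨(m 0 0 - m 1 1) / 2, (m 1 0 + m 0 1) / 2⟩
      map_zero' := by apply Complex.ext <;> simp
      map_add' := fun m n => by apply Complex.ext <;> simp <;> ring }
  eq m := by
    change m = iotaPlus _ + iotaPlus _ * jPlus
    rw [iotaPlus_apply, iotaPlus_apply]
    ext k l
    fin_cases k <;> fin_cases l <;> simp [jPlus] <;> ring
  α_eq b c := by
    change Complex.mk (((iotaPlus b + iotaPlus c * jPlus : M2) 0 0 +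
      (iotaPlus b + iotaPlus c * jPlus : M2) 1 1) / 2) (((iotaPlus b + iotaPlus c * jPlus : M2) 1 0 -
      (iotaPlus b + iotaPlus c * jPlus : M2) 0 1) / 2) = b
    rw [iotaPlus_apply, iotaPlus_apply]
    apply Complex.ext <;> simp [jPlus]
    ring
  β_eq b c := by
    change Complex.mk (((iotaPlus b + iotaPlus c * jPlus : M2) 0 0 -
      (iotaPlus b + iotaPlus c * jPlus : M2) 1 1) / 2) (((iotaPlus b + iotaPlus c * jPlus : M2) 1 0 +
      (iotaPlus b + iotaPlus c * jPlus : M2) 0 1) / 2) = c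
    rw [iotaPlus_apply, iotaPlus_apply]
    apply Complex.ext <;> simp [jPlus]
    ring

/-- `ℍ` is obtained from `ℂ = ℝ[i]` by adjoining `j` with `j² = -1`. -/
def minusExt : JExt ℂ ℍ[ℝ] Complex.conjAe.toAlgHom (-1) where
  ι := iotaMinus.toRingHom
  j := jMinus
  j_mul_j := by
    rw [Units.val_neg, Units.val_one, Int.cast_neg, Int.cast_one]
    exact quatJ_mul_self
  j_mul z := by
    change quatJ * iotaMinus z = iotaMinus ((starRingEnd ℂ) z) * quatJ
    ext <;> simp [iotaMinus_coords, quatJ_coords]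
  α :=
    { toFun := fun q => ⟨q.re, q.imI⟩
      map_zero' := rfl
      map_add' := fun _ _ => rfl }
  β :=
    { toFun := fun q => ⟨q.imJ, q.imK⟩
      map_zero' := rfl
      map_add' := fun _ _ => rfl }
  eq q := by
    change q = iotaMinus ⟨q.re, q.imI⟩ + iotaMinus ⟨q.imJ, q.imK⟩ * quatJ
    ext <;> simp [iotaMinus_coords, quatJ_coords]
  α_eq b c := by
    change Complex.mk (iotaMinus b + iotaMinus c * quatJ).re (iotaMinus b + iotaMinus c * quatJ).imI
      = b
    apply Complex.ext <;> simp [iotaMinus_coords, quatJ_coords]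
  β_eq b c := by
    change Complex.mk (iotaMinus b + iotaMinus c * quatJ).imJ (iotaMinus b + iotaMinus c * quatJ).imK
      = c
    apply Complex.ext <;> simp [iotaMinus_coords, quatJ_coords]

/-- `ℍ` is obtained from `ℂ = ℝ[j]` by adjoining `i` with `i² = -1`. -/
def quatExt : JExt ℂ ℍ[ℝ] Complex.conjAe.toAlgHom (-1) where
  ι := iotaQuat.toRingHom
  j := quatI
  j_mul_j := by
    rw [Units.val_neg, Units.val_one, Int.cast_neg, Int.cast_one]
    exact quatI_mul_self
  j_mul z := by
    change quatI * iotaQuat z = iotaQuat ((starRingEnd ℂ) z) * quatI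
    ext <;> simp [iotaQuat_coords, quatI_coords]
  α :=
    { toFun := fun q => ⟨q.re, q.imJ⟩
      map_zero' := rfl
      map_add' := fun _ _ => rfl }
  β :=
    { toFun := fun q => ⟨q.imI, -q.imK⟩
      map_zero' := by apply Complex.ext <;> simp
      map_add' := fun p q => by apply Complex.ext <;> simp [add_comm] }
  eq q := by
    change q = iotaQuat ⟨q.re, q.imJ⟩ + iotaQuat ⟨q.imI, -q.imK⟩ * quatI
    ext <;> simp [iotaQuat_coords, quatI_coords]
  α_eq b c := by
    change Complex.mk (iotaQuat b + iotaQuat c * quatI).re (iotaQuat b + iotaQuat c * quatI).imJ = b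
    apply Complex.ext <;> simp [iotaQuat_coords, quatI_coords]
  β_eq b c := by
    change Complex.mk (iotaQuat b + iotaQuat c * quatI).imI (-(iotaQuat b + iotaQuat c * quatI).imK)
      = c
    apply Complex.ext <;> simp [iotaQuat_coords, quatI_coords]

/-! ### The correspondence over `𝒜⁰ ⊗ ℂ` -/

section Instances

variable {X : Type u} [TopologicalSpace X] [InvolutiveSpace X] {A : Type v} [NormedRing A]
  [NormedAlgebra ℝ A] [StarRing A] [StarModule ℝ A] [IsRealCStarAlgebra A]
  (𝒜 : RealStarAlgebraBundle X A) {D : Type} [Ring D] [Algebra ℝ D] {ε : ℤˣ}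

theorem continuous_tensor_add {Y : Type*} [TopologicalSpace Y] {f g : Y → A ⊗[ℝ] D}
    (hf : Continuous f) (hg : Continuous g) : Continuous fun y => f y + g y :=
  continuous_tensor.2 fun l => ((continuous_tensor.1 hf l).add (continuous_tensor.1 hg l)).congr
    fun _ => (map_add _ _ _).symm

/-- For `𝒜⁰ ⊗ ℂ` the composition of the two anti-involutions is `a ⊗ z ↦ a ⊗ conj z`, which is
conjugation by `j`. -/
theorem twist_hermitian_dagger (x : X) (b : 𝒜.fiber x ⊗[ℝ] ℂ) :
    Algebra.TensorProduct.map (AlgHom.id ℝ (𝒜.fiber x)) Complex.conjAe.toAlgHom b =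
      twist 𝒜.dagger 𝒜.hermitian x b := by
  change _ = TensorProduct.map _ _ (TensorProduct.map _ _ b)
  induction b with
  | zero => simp
  | add b c hb hc => rw [map_add, map_add, map_add, hb, hc]
  | tmul b z => simp [starLinear, conjAnti, idAnti]

/-- An extension of `ℂ` by an element `j` as in `JExt` gives the setting `JData` for the bundles
`𝒜⁰ ⊗ ℂ` and `𝒜⁰ ⊗ D`. -/
def tensorJData (K : JExt ℂ D Complex.conjAe.toAlgHom ε) {ι : ℂ →ₐ[ℝ] D} (hι : ∀ z, K.ι z = ι z)
    (ρ : AlgInvolution D) (hρ : ∀ z, ρ.toAlgEquiv (ι z) = ι ((starRingEnd ℂ) z))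
    (hj : ρ.toAlgEquiv K.j = K.j) :
    JData (Cplx.equiv A) 𝒜.dagger 𝒜.hermitian ε (𝒜.toRealAlgebraBundle.tensor ρ) where
  isCStar x y a := by
    change 𝒜.fiber y ⊗[ℝ] ℂ at a
    change Cplx.equiv A (Algebra.TensorProduct.congr ((𝒜.chartAt x).iso y) AlgEquiv.refl
        (TensorProduct.map (starLinear (𝒜.fiber y)) conjAnti.toLinearMap a)) =
      star (Cplx.equiv A (Algebra.TensorProduct.congr ((𝒜.chartAt x).iso y) AlgEquiv.refl a))
    rw [← Cplx.equiv_star]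
    congr 1
    induction a with
    | zero => simp
    | add a b ha hb => rw [map_add, map_add, map_add, star_add, ha, hb]
    | tmul a z =>
      simpa [starLinear, conjAnti, TensorProduct.star_tmul] using
        congrArg (· ⊗ₜ[ℝ] (starRingEnd ℂ) z) (𝒜.chart_star x y a)
  comm x b := by
    change TensorProduct.map _ _ (TensorProduct.map _ _ b) =
      TensorProduct.map _ _ (TensorProduct.map _ _ b)
    change 𝒜.fiber x ⊗[ℝ] ℂ at b
    induction b with
    | zero => simp
    | add b c hb hc => rw [map_add, map_add, map_add, map_add, hb, hc]
    | tmul b z => simp [starLinear, conjAnti, idAnti]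
  ext x := (K.tensor hι (𝒜.fiber x)).congr (twist_hermitian_dagger 𝒜 x)
  conj_ι x b := by
    change Algebra.TensorProduct.map (𝒜.conj x) ρ.toAlgEquiv.toAlgHom
        (Algebra.TensorProduct.map (AlgHom.id ℝ (𝒜.fiber x)) ι b) =
      Algebra.TensorProduct.map (AlgHom.id ℝ (𝒜.fiber (bar x))) ι
        (Algebra.TensorProduct.map (𝒜.conj x) complexConj.toAlgEquiv.toAlgHom b)
    change 𝒜.fiber x ⊗[ℝ] ℂ at b
    induction b with
    | zero => simp
    | add b c hb hc => rw [map_add, map_add, map_add, map_add, hb, hc]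
    | tmul b z => simp [complexConj, hρ]
  conj_j x := by
    change Algebra.TensorProduct.map (𝒜.conj x) ρ.toAlgEquiv.toAlgHom (1 ⊗ₜ K.j) = 1 ⊗ₜ K.j
    simp [hj]
  σ := Algebra.TensorProduct.map (AlgHom.id ℝ A) Complex.conjAe.toAlgHom
  model := K.tensor hι A
  continuous_σ := continuous_tensorMap Complex.conjAe.toLinearMap
  continuous_α := continuous_tensorMap (K.αₗ hι)
  continuous_β := continuous_tensorMap (K.βₗ hι)
  continuous_mk := by
    have h1 : ∀ x : A ⊗[ℝ] ℂ, (K.tensor hι A).ι x * (K.tensor hι A).j =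
        (LinearMap.mulRight ℝ K.j ∘ₗ ι.toLinearMap).lTensor A x := by
      intro x
      change Algebra.TensorProduct.map (AlgHom.id ℝ A) ι x * 1 ⊗ₜ K.j = _
      induction x with
      | zero => simp
      | add x y hx hy => rw [map_add, add_mul, map_add, hx, hy]
      | tmul b x => simp
    refine continuous_tensor_add
      ((continuous_tensorMap ι.toLinearMap).comp continuous_fst) ?_
    simp only [h1]
    exact (continuous_tensorMap _).comp continuous_snd
  base_eq x := rfl
  chart_ι x y hy hy' b := by
    change Algebra.TensorProduct.congr ((𝒜.chartAt x).iso ⟨y, hy⟩) AlgEquiv.refl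
        (Algebra.TensorProduct.map (AlgHom.id ℝ (𝒜.fiber y)) ι b) =
      Algebra.TensorProduct.map (AlgHom.id ℝ A) ι
        (Algebra.TensorProduct.congr ((𝒜.chartAt x).iso ⟨y, hy⟩) AlgEquiv.refl b)
    change 𝒜.fiber y ⊗[ℝ] ℂ at b
    induction b with
    | zero => simp
    | add b c hb hc => rw [map_add, map_add, map_add, map_add, hb, hc]
    | tmul b z => simp
  chart_j x y hy := by
    change Algebra.TensorProduct.congr ((𝒜.chartAt x).iso ⟨y, hy⟩) AlgEquiv.refl (1 ⊗ₜ K.j) =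
      1 ⊗ₜ K.j
    simp

/-- The two notions of correspondence agree; they differ only in the way metrics are bundled. -/
theorem corresponds_iff_tensorJData (K : JExt ℂ D Complex.conjAe.toAlgHom ε) {ι : ℂ →ₐ[ℝ] D}
    (hι : ∀ z, K.ι z = ι z) (ρ : AlgInvolution D)
    (hρ : ∀ z, ρ.toAlgEquiv (ι z) = ι ((starRingEnd ℂ) z)) (hj : ρ.toAlgEquiv K.j = K.j)
    (E : SymBundle 𝒜.dagger ε) (F : RealBundle (𝒜.toRealAlgebraBundle.tensor ρ)) :
    Corresponds 𝒜 ρ ι K.j E F ↔ (tensorJData 𝒜 K hι ρ hρ hj).Corresponds E F :=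
  ⟨fun ⟨u, ψ, h⟩ => ⟨u, ⟨ψ.toSymForm, ψ.pos⟩, h⟩, fun ⟨u, ψ, h⟩ => ⟨u, ⟨ψ.toSymForm, ψ.pos⟩, h⟩⟩

/-- The correspondence between forms on Real `𝒜⁰ ⊗ ℂ`-bundles and Real `𝒜⁰ ⊗ D`-bundles, for an
algebra `D = ℂ + ℂ j` with `j² = ε` and an involution `ρ` that fixes `j` and extends complex
conjugation. -/
theorem correspondence [T2Space X] [ParacompactSpace X]
    (K : JExt ℂ D Complex.conjAe.toAlgHom ε) {ι : ℂ →ₐ[ℝ] D}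
    (hι : ∀ z, K.ι z = ι z) (ρ : AlgInvolution D)
    (hρ : ∀ z, ρ.toAlgEquiv (ι z) = ι ((starRingEnd ℂ) z)) (hj : ρ.toAlgEquiv K.j = K.j) :
    (∀ E : SymBundle 𝒜.dagger ε, ∃ F : RealBundle (𝒜.toRealAlgebraBundle.tensor ρ),
        Corresponds 𝒜 ρ ι K.j E F) ∧
      (∀ F : RealBundle (𝒜.toRealAlgebraBundle.tensor ρ), ∃ E : SymBundle 𝒜.dagger ε,
        Corresponds 𝒜 ρ ι K.j E F) ∧
      ∃! Φ : GR 𝒜.dagger ε ≃+ KR (𝒜.toRealAlgebraBundle.tensor ρ),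
        ∀ E F, Corresponds 𝒜 ρ ι K.j E F → Φ (GR.mk E) = KR.mk F := by
  simp only [corresponds_iff_tensorJData 𝒜 K hι ρ hρ hj]
  exact ⟨(tensorJData 𝒜 K hι ρ hρ hj).exists_corresponds_right,
    (tensorJData 𝒜 K hι ρ hρ hj).exists_corresponds_left,
    (tensorJData 𝒜 K hι ρ hρ hj).existsUnique_addEquiv⟩

end Instances

/-! ### The trivial bundle with fibre `ℂ` -/

section Quaternionic

variable (X : Type u) [TopologicalSpace X] [InvolutiveSpace X]

open scoped ComplexOrder in
/-- The setting `JData` for the trivial bundles with fibres `ℂ` and `ℍ`. The embedding of `ℂ` in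
`ℍ` has `i ↦ j`, so that conjugation by `i` induces complex conjugation. -/
def quatJData : JData (ContinuousAlgEquiv.refl ℝ ℂ)
    (AntiInvolution.trivial (X := X) continuous_complexConj idAnti continuous_id)
    (AntiInvolution.trivial (X := X) continuous_complexConj conjAnti Complex.continuous_conj) (-1)
    (RealAlgebraBundle.trivial X ℍ[ℝ] quatConjI continuous_quatConjI) where
  isCStar _ _ _ := rfl
  comm _ _ := rfl
  ext _ := quatExt.congr fun _ => rfl
  conj_ι _ z := by
    change quatI * iotaQuat z * -quatI = iotaQuat ((starRingEnd ℂ) z)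
    change ℂ at z
    ext <;> simp [iotaQuat_coords, quatI_coords]
  conj_j _ := by
    change quatI * quatI * -quatI = quatI
    rw [quatI_mul_self, neg_mul_neg, one_mul]
  σ := Complex.conjAe.toAlgHom
  model := quatExt
  continuous_σ := Complex.continuous_conj
  continuous_α := (quatExt.αₗ (ι := iotaQuat) fun _ => rfl).continuous_of_finiteDimensional
  continuous_β := (quatExt.βₗ (ι := iotaQuat) fun _ => rfl).continuous_of_finiteDimensional
  continuous_mk := by
    have h : Continuous iotaQuat := iotaQuat.toLinearMap.continuous_of_finiteDimensional
    exact (h.comp continuous_fst).add ((h.comp continuous_snd).mul continuous_const)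
  base_eq _ := rfl
  chart_ι _ _ _ _ _ := rfl
  chart_j _ _ _ := rfl

open scoped ComplexOrder in
/-- Skew-symmetric forms on Real vector bundles correspond to Real quaternionic bundles. -/
theorem nonempty_GRC_addEquiv_KRH [T2Space X] [ParacompactSpace X] :
    Nonempty (GRC X (-1) ≃+ KRH X) :=
  ⟨(quatJData X).existsUnique_addEquiv.choose⟩

end Quaternionic

end RealKTheory

end

open RealKTheory

theorem mainTheorem1 (X : Type u) [TopologicalSpace X] [T2Space X] [ParacompactSpace X]
    [InvolutiveSpace X] (A : Type v) [NormedRing A] [NormedAlgebra ℝ A] [StarRing A]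
    [StarModule ℝ A] [IsRealCStarAlgebra A] (𝒜 : RealStarAlgebraBundle X A) :
    ((∀ E : SymBundle 𝒜.dagger 1, ∃ F : RealBundle 𝒜.plus,
        Corresponds 𝒜 rhoPlus iotaPlus jPlus E F) ∧
      (∀ F : RealBundle 𝒜.plus, ∃ E : SymBundle 𝒜.dagger 1,
        Corresponds 𝒜 rhoPlus iotaPlus jPlus E F) ∧
      ∃! Φ : GR 𝒜.dagger 1 ≃+ KR 𝒜.plus,
        ∀ E F, Corresponds 𝒜 rhoPlus iotaPlus jPlus E F → Φ (GR.mk E) = KR.mk F) ∧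
    ((∀ E : SymBundle 𝒜.dagger (-1), ∃ F : RealBundle 𝒜.minus,
        Corresponds 𝒜 rhoMinus iotaMinus jMinus E F) ∧
      (∀ F : RealBundle 𝒜.minus, ∃ E : SymBundle 𝒜.dagger (-1),
        Corresponds 𝒜 rhoMinus iotaMinus jMinus E F) ∧
      ∃! Φ : GR 𝒜.dagger (-1) ≃+ KR 𝒜.minus,
        ∀ E F, Corresponds 𝒜 rhoMinus iotaMinus jMinus E F → Φ (GR.mk E) = KR.mk F) ∧
    Nonempty (GRC X (-1) ≃+ KRH X) := by
  refine ⟨correspondence 𝒜 plusExt (fun _ => rfl) rhoPlus (fun z => ?_) ?_,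
    correspondence 𝒜 minusExt (fun _ => rfl) rhoMinus (fun z => ?_) ?_,
    nonempty_GRC_addEquiv_KRH X⟩
  · change (jPlus : M2) * iotaPlus z * jPlus = iotaPlus ((starRingEnd ℂ) z)
    rw [iotaPlus_apply, iotaPlus_apply]
    ext k l
    fin_cases k <;> fin_cases l <;> simp [jPlus]
  · exact jPlus.mul_inv_cancel_right _
  · change quatJ * iotaMinus z * -quatJ = iotaMinus ((starRingEnd ℂ) z)
    ext <;> simp [iotaMinus_coords, quatJ_coords]
  · exact jMinus.mul_inv_cancel_right _
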